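/- Let $D\subset\mathbb R^2$ be a bounded open set and let $\nu,r,\beta>0$ satisfy $4\nu r>\beta^2|D|^2/\pi^2$. In the complex space $L^2=L^2(D)$, let $\Delta$ be the Laplacian with Dirichlet boundary condition, with domain $\{u\in H^1_0(D):\Delta u\in L^2(D)\}$, and let $A=-\nu\Delta+rI+\beta\,\partial_x\Delta^{-1}$ on the same domain. Let $e^{-At}$ be the semigroup generated by $-A$, and for $s>0$ put $A^{-s}=\frac1{\Gamma(s)}\int_0^\infty t^{s-1}e^{-At}\,dt$, $A^{s}=(A^{-s})^{-1}$, $A^0=I$. For $\gamma\in\mathbb R$ let $D(A^\gamma)$ be the Banach space with norm $\|x\|_\gamma=\|A^\gamma x\|_{L^2}$: the range of $A^{-\gamma}$ if $\gamma\ge 0$, and the completion of $L^2$ in this norm if $\gamma<0$. Let $\alpha,\gamma\in\mathbb R$ with $\alpha-\gamma<1$, let $f_0\in D(A^\gamma)$, and let $f:\mathbb R\to D(A^\gamma)$ be locally integrable. Assume that $f$ has the average $f_0$ in $D(A^\gamma)$: there are $M>0$ and a function $\sigma$ with $\sigma(T)\to0$ as $T\to\infty$ such that $$\Big\|\frac1T\int_t^{t+T}f(s)\,ds-f_0\Big\|_\gamma\le\min(M,\sigma(T))\qquad\text{for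 all }t\in\mathbb R,\ T>0.$$ Then for every $\varepsilon>0$ the equation $$\partial_\tau v=-\varepsilon Av+f_0-f,\qquad \tau\in\mathbb R,$$ (understood in integrated form in $D(A^{\alpha-1})$, for locally integrable $v:\mathbb R\to D(A^\alpha)$) has exactly one solution $v(\cdot,\varepsilon)$ that is bounded in $D(A^\alpha)$ on $\mathbb R$. This solution is continuous with values in $D(A^\alpha)$, and $$\sup_{\tau\in\mathbb R}\|\varepsilon v(\tau,\varepsilon)\|_\alpha\to0\qquad\text{as }\varepsilon\to0^+.$$ If moreover $f$ is (Bohr) almost periodic with values in $D(A^\gamma)$, then for every $\varepsilon>0$ the function $v(\cdot,\varepsilon)$ is almost periodic with values in $D(A^\alpha)$, with frequency basis contained in that of $f$. That is, call $\lambda\in\mathbb R$ a Fourier exponent of $g$ if $\lim_{T\to\infty}\frac1{2T}\int_{-T}^{T}g(t)e^{i\lambda t}\,dt$ exists and is $\neq0$, and call a countable set $\Omega\subset\mathbb R$ a frequency basis of $g$ if every Fourier exponent of $g$ is uniquely a finite linear combination of elements of $\Omega$ with integer coefficients. Then every frequency basis of $f$ contains a frequency basis of $v(\cdot,\varepsilon)$,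 and the additive subgroup of $\mathbb R$ generated by the Fourier exponents of $v(\cdot,\varepsilon)$ is contained in the one generated by the Fourier exponents of $f$. -/

import Mathlib

open MeasureTheory Set Filter Topology
open scoped ContDiff

noncomputable section

/-! ### Semigroups, fractional powers and the scale `D(A^γ)` -/

section Scale

variable {H : Type*} [NormedAddCommGroup H] [NormedSpace ℂ H]

/-- `S` (restricted to `t ≥ 0`) is a strongly continuous semigroup of bounded operators on `H`
whose infinitesimal generator is exactly `-A`, domain included. -/
structure IsSemigroupOfNeg (A : H →ₗ.[ℂ] H) (S : ℝ → H →L[ℂ] H) : Prop where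
  zero : S 0 = ContinuousLinearMap.id ℂ H
  add : ∀ s t : ℝ, 0 ≤ s → 0 ≤ t → S (s + t) = (S s).comp (S t)
  continuousOn : ∀ x : H, ContinuousOn (fun t : ℝ => S t x) (Ici 0)
  generator : ∀ x y : H, (x, y) ∈ A.graph ↔
    Tendsto (fun h : ℝ => h⁻¹ • (S h x - x)) (𝓝[>] 0) (𝓝 (-y))

open Classical in
/-- The semigroup `e^{-At}`, `t ≥ 0`, generated by `-A`. A strongly continuous semigroup is
determined on `t ≥ 0` by its generator, so the choice is immaterial; the value is `0` if `-A`
generates no such semigroup. -/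
def expNeg (A : H →ₗ.[ℂ] H) : ℝ → H →L[ℂ] H :=
  if h : ∃ S, IsSemigroupOfNeg A S then h.choose else 0

/-- `A^{-s} x = Γ(s)⁻¹ ∫₀^∞ t^{s-1} e^{-At} x dt` for `s > 0`, and `A^0 x = x`. -/
def negPow (A : H →ₗ.[ℂ] H) (s : ℝ) (x : H) : H :=
  if s = 0 then x
  else (Real.Gamma s)⁻¹ • ∫ t in Ioi (0 : ℝ), t ^ (s - 1) • expNeg A t x

/-- The Banach space `D(A^γ)`, `γ : ℝ`, with norm `‖x‖_γ = ‖A^γ x‖`. As `A^γ` is an isometric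
isomorphism of `D(A^γ)` onto `H`, an element `x` of `D(A^γ)` is stored as the vector `A^γ x` of `H`
(`FracDom.pow x`), and two elements of the scale are compared through the embeddings
`FracDom.incl`. For `γ ≥ 0`, `x` is the vector `A^{-γ} (A^γ x)` of the range `D(A^γ)` of `A^{-γ}`
(see `FracDom.toBase`). For `γ < 0`, this is the completion of `H` in the norm `‖A^γ x‖`
(see `FracDom.ofBase`). -/
def FracDom (_A : H →ₗ.[ℂ] H) (_γ : ℝ) : Type _ := H

namespace FracDom

variable {A : H →ₗ.[ℂ] H} {γ : ℝ}

instance : NormedAddCommGroup (FracDom A γ) := inferInstanceAs (NormedAddCommGroup H)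

instance : NormedSpace ℂ (FracDom A γ) := inferInstanceAs (NormedSpace ℂ H)

instance [CompleteSpace H] : CompleteSpace (FracDom A γ) := inferInstanceAs (CompleteSpace H)

/-- `A^γ : D(A^γ) → H`, an isometric isomorphism. -/
def pow : FracDom A γ ≃ₗᵢ[ℂ] H := LinearIsometryEquiv.refl ℂ H

/-- The embedding `D(A^γ) ⊆ D(A^δ)` for `δ ≤ γ`: `A^δ x = A^{-(γ-δ)} (A^γ x)`. -/
def incl (δ : ℝ) (x : FracDom A γ) : FracDom A δ := pow.symm (negPow A (γ - δ) (pow x))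

/-- The operator `A : D(A^γ) → D(A^{γ-1})`, given by `A^{γ-1} (A x) = A^γ x`. -/
def applyOp (x : FracDom A γ) : FracDom A (γ - 1) := pow.symm (pow x)

/-- For `γ ≥ 0`, the inclusion of `D(A^γ)` in `H`. -/
def toBase (x : FracDom A γ) : H := negPow A γ (pow x)

/-- For `γ ≤ 0`, the inclusion of `H` in `D(A^γ)`. -/
def ofBase (x : H) : FracDom A γ := pow.symm (negPow A (-γ) x)

theorem range_toBase : range (toBase : FracDom A γ → H) = range (negPow A γ) := rfl

theorem norm_eq (x : FracDom A γ) : ‖x‖ = ‖pow x‖ := rfl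

theorem norm_ofBase (x : H) : ‖(ofBase x : FracDom A γ)‖ = ‖negPow A (-γ) x‖ := rfl

end FracDom

/-- `v : ℝ → D(A^α)` solves `∂_τ v = -ε A v + f₀ - f` on `ℝ`, where `f : ℝ → D(A^γ)`,
`f₀ ∈ D(A^γ)` and `α - 1 ≤ γ`: all terms of the equation lie in `D(A^{α-1})`, and there the
equation holds in integrated form. (Thus `v` is locally absolutely continuous with values in
`D(A^{α-1})` and satisfies the equation for almost every `τ`.) -/
structure IsSolution (A : H →ₗ.[ℂ] H) {α γ : ℝ} (ε : ℝ) (f₀ : FracDom A γ)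
    (f : ℝ → FracDom A γ) (v : ℝ → FracDom A α) : Prop where
  locallyIntegrable : LocallyIntegrable v
  eqn : ∀ s t : ℝ, (v t).incl (α - 1) - (v s).incl (α - 1) =
    ∫ τ in s..t, (-(ε • (v τ).applyOp) + (f₀ - f τ).incl (α - 1))

end Scale

/-! ### Averages and almost periodic functions -/

section Functions

variable {X : Type*} [NormedAddCommGroup X] [NormedSpace ℂ X]

/-- `f : ℝ → X` has the average `f₀`:
`‖(1/T) ∫_t^{t+T} f - f₀‖ ≤ min (M, σ(T))` for all `t ∈ ℝ` and `T > 0`, where `M > 0` and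
`σ(T) → 0` as `T → ∞`. -/
def HasTimeAverage (f : ℝ → X) (f₀ : X) : Prop :=
  LocallyIntegrable f ∧ ∃ (M : ℝ) (σ : ℝ → ℝ), 0 < M ∧ Tendsto σ atTop (𝓝 0) ∧
    ∀ t T : ℝ, 0 < T → ‖T⁻¹ • (∫ s in t..(t + T), f s) - f₀‖ ≤ min M (σ T)

/-- Bohr almost periodicity. -/
def IsAlmostPeriodic (f : ℝ → X) : Prop :=
  Continuous f ∧ ∀ e : ℝ, 0 < e → ∃ l : ℝ, 0 < l ∧ ∀ T : ℝ, ∃ τ ∈ Ioo T (T + l),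
    ∀ t : ℝ, ‖f (t + τ) - f t‖ ≤ e

/-- The Fourier exponents of `f`: the real `lam` for which
`lim_{T → ∞} (1/2T) ∫_{-T}^T f(t) e^{i lam t} dt` is non-zero. -/
def fourierExponents (f : ℝ → X) : Set ℝ :=
  {lam | ∃ c : X, c ≠ 0 ∧ Tendsto
    (fun T : ℝ => (2 * T)⁻¹ • ∫ t in (-T)..T, Complex.exp (Complex.I * lam * t) • f t)
    atTop (𝓝 c)}

/-- `Ω` is a frequency basis of `f`: it is countable and every Fourier exponent of `f` is, in
exactly one way, a finite linear combination of elements of `Ω` with integer coefficients. -/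
def IsFrequencyBasis (Ω : Set ℝ) (f : ℝ → X) : Prop :=
  Ω.Countable ∧ ∀ lam ∈ fourierExponents f,
    ∃! c : Ω →₀ ℤ, (c.sum fun om n => (n : ℝ) * (om : ℝ)) = lam

/-- The frequency module of `f`: all finite integer combinations of its Fourier exponents. -/
def frequencyModule (f : ℝ → X) : Submodule ℤ ℝ := Submodule.span ℤ (fourierExponents f)

end Functions

/-! ### The quasi-geostrophic operator -/

/-- Complex `L²(D)`. -/
abbrev L2 (D : Set (EuclideanSpace ℝ (Fin 2))) : Type :=
  Lp ℂ 2 (volume.restrict D)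

/-- The partial derivative in the `i`-th coordinate. -/
def partialD (i : Fin 2) (φ : EuclideanSpace ℝ (Fin 2) → ℂ) (x : EuclideanSpace ℝ (Fin 2)) : ℂ :=
  fderiv ℝ φ x (EuclideanSpace.single i 1)

/-- All pairs `(φ, ∇φ)` with `φ ∈ C_c^∞(D)`. -/
def testGraph (D : Set (EuclideanSpace ℝ (Fin 2))) : Submodule ℂ (L2 D × (Fin 2 → L2 D)) where
  carrier := {p | ∃ φ : EuclideanSpace ℝ (Fin 2) → ℂ, ContDiff ℝ ∞ φ ∧ HasCompactSupport φ ∧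
    tsupport φ ⊆ D ∧ p.1 =ᵐ[volume.restrict D] φ ∧
    ∀ i, p.2 i =ᵐ[volume.restrict D] partialD i φ}
  zero_mem' := by
    refine ⟨0, contDiff_const, HasCompactSupport.zero, ?_, Lp.coeFn_zero _ _ _, fun i => ?_⟩
    · simp [tsupport]
    · refine (Lp.coeFn_zero ℂ 2 (volume.restrict D)).trans (Eventually.of_forall fun x => ?_)
      simp [partialD]
  add_mem' := by
    rintro p q ⟨φ, h1, h2, h3, h4, h5⟩ ⟨χ, k1, k2, k3, k4, k5⟩
    refine ⟨φ + χ, h1.add k1, h2.add k2, (tsupport_add φ χ).trans (union_subset h3 k3), ?_,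
      fun i => ?_⟩
    · filter_upwards [Lp.coeFn_add p.1 q.1, h4, k4] with x hx h k
      refine hx.trans ?_
      rw [Pi.add_apply, Pi.add_apply, h, k]
    · filter_upwards [Lp.coeFn_add (p.2 i) (q.2 i), h5 i, k5 i] with x hx h k
      have e1 := (h1.differentiable (by simp)) x
      have e2 := (k1.differentiable (by simp)) x
      refine hx.trans ?_
      rw [Pi.add_apply, h, k, partialD, partialD, partialD, fderiv_add e1 e2]
      rfl
  smul_mem' := by
    rintro c p ⟨φ, h1, h2, h3, h4, h5⟩
    refine ⟨c • φ, h1.const_smul c, h2.smul_left (f := fun _ => c),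
      (tsupport_smul_subset_right (fun _ => c) φ).trans h3, ?_, fun i => ?_⟩
    · filter_upwards [Lp.coeFn_smul c p.1, h4] with x hx h
      refine hx.trans ?_
      rw [Pi.smul_apply, Pi.smul_apply, h]
    · filter_upwards [Lp.coeFn_smul c (p.2 i), h5 i] with x hx h
      have e1 := (h1.differentiable (by simp)) x
      refine hx.trans ?_
      rw [Pi.smul_apply, h, partialD, partialD, fderiv_const_smul e1]
      rfl

/-- `H^1_0(D)`, the closure of `C_c^∞(D)` in the `H^1` norm: `(u, g) ∈ sobolevH10 D` means that
`u ∈ H^1_0(D)` and `∇u = g`. -/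
def sobolevH10 (D : Set (EuclideanSpace ℝ (Fin 2))) : Submodule ℂ (L2 D × (Fin 2 → L2 D)) :=
  (testGraph D).topologicalClosure

/-- The graph of the Laplacian of `L²(D)` with Dirichlet boundary condition: `(u, w)` belongs to it
when `u ∈ H^1_0(D)` and `Δu = w ∈ L²(D)` in the sense of distributions. -/
def dirichletLaplacian (D : Set (EuclideanSpace ℝ (Fin 2))) : Submodule ℂ (L2 D × L2 D) where
  carrier := {p | ∃ g, (p.1, g) ∈ sobolevH10 D ∧
    ∀ q ∈ testGraph D, ∑ i, inner ℂ (q.2 i) (g i) = -inner ℂ q.1 p.2}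
  zero_mem' := ⟨0, (sobolevH10 D).zero_mem, fun q _ => by simp⟩
  add_mem' := by
    rintro p q ⟨g, h1, h2⟩ ⟨k, k1, k2⟩
    refine ⟨g + k, (sobolevH10 D).add_mem h1 k1, fun t ht => ?_⟩
    have e1 := h2 t ht
    have e2 := k2 t ht
    simp only [Pi.add_apply, Prod.snd_add, inner_add_right, Finset.sum_add_distrib, e1, e2]
    ring
  smul_mem' := by
    rintro c p ⟨g, h1, h2⟩
    refine ⟨c • g, (sobolevH10 D).smul_mem c h1, fun t ht => ?_⟩
    have e1 := h2 t ht
    simp only [Pi.smul_apply, Prod.smul_snd, inner_smul_right, ← Finset.mul_sum, e1]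
    ring

/-- The graph of `-νΔ + r + β ∂_x Δ⁻¹`: `Δu = ℓ`, `ψ = Δ⁻¹ u`, `∇ψ = q`, and the value at `u` is
`-ν ℓ + r u + β q₀`. -/
def qgGraph (D : Set (EuclideanSpace ℝ (Fin 2))) (ν r β : ℝ) : Submodule ℂ (L2 D × L2 D) where
  carrier := {p | ∃ (ℓ ψ : L2 D) (q : Fin 2 → L2 D), (p.1, ℓ) ∈ dirichletLaplacian D ∧
    (ψ, p.1) ∈ dirichletLaplacian D ∧ (ψ, q) ∈ sobolevH10 D ∧
    p.2 = -((ν : ℂ) • ℓ) + (r : ℂ) • p.1 + (β : ℂ) • q 0}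
  zero_mem' := ⟨0, 0, 0, (dirichletLaplacian D).zero_mem, (dirichletLaplacian D).zero_mem,
    (sobolevH10 D).zero_mem, by simp⟩
  add_mem' := by
    rintro a b ⟨ℓ, ψ, q, h1, h2, h3, h4⟩ ⟨m, χ, k, k1, k2, k3, k4⟩
    refine ⟨ℓ + m, ψ + χ, q + k, (dirichletLaplacian D).add_mem h1 k1,
      (dirichletLaplacian D).add_mem h2 k2, (sobolevH10 D).add_mem h3 k3, ?_⟩
    simp only [Prod.snd_add, Prod.fst_add, h4, k4, Pi.add_apply, smul_add]
    abel
  smul_mem' := by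
    rintro c a ⟨ℓ, ψ, q, h1, h2, h3, h4⟩
    refine ⟨c • ℓ, c • ψ, c • q, (dirichletLaplacian D).smul_mem c h1,
      (dirichletLaplacian D).smul_mem c h2, (sobolevH10 D).smul_mem c h3, ?_⟩
    simp only [Prod.smul_snd, Prod.smul_fst, h4, Pi.smul_apply, smul_add, smul_neg,
      smul_comm c]

/-- The operator `A = -νΔ + r I + β ∂_x Δ⁻¹` in `L²(D)` with Dirichlet boundary condition and
domain `{u ∈ H^1_0(D) : Δu ∈ L²(D)}`. -/
def qgOperator (D : Set (EuclideanSpace ℝ (Fin 2))) (ν r β : ℝ) : L2 D →ₗ.[ℂ] L2 D :=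
  (qgGraph D ν r β).toLinearPMap

end

/-!
With `u = A^α v` and `θ = γ - α + 1 > 0`, the equation for `v : ℝ → D(A^α)` becomes, in `H = L²(D)`,
`(A⁻¹ u)' = -ε u + P g`, where `P = A^{-θ}` and `g = A^γ (f₀ - f)`. The semigroup of `-A` is
analytic and exponentially stable, so `k(t) = A e^{-At} P` is an integrable kernel:
`‖k(t)‖ ≤ C t^{δ-1} e^{-κt}` for some `δ > 0` (`norm_deriv_mul_gammaIntegral_le`), and
`u = k(ε ·) * g` is a bounded continuous solution (`apply_kernelConv_sub`). It makes sense although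
`f` is only locally integrable, because the bound on the averages makes `f - f₀` essentially bounded
(`HasTimeAverage.exists_bound`).

* Uniqueness: the difference `z` of two bounded solutions satisfies `(A⁻¹ z)' = -ε z`, and
  accretivity of `A` forces exponential growth at `-∞` unless `z = 0`
  (`IsSectorialInverse.eq_zero_of_bounded`).
* Smallness of `ε u`: by continuity of translations in `L¹`, `k(ε ·)` is within a small relative
  error of its moving average over a length `T` proportional to `1/ε`, and the averages of `g` over
  that length are at most `σ(T)`
  (`norm_kernelConv_le_of_average`, `tendstoUniformly_smul_kernelConv`).
* Almost periodicity passes from `g` to `k(ε ·) * g`. For the exponents, take Fourier means in the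
  equation: if the mean of `u` at `λ` tends to `c ≠ 0`, then `P` applied to that of `g` tends to
  `(ε - iλ A⁻¹) c ≠ 0`. As the means of `g` stay in a compact set and `P` is injective, they
  converge, to a limit that is not `0`, so `λ` is an exponent of `f`.

The argument uses of `A` only that `G = A⁻¹` is bounded, injective and sectorial
(`IsSectorialInverse`); the semigroup is constructed as the strong limit of `exp(-t (δ + G)⁻¹)`,
`δ → 0`, and the bounds come from Cauchy's estimate in the sector. For the quasi-geostrophic
operator these properties follow from Lax–Milgram: the gradients of `H^1_0(D)` form a Hilbert space
`V`, `E : ∇u ↦ u` is bounded on it, `Δ⁻¹ = -E E†`, and `A⁻¹ = E M⁻¹ E†` with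
`M = ν + E† (r - β Q) E`, where `Q u = -∂_x Δ⁻¹ u`. The condition `4νr > β² |D|² / π²` makes `M`
coercive as soon as the Poincaré constant is at most `|D| / π`; the Gagliardo–Nirenberg–Sobolev
inequality of the plane gives `|D| / 4`.
-/

noncomputable section

/-! ### Bounded generators -/

section BoundedGenerator

open scoped ComplexConjugate

variable {H : Type*} [NormedAddCommGroup H] [InnerProductSpace ℂ H]

theorem hasDerivWithinAt_norm_sq {u : ℝ → H} {u' : H} {s : Set ℝ} {t : ℝ}
    (h : HasDerivWithinAt u u' s t) :
    HasDerivWithinAt (fun τ => ‖u τ‖ ^ 2) (2 * (inner ℂ u' (u t)).re) s t := by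
  have h1 := (Complex.reCLM.hasFDerivAt (x := inner ℂ (u t) (u t))).comp_hasDerivWithinAt t
    (h.inner ℂ h)
  have e : (fun τ => ‖u τ‖ ^ 2) = Complex.reCLM ∘ fun τ => inner ℂ (u τ) (u τ) := by
    ext τ
    exact (inner_self_eq_norm_sq (𝕜 := ℂ) (u τ)).symm
  rw [e]
  have h2 : (inner ℂ (u t) u').re = (inner ℂ u' (u t)).re := inner_re_symm (𝕜 := ℂ) _ _
  refine h1.congr_deriv ?_
  change (inner ℂ (u t) u' + inner ℂ u' (u t)).re = _
  rw [Complex.add_re, h2]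
  ring

/-- If `u' = -b` and `Re ⟨b, u⟩ ≥ c ‖u‖²`, then `e^{2cτ} ‖u‖²` does not increase. -/
theorem antitone_exp_mul_norm_sq {u b : ℝ → H} {c : ℝ}
    (hu : ∀ t, HasDerivAt u (-b t) t) (hb : ∀ t, c * ‖u t‖ ^ 2 ≤ (inner ℂ (b t) (u t)).re) :
    Antitone fun t => Real.exp (2 * c * t) * ‖u t‖ ^ 2 := by
  have hd : ∀ t, HasDerivAt (fun t => Real.exp (2 * c * t) * ‖u t‖ ^ 2)
      (Real.exp (2 * c * t) * (2 * c) * ‖u t‖ ^ 2 +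
        Real.exp (2 * c * t) * (2 * (inner ℂ (-b t) (u t)).re)) t := by
    intro t
    have h1 : HasDerivAt (fun t : ℝ => Real.exp (2 * c * t))
        (Real.exp (2 * c * t) * (2 * c)) t := by
      simpa using ((hasDerivAt_id t).const_mul (2 * c)).exp
    exact h1.mul (hasDerivWithinAt_univ.1 (hasDerivWithinAt_norm_sq (hu t).hasDerivWithinAt))
  refine antitone_of_hasDerivAt_nonpos hd fun t => ?_
  have h := mul_le_mul_of_nonneg_left (hb t) (Real.exp_pos (2 * c * t)).le
  simp only [Pi.zero_apply, inner_neg_left, Complex.neg_re]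
  linarith

variable [CompleteSpace H]

/-- The group `e^{-za}`, `z ∈ ℂ`, generated by a bounded operator `a`. -/
def expGroup (a : H →L[ℂ] H) (z : ℂ) : H →L[ℂ] H := NormedSpace.exp (-z • a)

theorem hasDerivAt_expGroup (a : H →L[ℂ] H) (z : ℂ) :
    HasDerivAt (expGroup a) (-(a * expGroup a z)) z := by
  have h := (hasDerivAt_exp_smul_const' (𝕂 := ℂ) a (-z)).scomp z (hasDerivAt_neg z)
  have e : expGroup a = fun x => NormedSpace.exp (-x • a) := rfl
  rw [e]
  simpa [Function.comp_def] using h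

theorem hasDerivAt_expGroup_ofReal (a : H →L[ℂ] H) (t : ℝ) :
    HasDerivAt (fun t : ℝ => expGroup a t) (-(a * expGroup a t)) t := by
  have h := (hasDerivAt_expGroup a t).scomp t Complex.ofRealCLM.hasDerivAt
  simpa [Function.comp_def] using h

theorem hasDerivAt_expGroup_apply (a : H →L[ℂ] H) (t : ℝ) (x : H) :
    HasDerivAt (fun t : ℝ => expGroup a t x) (-(a (expGroup a t x))) t := by
  have h := hasDerivAt_expGroup_ofReal a t
  have h2 := ((ContinuousLinearMap.apply ℂ H x).restrictScalars ℝ).hasFDerivAt.comp_hasDerivAt t h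
  simpa [Function.comp_def] using h2

@[simp] theorem expGroup_zero (a : H →L[ℂ] H) : expGroup a 0 = 1 := by
  simp [expGroup]

theorem expGroup_add (a : H →L[ℂ] H) (z w : ℂ) :
    expGroup a (z + w) = expGroup a z * expGroup a w := by
  have h : Commute (-z • a) (-w • a) := ((Commute.refl a).smul_left _).smul_right _
  let _ : NormedAlgebra ℚ (H →L[ℂ] H) := NormedAlgebra.restrictScalars ℚ ℂ _
  rw [expGroup, expGroup, expGroup, ← NormedSpace.exp_add_of_commute h, neg_add, add_smul]

theorem expGroup_commute {a b : H →L[ℂ] H} (h : Commute b a) (z : ℂ) :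
    Commute b (expGroup a z) :=
  (h.smul_right (-z)).exp_right

theorem norm_expGroup_le {a : H →L[ℂ] H} {c : ℝ}
    (ha : ∀ x, c * ‖x‖ ^ 2 ≤ (inner ℂ (a x) x).re) {t : ℝ} (ht : 0 ≤ t) :
    ‖expGroup a t‖ ≤ Real.exp (-(c * t)) := by
  refine ContinuousLinearMap.opNorm_le_bound _ (Real.exp_pos _).le fun x => ?_
  have h := antitone_exp_mul_norm_sq (fun t => hasDerivAt_expGroup_apply a t x)
    (fun t => ha _) ht
  simp only [mul_zero, Real.exp_zero, one_mul, Complex.ofReal_zero, expGroup_zero,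
    one_apply_eq_self] at h
  rw [show 2 * c * t = c * t + c * t by ring, Real.exp_add] at h
  have h2 : Real.exp (c * t) * ‖expGroup a t x‖ ≤ ‖x‖ := by
    refine le_of_sq_le_sq ?_ (norm_nonneg _)
    nlinarith
  rw [Real.exp_neg, ← div_eq_inv_mul, le_div_iff₀ (Real.exp_pos _)]
  linarith

/-- In the sector `|Im z| K ≤ Re z` the operator `z a` is still accretive, so `e^{-za}` is a
contraction. -/
theorem norm_expGroup_le_one {a : H →L[ℂ] H} {K : ℝ}
    (hs : ∀ x, |(inner ℂ (a x) x).im| ≤ K * (inner ℂ (a x) x).re)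
    (hr : ∀ x, 0 ≤ (inner ℂ (a x) x).re) {z : ℂ} (hz : |z.im| * K ≤ z.re) :
    ‖expGroup a z‖ ≤ 1 := by
  have h := norm_expGroup_le (a := z • a) (c := 0) (t := 1) (fun x => ?_) zero_le_one
  · simpa [expGroup] using h
  · have e : (inner ℂ ((z • a) x) x).re =
        z.re * (inner ℂ (a x) x).re + z.im * (inner ℂ (a x) x).im := by
      rw [smul_apply, inner_smul_left, Complex.mul_re]
      simp
    rw [e]
    have h1 : |z.im * (inner ℂ (a x) x).im| ≤ |z.im| * (K * (inner ℂ (a x) x).re) := by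
      rw [abs_mul]; exact mul_le_mul_of_nonneg_left (hs x) (abs_nonneg _)
    have h2 := mul_le_mul_of_nonneg_right hz (hr x)
    have h3 := neg_abs_le (z.im * (inner ℂ (a x) x).im)
    nlinarith

/-- Cauchy's estimate on the disc of radius `t / (1 + K)` about `t`, which lies in the sector
where `e^{-za}` is a contraction. -/
theorem norm_mul_expGroup_le {a : H →L[ℂ] H} {K : ℝ} (hK : 0 ≤ K)
    (hs : ∀ x, |(inner ℂ (a x) x).im| ≤ K * (inner ℂ (a x) x).re)
    (hr : ∀ x, 0 ≤ (inner ℂ (a x) x).re) {t : ℝ} (ht : 0 < t) :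
    ‖a * expGroup a t‖ ≤ (1 + K) / t := by
  have hd : Differentiable ℂ (expGroup a) := fun z => (hasDerivAt_expGroup a z).differentiableAt
  have hK1 : 0 < 1 + K := by linarith
  have h := Complex.norm_deriv_le_of_forall_mem_sphere_norm_le (c := (t : ℂ)) (R := t / (1 + K))
    (C := 1) (div_pos ht hK1) hd.diffContOnCl (fun z hz => ?_)
  · rw [(hasDerivAt_expGroup a t).deriv, norm_neg] at h
    simpa using h
  · apply norm_expGroup_le_one hs hr
    have hz' : ‖z - t‖ = t / (1 + K) := by simpa [dist_eq_norm] using hz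
    have h1 : |z.im| ≤ t / (1 + K) := by
      simpa [← hz'] using Complex.abs_im_le_norm (z - t)
    have h2 : |z.re - t| ≤ t / (1 + K) := by
      simpa [← hz'] using Complex.abs_re_le_norm (z - t)
    have h3 := neg_abs_le (z.re - t)
    have h4 : t / (1 + K) * K = t - t / (1 + K) := by field_simp; ring
    nlinarith [mul_le_mul_of_nonneg_right h1 hK]

theorem norm_mul_expGroup_le_exp {a : H →L[ℂ] H} {c K : ℝ} (hK : 0 ≤ K)
    (hs : ∀ x, |(inner ℂ (a x) x).im| ≤ K * (inner ℂ (a x) x).re) (hc : 0 ≤ c)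
    (hr : ∀ x, c * ‖x‖ ^ 2 ≤ (inner ℂ (a x) x).re) {t : ℝ} (ht : 0 < t) :
    ‖a * expGroup a t‖ ≤ 2 * (1 + K) * t⁻¹ * Real.exp (-(c / 2 * t)) := by
  have e : expGroup a t = expGroup a (t / 2 : ℝ) * expGroup a (t / 2 : ℝ) := by
    rw [← expGroup_add]; congr 1; push_cast; ring
  have h1 := norm_mul_expGroup_le hK hs (fun x => (by positivity : 0 ≤ c * ‖x‖ ^ 2).trans (hr x))
    (half_pos ht)
  have h2 := norm_expGroup_le hr (half_pos ht).le
  rw [e, ← mul_assoc]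
  refine (norm_mul_le _ _).trans ((mul_le_mul h1 h2 (norm_nonneg _) (by positivity)).trans ?_)
  apply le_of_eq
  rw [show c * (t / 2) = c / 2 * t by ring]
  field_simp

/-- Semigroups of commuting accretive operators differ by at most `t ‖(a - b) x‖` at `x`. -/
theorem norm_expGroup_sub_le {a b : H →L[ℂ] H} (hab : Commute a b)
    (ha : ∀ x, 0 ≤ (inner ℂ (a x) x).re) (hb : ∀ x, 0 ≤ (inner ℂ (b x) x).re)
    {t : ℝ} (ht : 0 ≤ t) (x : H) :
    ‖expGroup a t x - expGroup b t x‖ ≤ t * ‖a x - b x‖ := by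
  have ca : ∀ {t : ℝ}, 0 ≤ t → ∀ y, ‖expGroup a t y‖ ≤ ‖y‖ := fun {t} h y => by
    have := norm_expGroup_le (a := a) (c := 0) (by simpa using ha) h
    simp only [zero_mul, neg_zero, Real.exp_zero] at this
    simpa using (expGroup a t).le_of_opNorm_le this y
  have cb : ∀ {t : ℝ}, 0 ≤ t → ∀ y, ‖expGroup b t y‖ ≤ ‖y‖ := fun {t} h y => by
    have := norm_expGroup_le (a := b) (c := 0) (by simpa using hb) h
    simp only [zero_mul, neg_zero, Real.exp_zero] at this
    simpa using (expGroup b t).le_of_opNorm_le this y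
  have hd : ∀ s : ℝ, HasDerivAt (fun s : ℝ => (expGroup a (t - s : ℝ) * expGroup b s) x)
      (expGroup a (t - s : ℝ) (expGroup b s (a x - b x))) s := by
    intro s
    have h1 : HasDerivAt (fun s : ℝ => expGroup a (t - s : ℝ)) (a * expGroup a (t - s : ℝ)) s := by
      have h := (hasDerivAt_expGroup_ofReal a (t - s)).scomp s
        ((hasDerivAt_id s).const_sub t)
      simpa [Function.comp_def] using h
    have h2 := hasDerivAt_expGroup_ofReal b s
    have h3 := ((ContinuousLinearMap.apply ℂ H x).restrictScalars ℝ).hasFDerivAt.comp_hasDerivAt s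
      (h1.mul h2)
    refine h3.congr_deriv ?_
    have c1 : a * expGroup a (t - s : ℝ) = expGroup a (t - s : ℝ) * a :=
      expGroup_commute (Commute.refl a) _
    have c2 : a * expGroup b s = expGroup b s * a := expGroup_commute hab _
    have c3 : b * expGroup b s = expGroup b s * b := expGroup_commute (Commute.refl b) _
    have e : a * expGroup a (t - s : ℝ) * expGroup b s +
        expGroup a (t - s : ℝ) * -(b * expGroup b s) =
        expGroup a (t - s : ℝ) * (expGroup b s * (a - b)) := by
      rw [c1, mul_assoc, c2, c3]; noncomm_ring
    change (a * expGroup a (t - s : ℝ) * expGroup b s +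
        expGroup a (t - s : ℝ) * -(b * expGroup b s)) x = _
    rw [e]; rfl
  have h := norm_image_sub_le_of_norm_deriv_le_segment' (a := 0) (b := t)
    (C := ‖a x - b x‖) (fun s _ => (hd s).hasDerivWithinAt) (fun s hs => ?_) t
    (right_mem_Icc.2 ht)
  · rw [norm_sub_rev]
    simpa [mul_comm] using h
  · exact (ca (by linarith [hs.2]) _).trans (cb hs.1 _)

end BoundedGenerator

/-! ### Strong limits and inverses of sectorial operators -/

section StrongLimits

variable {H : Type*} [NormedAddCommGroup H] [NormedSpace ℂ H] [CompleteSpace H]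

/-- A uniformly bounded sequence of operators that converges pointwise on a dense set converges
strongly. -/
theorem exists_strong_limit {T : ℕ → H →L[ℂ] H} {B : ℝ} (hB : ∀ n, ‖T n‖ ≤ B)
    {D : Set H} (hD : Dense D) (h : ∀ x ∈ D, CauchySeq fun n => T n x) :
    ∃ L : H →L[ℂ] H, (∀ x, Tendsto (fun n => T n x) atTop (𝓝 (L x))) ∧ ‖L‖ ≤ B := by
  have hB0 : 0 ≤ B := (norm_nonneg _).trans (hB 0)
  have hc : ∀ x, CauchySeq fun n => T n x := by
    intro x
    rw [Metric.cauchySeq_iff]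
    intro e he
    obtain ⟨y, hy, hxy⟩ := hD.exists_dist_lt x (ε := e / (3 * (B + 1))) (by positivity)
    obtain ⟨N, hN⟩ := Metric.cauchySeq_iff.1 (h y hy) (e / 3) (by positivity)
    have hd : ∀ n, dist (T n x) (T n y) < e / 3 := by
      intro n
      rw [dist_eq_norm, ← map_sub]
      rw [dist_eq_norm] at hxy
      calc ‖T n (x - y)‖ ≤ B * ‖x - y‖ := (T n).le_of_opNorm_le (hB n) _
        _ ≤ (B + 1) * ‖x - y‖ := by gcongr; linarith
        _ < (B + 1) * (e / (3 * (B + 1))) := by gcongr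
        _ = e / 3 := by field_simp
    refine ⟨N, fun m hm n hn => ?_⟩
    have h1 := dist_triangle4 (T m x) (T m y) (T n y) (T n x)
    have h2 := hd n
    rw [dist_comm] at h2
    linarith [hd m, hN m hm n hn]
  choose L hL using fun x => cauchySeq_tendsto_of_complete (hc x)
  refine ⟨continuousLinearMapOfTendsto T (f := L) (tendsto_pi_nhds.2 hL), hL, ?_⟩
  refine ContinuousLinearMap.opNorm_le_bound _ hB0 fun x => ?_
  exact le_of_tendsto (hL x).norm (Eventually.of_forall fun n => (T n).le_of_opNorm_le (hB n) _)

omit [CompleteSpace H] in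
/-- Operators that agree on a dense range composed with them are equal. -/
theorem eq_of_mul_eq_of_denseRange {A B G : H →L[ℂ] H} (hG : DenseRange G)
    (h : ∀ y, A (G y) = B (G y)) : A = B :=
  ContinuousLinearMap.ext fun x =>
    congrFun (hG.equalizer A.continuous B.continuous (funext h)) x


omit [CompleteSpace H] in
theorem tendsto_apply_of_strong {T : ℕ → H →L[ℂ] H} {L : H →L[ℂ] H} {B : ℝ} (hB : ∀ n, ‖T n‖ ≤ B)
    (hT : ∀ x, Tendsto (fun n => T n x) atTop (𝓝 (L x))) {y : ℕ → H} {z : H}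
    (hy : Tendsto y atTop (𝓝 z)) : Tendsto (fun n => T n (y n)) atTop (𝓝 (L z)) := by
  have h1 : Tendsto (fun n => T n (y n - z)) atTop (𝓝 0) := by
    have h0 : Tendsto (fun n => B * ‖y n - z‖) atTop (𝓝 0) := by
      simpa using (tendsto_iff_norm_sub_tendsto_zero.1 hy).const_mul B
    exact squeeze_zero_norm (fun n => (T n).le_of_opNorm_le (hB n) _) h0
  simpa using h1.add (hT z)

end StrongLimits

section Sectorial

variable {H : Type*} [NormedAddCommGroup H] [InnerProductSpace ℂ H]

/-- The bounded operator `G` is the inverse of an operator `A` whose numerical range lies in a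
sector of the open right half-plane: `Re ⟨Au, u⟩ ≥ c ‖u‖²` and `|Im ⟨Au, u⟩| ≤ K Re ⟨Au, u⟩`,
written for `u = G x`. -/
structure IsSectorialInverse (G : H →L[ℂ] H) (c K : ℝ) : Prop where
  pos : 0 < c
  nonneg : 0 ≤ K
  eq_zero : ∀ x, G x = 0 → x = 0
  coercive : ∀ x, c * ‖G x‖ ^ 2 ≤ (inner ℂ x (G x)).re
  sector : ∀ x, |(inner ℂ x (G x)).im| ≤ K * (inner ℂ x (G x)).re

/-- `(δ + G)⁻¹`, the Yosida approximation `A (1 + δ A)⁻¹` of `A = G⁻¹`. -/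
def yosida (G : H →L[ℂ] H) (δ : ℝ) : H →L[ℂ] H := Ring.inverse ((δ : ℂ) • 1 + G)

namespace IsSectorialInverse

variable {G : H →L[ℂ] H} {c K : ℝ} (hG : IsSectorialInverse G c K)
include hG

theorem injective : Function.Injective G :=
  (injective_iff_map_eq_zero G).2 hG.eq_zero

theorem re_nonneg (x : H) : 0 ≤ (inner ℂ x (G x)).re :=
  (mul_nonneg hG.pos.le (sq_nonneg _)).trans (hG.coercive x)

omit hG in
theorem inner_shift_re (δ : ℝ) (x : H) : (inner ℂ x (((δ : ℂ) • (1 : H →L[ℂ] H) + G) x)).re =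
    δ * ‖x‖ ^ 2 + (inner ℂ x (G x)).re := by
  have h : inner ℂ x x = ((‖x‖ ^ 2 : ℝ) : ℂ) := by
    simp [inner_self_eq_norm_sq_to_K]
  rw [add_apply, smul_apply, one_apply_eq_self, inner_add_right, inner_smul_right, h,
    ← Complex.ofReal_mul, Complex.add_re, Complex.ofReal_re]

omit hG in
theorem inner_shift_im (δ : ℝ) (x : H) : (inner ℂ x (((δ : ℂ) • (1 : H →L[ℂ] H) + G) x)).im =
    (inner ℂ x (G x)).im := by
  have h : inner ℂ x x = ((‖x‖ ^ 2 : ℝ) : ℂ) := by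
    simp [inner_self_eq_norm_sq_to_K]
  rw [add_apply, smul_apply, one_apply_eq_self, inner_add_right, inner_smul_right, h,
    ← Complex.ofReal_mul, Complex.add_im, Complex.ofReal_im, zero_add]

theorem le_norm_shift {δ : ℝ} (x : H) :
    δ * ‖x‖ ≤ ‖((δ : ℂ) • (1 : H →L[ℂ] H) + G) x‖ := by
  rcases eq_or_ne x 0 with rfl | hx
  · simp
  have h1 := inner_shift_re (G := G) δ x
  have h2 := hG.re_nonneg x
  have h3 := (Complex.re_le_norm _).trans
    (norm_inner_le_norm (𝕜 := ℂ) x (((δ : ℂ) • (1 : H →L[ℂ] H) + G) x))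
  have h4 : 0 < ‖x‖ := norm_pos_iff.2 hx
  refine le_of_mul_le_mul_left ?_ h4
  nlinarith

variable [CompleteSpace H]

/-- The orthogonal complement of the range is trivial, by coercivity. -/
theorem denseRange : DenseRange G := by
  have h : (LinearMap.range G.toLinearMap)ᗮ = ⊥ := by
    rw [Submodule.eq_bot_iff]
    intro y hy
    have h0 : inner ℂ (G y) y = 0 := hy (G y) ⟨y, rfl⟩
    have h1 := hG.coercive y
    rw [← inner_conj_symm, h0] at h1
    simp only [map_zero, Complex.zero_re] at h1
    have h2 : ‖G y‖ ^ 2 ≤ 0 := by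
      by_contra! h3
      have := mul_pos hG.pos h3
      linarith
    exact hG.eq_zero y (norm_eq_zero.1 (by nlinarith [norm_nonneg (G y)]))
  have h' := (Submodule.topologicalClosure_eq_top_iff).2 h
  have : Dense (LinearMap.range G.toLinearMap : Set H) :=
    Submodule.dense_iff_topologicalClosure_eq_top.2 h'
  exact this

theorem denseRange_sq : DenseRange fun z => G (G z) :=
  hG.denseRange.comp hG.denseRange G.continuous

theorem isUnit_shift {δ : ℝ} (hδ : 0 < δ) : IsUnit ((δ : ℂ) • (1 : H →L[ℂ] H) + G) := by
  refine ContinuousLinearMap.isUnit_of_forall_le_norm_inner_map _ (c := ⟨δ, hδ.le⟩) hδ fun x => ?_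
  rw [norm_inner_symm]
  refine le_trans ?_ (Complex.re_le_norm _)
  rw [inner_shift_re]
  change ‖x‖ ^ 2 * δ ≤ _
  linarith [hG.re_nonneg x]

theorem yosida_shift {δ : ℝ} (hδ : 0 < δ) (x : H) : yosida G δ ((δ : ℂ) • x + G x) = x := by
  have := congrArg (fun T : H →L[ℂ] H => T x) (Ring.inverse_mul_cancel _ (hG.isUnit_shift hδ))
  simpa [yosida] using this

theorem shift_yosida {δ : ℝ} (hδ : 0 < δ) (x : H) :
    (δ : ℂ) • yosida G δ x + G (yosida G δ x) = x := by
  have := congrArg (fun T : H →L[ℂ] H => T x) (Ring.mul_inverse_cancel _ (hG.isUnit_shift hδ))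
  simpa [yosida] using this

omit hG [CompleteSpace H] in
theorem yosida_commute (δ ε : ℝ) : Commute (yosida G δ) (yosida G ε) := by
  apply Commute.ringInverse_ringInverse
  refine Commute.add_left ((Commute.one_left _).smul_left _)
    (Commute.add_right ((Commute.one_right _).smul_right _) (Commute.refl _))

theorem commute_yosida {δ : ℝ} (hδ : 0 < δ) : Commute G (yosida G δ) := by
  ext x
  have h1 := hG.shift_yosida hδ x
  have h2 : yosida G δ (G x) = x - (δ : ℂ) • yosida G δ x := by
    have := hG.yosida_shift hδ x
    rw [map_add, map_smul] at this
    exact eq_sub_of_add_eq' this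
  change G (yosida G δ x) = yosida G δ (G x)
  rw [h2]
  exact eq_sub_of_add_eq' h1

theorem yosida_apply {δ : ℝ} (hδ : 0 < δ) (x : H) :
    yosida G δ (G x) = x - (δ : ℂ) • yosida G δ x := by
  have := hG.yosida_shift hδ x
  rw [map_add, map_smul] at this
  exact eq_sub_of_add_eq' this

theorem norm_smul_yosida_le {δ : ℝ} (hδ : 0 < δ) (x : H) : ‖(δ : ℂ) • yosida G δ x‖ ≤ ‖x‖ := by
  have h := hG.le_norm_shift (δ := δ) (yosida G δ x)
  have h2 : ((δ : ℂ) • (1 : H →L[ℂ] H) + G) (yosida G δ x) = x := by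
    simpa using hG.shift_yosida hδ x
  rw [h2] at h
  rw [norm_smul]
  simpa [abs_of_pos hδ] using h

theorem norm_yosida_apply_le {δ : ℝ} (hδ : 0 < δ) (x : H) : ‖yosida G δ (G x)‖ ≤ 2 * ‖x‖ := by
  rw [hG.yosida_apply hδ]
  linarith [norm_sub_le x ((δ : ℂ) • yosida G δ x), hG.norm_smul_yosida_le hδ x]

theorem norm_yosida_sub_le {δ : ℝ} (hδ : 0 < δ) (z : H) :
    ‖yosida G δ (G (G z)) - G z‖ ≤ δ * (2 * ‖z‖) := by
  rw [hG.yosida_apply hδ, sub_sub_cancel_left, norm_neg, norm_smul]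
  simp only [Complex.norm_real, Real.norm_eq_abs, abs_of_pos hδ]
  exact mul_le_mul_of_nonneg_left (hG.norm_yosida_apply_le hδ z) hδ.le

theorem yosida_re {δ : ℝ} (hδ : 0 < δ) (hδ1 : δ ≤ 1) (x : H) :
    min c 1 / 2 * ‖x‖ ^ 2 ≤ (inner ℂ (yosida G δ x) x).re := by
  obtain ⟨y, rfl⟩ : ∃ y, (δ : ℂ) • y + G y = x := ⟨_, hG.shift_yosida hδ x⟩
  rw [hG.yosida_shift hδ]
  have h1 := inner_shift_re (G := G) δ y
  simp only [add_apply, smul_apply, one_apply_eq_self] at h1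
  rw [h1]
  have h2 := hG.coercive y
  have h3 : ‖(δ : ℂ) • y + G y‖ ≤ δ * ‖y‖ + ‖G y‖ := by
    refine (norm_add_le _ _).trans ?_
    rw [norm_smul]; simp [abs_of_pos hδ]
  have h4 : ‖(δ : ℂ) • y + G y‖ ^ 2 ≤ 2 * (δ ^ 2 * ‖y‖ ^ 2 + ‖G y‖ ^ 2) := by
    nlinarith [norm_nonneg ((δ : ℂ) • y + G y), sq_nonneg (δ * ‖y‖ - ‖G y‖)]
  have hm : 0 < min c 1 := lt_min hG.pos one_pos
  have h5 := mul_le_mul_of_nonneg_left h4 (half_pos hm).le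
  have h6 : min c 1 * ‖G y‖ ^ 2 ≤ c * ‖G y‖ ^ 2 :=
    mul_le_mul_of_nonneg_right (min_le_left _ _) (sq_nonneg _)
  have h7 : min c 1 * (δ ^ 2 * ‖y‖ ^ 2) ≤ 1 * (δ * ‖y‖ ^ 2) := by
    refine mul_le_mul (min_le_right _ _) ?_ (by positivity) zero_le_one
    exact mul_le_mul_of_nonneg_right (by nlinarith) (sq_nonneg _)
  linarith

theorem yosida_im {δ : ℝ} (hδ : 0 < δ) (x : H) :
    |(inner ℂ (yosida G δ x) x).im| ≤ K * (inner ℂ (yosida G δ x) x).re := by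
  obtain ⟨y, rfl⟩ : ∃ y, (δ : ℂ) • y + G y = x := ⟨_, hG.shift_yosida hδ x⟩
  rw [hG.yosida_shift hδ]
  have h1 := inner_shift_re (G := G) δ y
  have h2 := inner_shift_im (G := G) δ y
  simp only [add_apply, smul_apply, one_apply_eq_self] at h1 h2
  rw [h1, h2]
  have := mul_nonneg hG.nonneg (mul_nonneg hδ.le (sq_nonneg ‖y‖))
  linarith [hG.sector y]

end IsSectorialInverse

end Sectorial

/-! ### The analytic semigroup of an unbounded sectorial operator -/

section AnalyticSemigroup

variable {H : Type*} [NormedAddCommGroup H] [NormedSpace ℂ H]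

/-- `S` is, on `t ≥ 0`, a strongly continuous semigroup of decay rate `κ` whose generator is
`-G⁻¹`, and `N t = G⁻¹ S t` satisfies the estimate `‖N t‖ ≤ C t⁻¹ e^{-κt}` of an exponentially
stable analytic semigroup. -/
structure IsStableAnalytic (G : H →L[ℂ] H) (S N : ℝ → H →L[ℂ] H) (κ C : ℝ) : Prop where
  pos : 0 < κ
  eq_zero : ∀ x, G x = 0 → x = 0
  zero : S 0 = 1
  add : ∀ s t : ℝ, 0 ≤ s → 0 ≤ t → S (s + t) = S s * S t
  commute : ∀ t, 0 ≤ t → ∀ x, G (S t x) = S t (G x)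
  continuousOn : ∀ x, ContinuousOn (fun t => S t x) (Ici 0)
  norm_le : ∀ t, 0 ≤ t → ‖S t‖ ≤ Real.exp (-(κ * t))
  apply_sub : ∀ t, 0 ≤ t → ∀ y, S t (G y) - G y = -∫ τ in (0 : ℝ)..t, S τ y
  apply_deriv : ∀ t, 0 < t → ∀ x, G (N t x) = S t x
  norm_deriv_le : ∀ t, 0 < t → ‖N t‖ ≤ C * t⁻¹ * Real.exp (-(κ * t))

end AnalyticSemigroup

section Construction

variable {H : Type*} [NormedAddCommGroup H] [InnerProductSpace ℂ H] [CompleteSpace H]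
  {G : H →L[ℂ] H} {c K : ℝ}

/-- The sequence `A_n = (1/(n+1) + G)⁻¹` of Yosida approximations. -/
def yosidaSeq (G : H →L[ℂ] H) (n : ℕ) : H →L[ℂ] H := yosida G (1 / ((n : ℝ) + 1))

namespace IsSectorialInverse

variable (hG : IsSectorialInverse G c K)
include hG

theorem yosidaSeq_re (n : ℕ) (x : H) :
    min c 1 / 2 * ‖x‖ ^ 2 ≤ (inner ℂ (yosidaSeq G n x) x).re :=
  hG.yosida_re (by positivity) (div_le_one_of_le₀ (by linarith [n.cast_nonneg (α := ℝ)])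
    (by positivity)) x

theorem yosidaSeq_re_nonneg (n : ℕ) (x : H) : 0 ≤ (inner ℂ (yosidaSeq G n x) x).re :=
  (mul_nonneg (half_pos (lt_min hG.pos one_pos)).le (sq_nonneg _)).trans (hG.yosidaSeq_re n x)

theorem yosidaSeq_tendsto_on_range (z : H) :
    Tendsto (fun n => yosidaSeq G n (G (G z))) atTop (𝓝 (G z)) := by
  rw [tendsto_iff_norm_sub_tendsto_zero]
  refine squeeze_zero (fun _ => norm_nonneg _)
    (fun n => hG.norm_yosida_sub_le (δ := 1 / ((n : ℝ) + 1)) (by positivity) z) ?_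
  simpa using tendsto_one_div_add_atTop_nhds_zero_nat.mul_const (2 * ‖z‖)

theorem tendsto_yosidaSeq (y : H) : Tendsto (fun n => yosidaSeq G n (G y)) atTop (𝓝 y) := by
  have hB : ∀ n, ‖yosidaSeq G n * G‖ ≤ 2 := fun n =>
    ContinuousLinearMap.opNorm_le_bound _ zero_le_two fun x =>
      hG.norm_yosida_apply_le (by positivity) x
  obtain ⟨L, hL, -⟩ := exists_strong_limit hB hG.denseRange (by
    rintro _ ⟨z, rfl⟩
    exact (hG.yosidaSeq_tendsto_on_range z).cauchySeq)
  have : L = 1 := eq_of_mul_eq_of_denseRange hG.denseRange fun z =>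
    tendsto_nhds_unique (hL (G z)) (hG.yosidaSeq_tendsto_on_range z)
  simpa [this] using hL y

theorem norm_expGroup_yosidaSeq_le (n : ℕ) {t : ℝ} (ht : 0 ≤ t) :
    ‖expGroup (yosidaSeq G n) t‖ ≤ Real.exp (-(min c 1 / 4 * t)) := by
  refine (norm_expGroup_le (hG.yosidaSeq_re n) ht).trans (Real.exp_le_exp.2 ?_)
  have := mul_nonneg (lt_min hG.pos one_pos).le ht
  linarith

theorem norm_expGroup_yosidaSeq_le_one (n : ℕ) {t : ℝ} (ht : 0 ≤ t) :
    ‖expGroup (yosidaSeq G n) t‖ ≤ 1 := by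
  refine (hG.norm_expGroup_yosidaSeq_le n ht).trans ?_
  rw [Real.exp_le_one_iff]
  have := mul_nonneg (lt_min hG.pos one_pos).le ht
  linarith

theorem norm_mul_expGroup_yosidaSeq_le (n : ℕ) {t : ℝ} (ht : 0 < t) :
    ‖yosidaSeq G n * expGroup (yosidaSeq G n) t‖ ≤
      2 * (1 + K) * t⁻¹ * Real.exp (-(min c 1 / 4 * t)) := by
  have h := norm_mul_expGroup_le_exp hG.nonneg (hG.yosida_im (δ := 1 / ((n : ℝ) + 1))
    (by positivity)) (half_pos (lt_min hG.pos one_pos)).le (hG.yosidaSeq_re n) ht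
  rwa [show min c 1 / 2 / 2 = min c 1 / 4 by ring] at h

theorem exists_semigroup_limit {t : ℝ} (ht : 0 ≤ t) : ∃ L : H →L[ℂ] H,
    (∀ x, Tendsto (fun n => expGroup (yosidaSeq G n) t x) atTop (𝓝 (L x))) ∧
      ‖L‖ ≤ Real.exp (-(min c 1 / 4 * t)) := by
  refine exists_strong_limit (fun n => hG.norm_expGroup_yosidaSeq_le n ht) hG.denseRange_sq ?_
  rintro _ ⟨z, rfl⟩
  have h0 : Tendsto (fun n => t * ‖yosidaSeq G n (G (G z)) - G z‖) atTop (𝓝 0) := by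
    simpa using (tendsto_iff_norm_sub_tendsto_zero.1 (hG.yosidaSeq_tendsto_on_range z)).const_mul t
  rw [Metric.cauchySeq_iff]
  intro e he
  obtain ⟨N, hN⟩ := eventually_atTop.1 (h0.eventually (gt_mem_nhds (half_pos he)))
  refine ⟨N, fun m hm n hn => ?_⟩
  rw [dist_eq_norm]
  have h1 := norm_expGroup_sub_le (yosida_commute (G := G) (1 / ((m : ℝ) + 1))
    (1 / ((n : ℝ) + 1))) (hG.yosidaSeq_re_nonneg m) (hG.yosidaSeq_re_nonneg n) ht (G (G z))
  have h2 : ‖yosidaSeq G m (G (G z)) - yosidaSeq G n (G (G z))‖ ≤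
      ‖yosidaSeq G m (G (G z)) - G z‖ + ‖yosidaSeq G n (G (G z)) - G z‖ := by
    rw [norm_sub_rev (yosidaSeq G n (G (G z)))]
    exact norm_sub_le_norm_sub_add_norm_sub _ _ _
  have h3 := mul_le_mul_of_nonneg_left h2 ht
  rw [mul_add] at h3
  change ‖expGroup (yosidaSeq G m) t (G (G z)) - expGroup (yosidaSeq G n) t (G (G z))‖ ≤
    t * ‖yosidaSeq G m (G (G z)) - yosidaSeq G n (G (G z))‖ at h1
  linarith [hN m hm, hN n hn]

/-- On the range of `G` one has `e^{-tA_n} A_n G y → e^{-tA} y`, and `e^{-tA_n} A_n` is bounded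
uniformly in `n` by the analytic estimate. -/
theorem exists_deriv_limit {t : ℝ} (ht : 0 < t) : ∃ L : H →L[ℂ] H,
    (∀ x, Tendsto (fun n => expGroup (yosidaSeq G n) t (yosidaSeq G n x)) atTop (𝓝 (L x))) ∧
      ‖L‖ ≤ 2 * (1 + K) * t⁻¹ * Real.exp (-(min c 1 / 4 * t)) := by
  obtain ⟨L, hL, -⟩ := hG.exists_semigroup_limit ht.le
  refine exists_strong_limit (T := fun n => expGroup (yosidaSeq G n) t * yosidaSeq G n)
    (fun n => ?_) hG.denseRange ?_
  · rw [← (expGroup_commute (Commute.refl (yosidaSeq G n)) t).eq]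
    exact hG.norm_mul_expGroup_yosidaSeq_le n ht
  · rintro _ ⟨y, rfl⟩
    exact (tendsto_apply_of_strong (fun n => hG.norm_expGroup_yosidaSeq_le_one n ht.le) hL
      (hG.tendsto_yosidaSeq y)).cauchySeq

/-- The operator with sectorial inverse `G` generates an exponentially stable analytic semigroup:
the strong limit of `e^{-tA_n}`. -/
theorem exists_isStableAnalytic :
    ∃ S N : ℝ → H →L[ℂ] H, IsStableAnalytic G S N (min c 1 / 4) (2 * (1 + K)) := by
  choose S hS hSn using fun t : ℝ => hG.exists_semigroup_limit (le_max_right t 0)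
  have hS' : ∀ t : ℝ, 0 ≤ t → ∀ x, Tendsto (fun n => expGroup (yosidaSeq G n) t x) atTop
      (𝓝 (S t x)) := fun t ht x => by simpa [max_eq_left ht] using hS t x
  have hN : ∀ t : ℝ, ∃ L : H →L[ℂ] H, 0 < t →
    (∀ x, Tendsto (fun n => expGroup (yosidaSeq G n) t (yosidaSeq G n x)) atTop (𝓝 (L x))) ∧
      ‖L‖ ≤ 2 * (1 + K) * t⁻¹ * Real.exp (-(min c 1 / 4 * t)) := by
    intro t
    by_cases ht : 0 < t
    · obtain ⟨L, hL⟩ := hG.exists_deriv_limit ht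
      exact ⟨L, fun _ => hL⟩
    · exact ⟨0, fun h => absurd h ht⟩
  choose N hN using hN
  have hcomm : ∀ t, 0 ≤ t → ∀ x, G (S t x) = S t (G x) := by
    intro t ht x
    refine tendsto_nhds_unique ((G.continuous.tendsto _).comp (hS' t ht x))
      ((hS' t ht (G x)).congr fun n => ?_)
    have := expGroup_commute (hG.commute_yosida (δ := 1 / ((n : ℝ) + 1)) (by positivity)) t
    exact congrArg (fun T : H →L[ℂ] H => T x) this.eq.symm
  have hnorm : ∀ t, 0 ≤ t → ‖S t‖ ≤ Real.exp (-(min c 1 / 4 * t)) := fun t ht => by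
    simpa [max_eq_left ht] using hSn t
  have hnorm1 : ∀ t, 0 ≤ t → ‖S t‖ ≤ 1 := fun t ht => (hnorm t ht).trans (by
    rw [Real.exp_le_one_iff]
    linarith [mul_nonneg (lt_min hG.pos one_pos).le ht])
  have hlip : ∀ y, ∀ s, 0 ≤ s → ∀ t, s ≤ t → ‖S t (G y) - S s (G y)‖ ≤ 2 * ‖y‖ * (t - s) := by
    intro y s hs t hst
    refine le_of_tendsto ((hS' t (hs.trans hst) (G y)).sub (hS' s hs (G y))).norm
      (Eventually.of_forall fun n => ?_)
    refine norm_image_sub_le_of_norm_deriv_le_segment' (a := s) (b := t)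
      (fun τ _ => (hasDerivAt_expGroup_apply (yosidaSeq G n) τ (G y)).hasDerivWithinAt)
      (fun τ hτ => ?_) t (right_mem_Icc.2 hst)
    have hc := (expGroup_commute (Commute.refl (yosidaSeq G n)) τ).eq
    have : yosidaSeq G n (expGroup (yosidaSeq G n) τ (G y)) =
      expGroup (yosidaSeq G n) τ (yosidaSeq G n (G y)) :=
        congrArg (fun T : H →L[ℂ] H => T (G y)) hc
    rw [norm_neg, this]
    refine ((expGroup (yosidaSeq G n) τ).le_of_opNorm_le
      (hG.norm_expGroup_yosidaSeq_le_one n (hs.trans hτ.1)) _).trans ?_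
    rw [one_mul]
    exact hG.norm_yosida_apply_le (by positivity) y
  have hcont : ∀ x, ContinuousOn (fun t => S t x) (Ici 0) := by
    intro x
    obtain ⟨x', hx'⟩ := mem_closure_iff_seq_limit.1 (hG.denseRange x)
    obtain ⟨hx'1, hx'2⟩ := hx'
    choose y hy using hx'1
    have hu : TendstoUniformlyOn (fun k t => S t (x' k)) (fun t => S t x) atTop (Ici 0) := by
      rw [Metric.tendstoUniformlyOn_iff]
      intro e he
      filter_upwards [(tendsto_iff_dist_tendsto_zero.1 hx'2).eventually (gt_mem_nhds he)]
        with k hk t ht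
      rw [dist_eq_norm, ← map_sub]
      refine ((S t).le_of_opNorm_le (hnorm1 t ht) _).trans_lt ?_
      rwa [one_mul, ← dist_eq_norm, dist_comm]
    refine hu.continuousOn (Frequently.of_forall fun k => ?_)
    rw [← hy k]
    have hL : LipschitzOnWith (Real.toNNReal (2 * ‖y k‖)) (fun t => S t (G (y k))) (Ici 0) := by
      refine LipschitzOnWith.of_dist_le_mul fun s hs t ht => ?_
      rw [dist_eq_norm, Real.dist_eq, Real.coe_toNNReal _ (by positivity)]
      rcases le_total s t with h | h
      · rw [norm_sub_rev, abs_sub_comm, abs_of_nonneg (sub_nonneg.2 h)]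
        exact hlip (y k) s hs t h
      · rw [abs_of_nonneg (sub_nonneg.2 h)]
        exact hlip (y k) t ht s h
    exact hL.continuousOn
  refine ⟨S, N, ⟨by have := lt_min hG.pos one_pos; positivity, hG.eq_zero, ?_, ?_, hcomm, hcont,
    hnorm, ?_, ?_, fun t ht => (hN t ht).2⟩⟩
  · ext x
    refine tendsto_nhds_unique (hS' 0 le_rfl x) ?_
    simp
  · intro s t hs ht
    ext x
    refine tendsto_nhds_unique (hS' (s + t) (add_nonneg hs ht) x) ?_
    refine (tendsto_apply_of_strong (fun n => hG.norm_expGroup_yosidaSeq_le_one n hs) (hS' s hs)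
      (hS' t ht x)).congr fun n => ?_
    rw [Complex.ofReal_add, expGroup_add]; rfl
  · intro t ht y
    have h1 : Tendsto (fun n => ∫ τ in (0 : ℝ)..t, expGroup (yosidaSeq G n) τ (yosidaSeq G n (G y)))
        atTop (𝓝 (∫ τ in (0 : ℝ)..t, S τ y)) := by
      refine intervalIntegral.tendsto_integral_filter_of_dominated_convergence (fun _ => 2 * ‖y‖)
        (Eventually.of_forall fun n => ?_) (Eventually.of_forall fun n => ?_)
        intervalIntegrable_const (Eventually.of_forall fun τ hτ => ?_)
      · have : Continuous fun τ : ℝ => expGroup (yosidaSeq G n) τ (yosidaSeq G n (G y)) :=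
          continuous_iff_continuousAt.2 fun τ => (hasDerivAt_expGroup_apply _ τ _).continuousAt
        exact this.aestronglyMeasurable
      · refine Eventually.of_forall fun τ hτ => ?_
        rw [uIoc_of_le ht] at hτ
        refine ((expGroup (yosidaSeq G n) τ).le_of_opNorm_le
          (hG.norm_expGroup_yosidaSeq_le_one n hτ.1.le) _).trans ?_
        rw [one_mul]
        exact hG.norm_yosida_apply_le (by positivity) y
      · rw [uIoc_of_le ht] at hτ
        exact tendsto_apply_of_strong (fun n => hG.norm_expGroup_yosidaSeq_le_one n hτ.1.le)
          (hS' τ hτ.1.le) (hG.tendsto_yosidaSeq y)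
    refine tendsto_nhds_unique ((hS' t ht (G y)).sub_const (G y)) (h1.neg.congr fun n => ?_)
    have hd : ∀ τ : ℝ, HasDerivAt (fun τ : ℝ => expGroup (yosidaSeq G n) τ (G y))
        (-(expGroup (yosidaSeq G n) τ (yosidaSeq G n (G y)))) τ := by
      intro τ
      refine (hasDerivAt_expGroup_apply (yosidaSeq G n) τ (G y)).congr_deriv ?_
      exact congrArg (fun T : H →L[ℂ] H => -T (G y))
        (expGroup_commute (Commute.refl (yosidaSeq G n)) τ).eq
    have hi : Continuous fun τ : ℝ => -expGroup (yosidaSeq G n) τ (yosidaSeq G n (G y)) :=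
      (continuous_iff_continuousAt.2 fun τ => (hasDerivAt_expGroup_apply _ τ _).continuousAt).neg
    have := intervalIntegral.integral_eq_sub_of_hasDerivAt (a := 0) (b := t) (fun τ _ => hd τ)
      (hi.intervalIntegrable _ _)
    rw [intervalIntegral.integral_neg] at this
    simpa using this
  · intro t ht x
    have hNG : ∀ y, N t (G y) = S t y := fun y =>
      tendsto_nhds_unique ((hN t ht).1 (G y))
        (tendsto_apply_of_strong (fun n => hG.norm_expGroup_yosidaSeq_le_one n ht.le)
          (hS' t ht.le) (hG.tendsto_yosidaSeq y))
    have : G * N t = S t := eq_of_mul_eq_of_denseRange hG.denseRange fun y => by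
      change G (N t (G y)) = _
      rw [hNG, hcomm t ht.le]
    exact congrArg (fun T : H →L[ℂ] H => T x) this

end IsSectorialInverse

end Construction

/-! ### Uniqueness of the semigroup -/

section Generator

variable {H : Type*} [NormedAddCommGroup H] [InnerProductSpace ℂ H] {A : H →ₗ.[ℂ] H}

theorem HasDerivWithinAt.of_tendsto_right {E : Type*} [NormedAddCommGroup E] [NormedSpace ℝ E]
    {f : ℝ → E} {f' : E} {t : ℝ}
    (h : Tendsto (fun h : ℝ => h⁻¹ • (f (t + h) - f t)) (𝓝[>] 0) (𝓝 f')) :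
    HasDerivWithinAt f f' (Ici t) t := by
  rw [← hasDerivWithinAt_Ioi_iff_Ici, hasDerivWithinAt_iff_tendsto_slope' (by simp)]
  have h1 : Tendsto (fun s => s - t) (𝓝[>] t) (𝓝[>] 0) := by
    refine tendsto_nhdsWithin_iff.2 ⟨?_, ?_⟩
    · have : Tendsto (fun s => s - t) (𝓝 t) (𝓝 (t - t)) := (continuous_sub_right t).tendsto t
      rw [sub_self] at this
      exact this.mono_left nhdsWithin_le_nhds
    · filter_upwards [self_mem_nhdsWithin] with s hs
      exact sub_pos.2 (mem_Ioi.1 hs)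
  refine (h.comp h1).congr fun s => ?_
  simp [slope_def_module]

namespace IsSemigroupOfNeg

variable {S S' : ℝ → H →L[ℂ] H}

theorem mem_graph (hS : IsSemigroupOfNeg A S) {x y : H} (hxy : (x, y) ∈ A.graph) {t : ℝ}
    (ht : 0 ≤ t) : (S t x, S t y) ∈ A.graph ∧
      HasDerivWithinAt (fun τ => S τ x) (-(S t y)) (Ici t) t := by
  have h1 := (((S t).continuous.tendsto _).comp ((hS.generator x y).1 hxy))
  rw [map_neg] at h1
  constructor
  · refine (hS.generator _ _).2 (h1.congr' ?_)
    filter_upwards [self_mem_nhdsWithin] with h hh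
    have e : S h (S t x) = S t (S h x) := by
      have h2 := hS.add h t (le_of_lt hh) ht
      rw [add_comm, hS.add t h ht (le_of_lt hh)] at h2
      exact congrArg (fun T : H →L[ℂ] H => T x) h2.symm
    rw [Function.comp_apply, ContinuousLinearMap.map_smul_of_tower, map_sub, e]
  · refine .of_tendsto_right (h1.congr' ?_)
    filter_upwards [self_mem_nhdsWithin] with h hh
    rw [Function.comp_apply, ContinuousLinearMap.map_smul_of_tower, map_sub,
      hS.add t h ht (le_of_lt hh)]
    rfl

/-- An accretive operator with dense domain generates at most one semigroup: the difference of two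
orbits solves `d' = -A d`, `d(0) = 0`, so its norm does not grow. -/
theorem eq_of_accretive (hS : IsSemigroupOfNeg A S) (hS' : IsSemigroupOfNeg A S')
    (hA : ∀ x y, (x, y) ∈ A.graph → 0 ≤ (inner ℂ y x).re)
    (hdense : Dense {x | ∃ y, (x, y) ∈ A.graph}) {t : ℝ} (ht : 0 ≤ t) : S t = S' t := by
  ext x
  revert x
  refine fun x => congrFun (Continuous.ext_on hdense (S t).continuous (S' t).continuous ?_) x
  rintro x ⟨y, hxy⟩
  have hd : ∀ τ : ℝ, 0 ≤ τ → HasDerivWithinAt (fun τ => S τ x - S' τ x)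
      (-(S τ y - S' τ y)) (Ici τ) τ := by
    intro τ hτ
    refine ((hS.mem_graph hxy hτ).2.sub (hS'.mem_graph hxy hτ).2).congr_deriv ?_
    abel
  -- The squared norm of the difference starts at `0` and has a non-positive right derivative.
  have hb := image_le_of_deriv_right_le_deriv_boundary (a := 0) (b := t)
    (f := fun τ => ‖S τ x - S' τ x‖ ^ 2) (B := fun _ => 0) (B' := fun _ => 0)
    (((((hS.continuousOn x).sub (hS'.continuousOn x)).mono Icc_subset_Ici_self).norm.pow 2))
    (fun τ hτ => hasDerivWithinAt_norm_sq (hd τ hτ.1)) (by simp [hS.zero, hS'.zero])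
    continuousOn_const (fun _ _ => hasDerivWithinAt_const _ _ _) (fun τ hτ => ?_)
    (right_mem_Icc.2 ht)
  · have : ‖S t x - S' t x‖ = 0 := by
      nlinarith [norm_nonneg (S t x - S' t x)]
    exact sub_eq_zero.1 (norm_eq_zero.1 this)
  · have := hA _ _ (A.graph.sub_mem (hS.mem_graph hxy hτ.1).1 (hS'.mem_graph hxy hτ.1).1)
    rw [inner_neg_left, Complex.neg_re]
    linarith

end IsSemigroupOfNeg

end Generator

section AnalyticEstimates

variable {H : Type*} [NormedAddCommGroup H] [NormedSpace ℂ H]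

theorem continuousOn_Ioi_of_lipschitz {E : Type*} [SeminormedAddCommGroup E] {f : ℝ → E}
    {L : ℝ → ℝ} (hf : ∀ a s t, 0 < a → a ≤ s → s ≤ t → ‖f t - f s‖ ≤ L a * (t - s)) :
    ContinuousOn f (Ioi 0) := by
  intro t₀ ht₀
  have ha : 0 < t₀ / 2 := half_pos ht₀
  have hL : LipschitzOnWith (Real.toNNReal (L (t₀ / 2))) f (Ici (t₀ / 2)) := by
    refine LipschitzOnWith.of_dist_le_mul fun s hs t ht => ?_
    have h0 : L (t₀ / 2) ≤ Real.toNNReal (L (t₀ / 2)) := Real.le_coe_toNNReal _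
    rw [dist_eq_norm, Real.dist_eq]
    rcases le_total s t with h | h
    · rw [norm_sub_rev, abs_sub_comm, abs_of_nonneg (sub_nonneg.2 h)]
      exact (hf _ s t ha hs h).trans (mul_le_mul_of_nonneg_right h0 (sub_nonneg.2 h))
    · rw [abs_of_nonneg (sub_nonneg.2 h)]
      exact (hf _ t s ha ht h).trans (mul_le_mul_of_nonneg_right h0 (sub_nonneg.2 h))
  exact (hL.continuousOn.continuousAt (Ici_mem_nhds (half_lt_self ht₀))).continuousWithinAt

namespace IsStableAnalytic

variable {G : H →L[ℂ] H} {S N : ℝ → H →L[ℂ] H} {κ C : ℝ} (h : IsStableAnalytic G S N κ C)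
include h

theorem injective : Function.Injective G :=
  (injective_iff_map_eq_zero G).2 h.eq_zero

theorem norm_le_one {t : ℝ} (ht : 0 ≤ t) : ‖S t‖ ≤ 1 := by
  refine (h.norm_le t ht).trans (Real.exp_le_one_iff.2 ?_)
  linarith [mul_nonneg h.pos.le ht]

theorem norm_apply_le {t : ℝ} (ht : 0 ≤ t) (x : H) : ‖S t x‖ ≤ ‖x‖ := by
  simpa using (S t).le_of_opNorm_le (h.norm_le_one ht) x

theorem intervalIntegrable (x : H) {s t : ℝ} (hs : 0 ≤ s) (ht : 0 ≤ t) :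
    IntervalIntegrable (fun τ => S τ x) volume s t :=
  ((h.continuousOn x).mono fun _ hτ => (le_min hs ht).trans hτ.1).intervalIntegrable

theorem apply_sub_apply {s t : ℝ} (hs : 0 ≤ s) (ht : 0 ≤ t) (y : H) :
    S t (G y) - S s (G y) = -∫ τ in s..t, S τ y := by
  rw [← intervalIntegral.integral_interval_sub_left (h.intervalIntegrable y le_rfl ht)
    (h.intervalIntegrable y le_rfl hs), neg_sub, ← sub_sub_sub_cancel_right _ _ (G y),
    h.apply_sub t ht, h.apply_sub s hs]
  abel

theorem norm_apply_sub_le {s t : ℝ} (hs : 0 ≤ s) (hst : s ≤ t) (y : H) :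
    ‖S t (G y) - S s (G y)‖ ≤ ‖y‖ * (t - s) := by
  rw [h.apply_sub_apply hs (hs.trans hst), norm_neg]
  have := intervalIntegral.norm_integral_le_of_norm_le_const (a := s) (b := t) (C := ‖y‖)
    (f := fun τ => S τ y) fun τ hτ => by
      rw [uIoc_of_le hst] at hτ
      exact h.norm_apply_le (hs.trans hτ.1.le) y
  rwa [abs_of_nonneg (sub_nonneg.2 hst)] at this

theorem deriv_mul {t s : ℝ} (ht : 0 < t) (hs : 0 ≤ s) : N t * S s = N (t + s) := by
  ext x
  apply h.injective
  change G (N t (S s x)) = G (N (t + s) x)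
  rw [h.apply_deriv t ht, h.apply_deriv _ (by linarith), h.add t s ht.le hs]
  rfl

theorem norm_sub_le {s t : ℝ} (hs : 0 < s) (hst : s ≤ t) : ‖S t - S s‖ ≤ ‖N s‖ * (t - s) := by
  refine ContinuousLinearMap.opNorm_le_bound _
    (mul_nonneg (norm_nonneg _) (sub_nonneg.2 hst)) fun x => ?_
  have e : S t x - S s x = S (t - s) (G (N s x)) - S 0 (G (N s x)) := by
    rw [h.apply_deriv s hs, h.zero]
    have := h.add (t - s) s (sub_nonneg.2 hst) hs.le
    rw [sub_add_cancel] at this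
    rw [this]; rfl
  rw [sub_apply, e]
  refine (h.norm_apply_sub_le le_rfl (sub_nonneg.2 hst) _).trans ?_
  rw [sub_zero, mul_right_comm]
  exact mul_le_mul_of_nonneg_right ((N s).le_opNorm x) (sub_nonneg.2 hst)

theorem const_nonneg : 0 ≤ C := by
  have := (norm_nonneg _).trans (h.norm_deriv_le 1 one_pos)
  rw [inv_one, mul_one] at this
  exact nonneg_of_mul_nonneg_left this (Real.exp_pos _)

theorem norm_deriv_le_div {a t : ℝ} (ha : 0 < a) (hat : a ≤ t) : ‖N t‖ ≤ C / a := by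
  have ht := ha.trans_le hat
  have hC := h.const_nonneg
  calc ‖N t‖ ≤ C * t⁻¹ * Real.exp (-(κ * t)) := h.norm_deriv_le t ht
    _ ≤ C * t⁻¹ * 1 := by
      refine mul_le_mul_of_nonneg_left (Real.exp_le_one_iff.2 ?_) (by positivity)
      linarith [mul_nonneg h.pos.le ht.le]
    _ ≤ C / a := by
      rw [mul_one, div_eq_mul_inv]
      gcongr

theorem continuousOn_Ioi : ContinuousOn S (Ioi 0) :=
  continuousOn_Ioi_of_lipschitz (L := fun a => C / a) fun _ _ _ ha has hst =>
    (h.norm_sub_le (ha.trans_le has) hst).trans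
      (mul_le_mul_of_nonneg_right (h.norm_deriv_le_div ha has) (sub_nonneg.2 hst))

theorem norm_deriv_sub_le {s t : ℝ} (hs : 0 < s) (hst : s ≤ t) :
    ‖N t - N s‖ ≤ ‖N (s / 2)‖ ^ 2 * (t - s) := by
  have h2 : 0 < s / 2 := half_pos hs
  have e1 : N t = N (s / 2) * S (t - s / 2) := by
    rw [h.deriv_mul h2 (by linarith)]; congr 1; ring
  have e2 : N s = N (s / 2) * S (s / 2) := by
    rw [h.deriv_mul h2 h2.le]; congr 1; ring
  rw [e1, e2, ← mul_sub]
  have h3 := h.norm_sub_le h2 (show s / 2 ≤ t - s / 2 by linarith)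
  rw [show t - s / 2 - s / 2 = t - s by ring] at h3
  calc _ ≤ ‖N (s / 2)‖ * ‖S (t - s / 2) - S (s / 2)‖ := norm_mul_le _ _
    _ ≤ ‖N (s / 2)‖ * (‖N (s / 2)‖ * (t - s)) := by gcongr
    _ = _ := by ring

theorem continuousOn_deriv : ContinuousOn N (Ioi 0) :=
  continuousOn_Ioi_of_lipschitz (L := fun a => (C / (a / 2)) ^ 2) fun a s t ha has hst => by
    refine (h.norm_deriv_sub_le (ha.trans_le has) hst).trans
      (mul_le_mul_of_nonneg_right ?_ (sub_nonneg.2 hst))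
    gcongr
    exact h.norm_deriv_le_div (half_pos ha) (by linarith)

variable {A : H →ₗ.[ℂ] H}

theorem isSemigroupOfNeg (hA : ∀ x y, (x, y) ∈ A.graph ↔ x = G y) [CompleteSpace H] :
    IsSemigroupOfNeg A S := by
  have hd : ∀ y, Tendsto (fun t : ℝ => t⁻¹ • (S t (G y) - G y)) (𝓝[>] 0) (𝓝 (-y)) := by
    intro y
    have h1 : HasDerivWithinAt (fun t => ∫ τ in (0 : ℝ)..t, S τ y) (S 0 y) (Ici 0) 0 := by
      refine intervalIntegral.integral_hasDerivWithinAt_right (by simp) ?_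
        (((h.continuousOn y) 0 self_mem_Ici).mono Ioi_subset_Ici_self)
      exact ⟨Ioi 0, self_mem_nhdsWithin, ((h.continuousOn y).mono
        Ioi_subset_Ici_self).aestronglyMeasurable measurableSet_Ioi⟩
    have h2 := (hasDerivWithinAt_iff_tendsto_slope' (by simp)).1 h1.Ioi_of_Ici
    rw [h.zero] at h2
    refine h2.neg.congr' ?_
    filter_upwards [self_mem_nhdsWithin] with t ht
    rw [h.apply_sub t (le_of_lt ht)]
    simp [slope_def_module]
  refine ⟨h.zero, h.add, h.continuousOn, fun x y => ⟨fun hxy => ?_, fun hxy => ?_⟩⟩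
  · rw [(hA x y).1 hxy]
    exact hd y
  · rw [hA]
    have h1 := ((G.continuous.tendsto _).comp hxy).congr' (f₂ := fun t : ℝ =>
      t⁻¹ • (S t (G x) - G x)) (by
        filter_upwards [self_mem_nhdsWithin] with t ht
        rw [Function.comp_apply, ContinuousLinearMap.map_smul_of_tower, map_sub,
          h.commute t (le_of_lt ht)])
    have := tendsto_nhds_unique h1 (hd x)
    rw [map_neg] at this
    exact (neg_injective this).symm

theorem congr {S' : ℝ → H →L[ℂ] H} (hS : ∀ t, 0 ≤ t → S' t = S t) :
    IsStableAnalytic G S' N κ C where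
  pos := h.pos
  eq_zero := h.eq_zero
  zero := (hS 0 le_rfl).trans h.zero
  add s t hs ht := by rw [hS _ (add_nonneg hs ht), hS s hs, hS t ht, h.add s t hs ht]
  commute t ht x := by rw [hS t ht, h.commute t ht]
  continuousOn x := (h.continuousOn x).congr fun t ht => by simp only [hS t ht]
  norm_le t ht := by rw [hS t ht]; exact h.norm_le t ht
  apply_sub t ht y := by
    rw [hS t ht, h.apply_sub t ht]
    congr 1
    refine intervalIntegral.integral_congr fun τ hτ => ?_
    rw [uIcc_of_le ht] at hτ
    simp only [hS τ hτ.1]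
  apply_deriv t ht x := by rw [hS t ht.le, h.apply_deriv t ht]
  norm_deriv_le := h.norm_deriv_le

end IsStableAnalytic

end AnalyticEstimates

/-- For an operator `A` with sectorial inverse, `expNeg A` is the analytic semigroup constructed
from the Yosida approximations. -/
theorem IsSectorialInverse.exists_isStableAnalytic_expNeg {H : Type*} [NormedAddCommGroup H]
    [InnerProductSpace ℂ H] [CompleteSpace H] {A : H →ₗ.[ℂ] H} {G : H →L[ℂ] H} {c K : ℝ}
    (hG : IsSectorialInverse G c K) (hA : ∀ x y, (x, y) ∈ A.graph ↔ x = G y) :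
    ∃ N κ C, IsStableAnalytic G (expNeg A) N κ C := by
  obtain ⟨S, N, h⟩ := hG.exists_isStableAnalytic
  have hS := h.isSemigroupOfNeg hA
  have hex : ∃ S, IsSemigroupOfNeg A S := ⟨S, hS⟩
  have hE : IsSemigroupOfNeg A (expNeg A) := by
    rw [expNeg, dif_pos hex]
    exact hex.choose_spec
  refine ⟨N, _, _, h.congr fun t ht => hE.eq_of_accretive hS (fun x y hxy => ?_) ?_ ht⟩
  · rw [(hA x y).1 hxy]
    exact hG.re_nonneg y
  · refine hG.denseRange.mono ?_
    rintro _ ⟨y, rfl⟩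
    exact ⟨y, (hA _ _).2 rfl⟩

/-! ### Fractional powers -/

section FractionalPowers

variable {H : Type*} [NormedAddCommGroup H] [NormedSpace ℂ H]

/-- The operator `∫₀^∞ t^{s-1} S(t) dt = Γ(s) A^{-s}`. -/
def gammaIntegral (S : ℝ → H →L[ℂ] H) (s : ℝ) : H →L[ℂ] H :=
  ∫ t in Ioi (0 : ℝ), t ^ (s - 1) • S t

theorem integrableOn_rpow_mul_exp {s b : ℝ} (hs : 0 < s) (hb : 0 < b) :
    IntegrableOn (fun t : ℝ => t ^ (s - 1) * Real.exp (-(b * t))) (Ioi 0) := by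
  have := integrableOn_rpow_mul_exp_neg_mul_rpow (p := 1) (s := s - 1) (b := b) (by linarith)
    one_pos hb
  simpa using this

namespace IsStableAnalytic

variable {G : H →L[ℂ] H} {S N : ℝ → H →L[ℂ] H} {κ C : ℝ} (h : IsStableAnalytic G S N κ C)
include h

theorem integrableOn_rpow_smul {s : ℝ} (hs : 0 < s) :
    IntegrableOn (fun t : ℝ => t ^ (s - 1) • S t) (Ioi 0) := by
  refine Integrable.mono' (integrableOn_rpow_mul_exp hs h.pos) ?_ ?_
  · have hr : ContinuousOn (fun t : ℝ => t ^ (s - 1)) (Ioi 0) := fun t ht =>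
      (Real.continuousAt_rpow_const _ _ (Or.inl (ne_of_gt ht))).continuousWithinAt
    exact (hr.smul h.continuousOn_Ioi).aestronglyMeasurable measurableSet_Ioi
  · refine (ae_restrict_iff' measurableSet_Ioi).2 (Eventually.of_forall fun t ht => ?_)
    have ht' : 0 < t := ht
    rw [norm_smul, Real.norm_of_nonneg (Real.rpow_nonneg ht'.le _)]
    exact mul_le_mul_of_nonneg_left (h.norm_le t ht'.le) (Real.rpow_nonneg ht'.le _)

variable [CompleteSpace H]

omit [CompleteSpace H] in
theorem gammaIntegral_apply {s : ℝ} (hs : 0 < s) (x : H) :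
    gammaIntegral S s x = ∫ t in Ioi (0 : ℝ), t ^ (s - 1) • S t x :=
  ContinuousLinearMap.integral_apply (h.integrableOn_rpow_smul hs) x

omit [CompleteSpace H] in
theorem gammaIntegral_one : gammaIntegral S 1 = G := by
  ext x
  rw [h.gammaIntegral_apply one_pos]
  have hi : IntegrableOn (fun t => S t x) (Ioi 0) := by
    have := (h.integrableOn_rpow_smul one_pos).apply_continuousLinearMap x
    simpa [IntegrableOn] using this
  simp only [sub_self, Real.rpow_zero, one_smul]
  refine tendsto_nhds_unique (intervalIntegral_tendsto_integral_Ioi 0 hi tendsto_id) ?_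
  have h1 : Tendsto (fun t => S t (G x)) atTop (𝓝 0) := by
    have h0 : Tendsto (fun t => Real.exp (-(κ * t)) * ‖G x‖) atTop (𝓝 0) := by
      have := (Real.tendsto_exp_neg_atTop_nhds_zero.comp
        (tendsto_id.const_mul_atTop h.pos)).mul_const ‖G x‖
      simpa using this
    refine squeeze_zero_norm' ?_ h0
    filter_upwards [eventually_ge_atTop 0] with t ht
    exact (S t).le_of_opNorm_le (h.norm_le t ht) _
  have h2 : Tendsto (fun t => G x - S t (G x)) atTop (𝓝 (G x)) := by
    simpa using h1.const_sub (G x)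
  refine h2.congr' ?_
  filter_upwards [eventually_ge_atTop 0] with t ht
  rw [← neg_sub, h.apply_sub t ht, neg_neg]
  rfl

/-- `A^{-a} A^{-b} = A^{-(a+b)}`, by Euler's integral for the Beta function. -/
theorem gammaIntegral_mul {a b : ℝ} (ha : 0 < a) (hb : 0 < b) :
    gammaIntegral S a * gammaIntegral S b =
      Complex.betaIntegral a b • gammaIntegral S (a + b) := by
  have hc : ∀ s : ℝ, ∀ t ∈ Ioi (0 : ℝ),
      t ^ (s - 1) • S t = (t : ℂ) ^ ((s : ℂ) - 1) • S t := by
    intro s t ht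
    rw [← Complex.coe_smul, Complex.ofReal_cpow (le_of_lt ht)]
    push_cast; rfl
  have hI : ∀ {s : ℝ}, 0 < s →
      IntegrableOn (fun t : ℝ => (t : ℂ) ^ ((s : ℂ) - 1) • S t) (Ioi 0) := fun hs =>
    (h.integrableOn_rpow_smul hs).congr_fun (hc _) measurableSet_Ioi
  have hg : ∀ s, gammaIntegral S s = ∫ t in Ioi (0 : ℝ), (t : ℂ) ^ ((s : ℂ) - 1) • S t :=
    fun s => setIntegral_congr_fun measurableSet_Ioi (hc s)
  have hconv := integral_posConvolution (hI ha) (hI hb) (ContinuousLinearMap.mul ℝ (H →L[ℂ] H))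
  rw [hg a, hg b, hg (a + b)]
  change _ = (∫ t in Ioi (0 : ℝ), (t : ℂ) ^ ((a : ℂ) - 1) • S t) *
    ∫ t in Ioi (0 : ℝ), (t : ℂ) ^ ((b : ℂ) - 1) • S t at hconv
  rw [← hconv, ← integral_smul]
  refine setIntegral_congr_fun measurableSet_Ioi fun x hx => ?_
  have hx0 : (0 : ℝ) < x := hx
  have e : ∫ t in (0 : ℝ)..x, ContinuousLinearMap.mul ℝ (H →L[ℂ] H) ((t : ℂ) ^ ((a : ℂ) - 1) • S t)
      (((x - t : ℝ) : ℂ) ^ ((b : ℂ) - 1) • S (x - t)) =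
      ∫ t in (0 : ℝ)..x, ((t : ℂ) ^ ((a : ℂ) - 1) * ((x : ℂ) - t) ^ ((b : ℂ) - 1)) • S x := by
    refine intervalIntegral.integral_congr fun t ht => ?_
    rw [uIcc_of_le hx0.le] at ht
    have h1 := h.add t (x - t) ht.1 (sub_nonneg.2 ht.2)
    rw [add_sub_cancel] at h1
    simp only [ContinuousLinearMap.mul_apply']
    rw [smul_mul_smul_comm, ← h1, Complex.ofReal_sub]
  rw [e, intervalIntegral.integral_smul_const, Complex.betaIntegral_scaled _ _ hx0, smul_smul,
    mul_comm (Complex.betaIntegral _ _)]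
  push_cast
  rfl

omit h [CompleteSpace H] in
theorem betaIntegral_ne_zero {a b : ℝ} (ha : 0 < a) (hb : 0 < b) :
    Complex.betaIntegral a b ≠ 0 := by
  intro h0
  have h1 := Complex.Gamma_mul_Gamma_eq_betaIntegral (s := a) (t := b) (by simpa) (by simpa)
  rw [h0, mul_zero] at h1
  rcases mul_eq_zero.1 h1 with h2 | h2
  · exact Complex.Gamma_ne_zero_of_re_pos (by simpa) h2
  · exact Complex.Gamma_ne_zero_of_re_pos (by simpa) h2

theorem eq_zero_of_gammaIntegral_nat (n : ℕ) {x : H} (hx : gammaIntegral S (n + 1) x = 0) :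
    x = 0 := by
  induction n with
  | zero =>
    rw [Nat.cast_zero, zero_add, h.gammaIntegral_one] at hx
    exact h.eq_zero x hx
  | succ n ih =>
    apply ih
    apply h.eq_zero
    have h1 := congrArg (fun T : H →L[ℂ] H => T x)
      (h.gammaIntegral_mul one_pos (b := n + 1) (by positivity))
    rw [h.gammaIntegral_one] at h1
    refine h1.trans ?_
    rw [smul_apply, show (1 : ℝ) + (n + 1) = ((n + 1 : ℕ) : ℝ) + 1 by push_cast; ring, hx,
      smul_zero]

/-- `A^{-s}` is injective, because `A^{-(n+1-s)} A^{-s}` is a multiple of `G^{n+1}`. -/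
theorem eq_zero_of_gammaIntegral {s : ℝ} (hs : 0 < s) {x : H} (hx : gammaIntegral S s x = 0) :
    x = 0 := by
  obtain ⟨n, hn⟩ := exists_nat_gt s
  have h1 := congrArg (fun T : H →L[ℂ] H => T x)
    (h.gammaIntegral_mul (a := n + 1 - s) (b := s) (by linarith) hs)
  refine h.eq_zero_of_gammaIntegral_nat n ?_
  rw [sub_add_cancel] at h1
  have h2 : Complex.betaIntegral ((n + 1 - s : ℝ) : ℂ) s • gammaIntegral S (n + 1) x = 0 := by
    rw [← smul_apply, ← h1]
    change gammaIntegral S (n + 1 - s) (gammaIntegral S s x) = 0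
    rw [hx, map_zero]
  exact (smul_eq_zero.1 h2).resolve_left (betaIntegral_ne_zero (by linarith) hs)

omit [CompleteSpace H] in
/-- Since `t^{1-δ} s^δ ≤ t + s`, the integrand of `A^{1-s} e^{-At}` loses only the integrable
power `t^{δ-1}`. -/
theorem norm_deriv_mul_gammaIntegral_le {s : ℝ} (hs : 0 < s) :
    ∃ δ B : ℝ, 0 < δ ∧ ∀ t, 0 < t →
      ‖N t * gammaIntegral S s‖ ≤ B * (t ^ (δ - 1) * Real.exp (-(κ * t))) := by
  have hC := h.const_nonneg
  set δ := min s 1 / 2 with hδ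
  have hm : 0 < min s 1 := lt_min hs one_pos
  have hδ0 : 0 < δ := by positivity
  have hδs : 0 < s - δ := by linarith [min_le_left s 1]
  have hδ1 : δ < 1 := by linarith [min_le_right s 1]
  refine ⟨δ, C * ∫ τ in Ioi (0 : ℝ), τ ^ (s - δ - 1) * Real.exp (-(κ * τ)), hδ0, fun t ht => ?_⟩
  rw [gammaIntegral, ← integral_const_mul_of_integrable (h.integrableOn_rpow_smul hs)]
  have hint := integrableOn_rpow_mul_exp hδs h.pos
  calc _ ≤ ∫ τ in Ioi (0 : ℝ), C * (t ^ (δ - 1) * Real.exp (-(κ * t))) *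
        (τ ^ (s - δ - 1) * Real.exp (-(κ * τ))) := by
        refine norm_integral_le_of_norm_le (hint.const_mul _) ?_
        refine (ae_restrict_iff' measurableSet_Ioi).2 (Eventually.of_forall fun τ hτ => ?_)
        have hτ0 : 0 < τ := hτ
        rw [mul_smul_comm, norm_smul, Real.norm_of_nonneg (Real.rpow_nonneg hτ0.le _),
          h.deriv_mul ht hτ0.le]
        have h1 : (t + τ)⁻¹ ≤ t ^ (δ - 1) * τ ^ (-δ) := by
          have h2 := Real.geom_mean_le_arith_mean2_weighted (sub_nonneg.2 hδ1.le) hδ0.le ht.le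
            hτ0.le (sub_add_cancel 1 δ)
          have h3 : t ^ (1 - δ) * τ ^ δ ≤ t + τ := by nlinarith
          have h4 : 0 < t ^ (1 - δ) * τ ^ δ := by positivity
          refine (inv_anti₀ h4 h3).trans (le_of_eq ?_)
          rw [mul_inv, ← Real.rpow_neg ht.le, ← Real.rpow_neg hτ0.le, neg_sub]
        have h5 : Real.exp (-(κ * (t + τ))) = Real.exp (-(κ * t)) * Real.exp (-(κ * τ)) := by
          rw [← Real.exp_add]; ring_nf
        have h6 : τ ^ (s - δ - 1) = τ ^ (s - 1) * τ ^ (-δ) := by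
          rw [← Real.rpow_add hτ0]; ring_nf
        calc τ ^ (s - 1) * ‖N (t + τ)‖
            ≤ τ ^ (s - 1) * (C * (t + τ)⁻¹ * Real.exp (-(κ * (t + τ)))) := by
              gcongr
              exact h.norm_deriv_le _ (by linarith)
          _ ≤ τ ^ (s - 1) * (C * (t ^ (δ - 1) * τ ^ (-δ)) * Real.exp (-(κ * (t + τ)))) := by
              gcongr
          _ = _ := by rw [h5, h6]; ring
    _ = _ := by rw [integral_const_mul]; ring

end IsStableAnalytic

end FractionalPowers

/-! ### Convolution with an operator kernel -/

section Convolution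

variable {E : Type*} [NormedAddCommGroup E]

/-- The modulus of continuity of translations `∫ ‖k(s + r) - k(s)‖ ds`. -/
def translationModulus (k : ℝ → E) (r : ℝ) : ℝ := ∫ s, ‖k (s + r) - k s‖

/-- Translations act continuously on `L¹(ℝ)`. -/
theorem tendsto_translationModulus {k : ℝ → E} (hk : Integrable k) :
    Tendsto (translationModulus k) (𝓝 0) (𝓝 0) := by
  have : Fact ((1 : ENNReal) ≠ ⊤) := ⟨ENNReal.one_ne_top⟩
  have hc : Continuous fun r : ℝ => (DomAddAct.mk r) +ᵥ hk.toL1 k :=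
    (DomAddAct.continuous_mk).vadd continuous_const
  have h1 : Tendsto (fun r : ℝ => ‖((DomAddAct.mk r) +ᵥ hk.toL1 k) - hk.toL1 k‖) (𝓝 0) (𝓝 0) := by
    have := ((hc.sub continuous_const).norm.tendsto (0 : ℝ) :
      Tendsto (fun r : ℝ => ‖((DomAddAct.mk r) +ᵥ hk.toL1 k) - hk.toL1 k‖) _ _)
    simpa using this
  refine h1.congr fun r => ?_
  have hkr : Integrable fun s => k (r + s) := hk.comp_add_left r
  have e : ((DomAddAct.mk r) +ᵥ hk.toL1 k) = hkr.toL1 _ := by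
    rw [Integrable.toL1, DomAddAct.mk_vadd_toLp]
    rfl
  rw [e, ← Integrable.toL1_sub, L1.norm_of_fun_eq_integral_norm]
  simp only [translationModulus, Pi.sub_apply, add_comm]

end Convolution

section KernelConvolution

variable {E : Type*} [NormedAddCommGroup E] [NormedSpace ℂ E]

/-- The convolution `∫ k(s) h(t - s) ds` of an operator-valued kernel with a function. -/
def kernelConv (k : ℝ → E →L[ℂ] E) (h : ℝ → E) (t : ℝ) : E := ∫ s, k s (h (t - s))

variable {k : ℝ → E →L[ℂ] E} {h : ℝ → E} {M : ℝ}

theorem aestronglyMeasurable_apply {α : Type*} [MeasurableSpace α] {μ : Measure α}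
    {F : α → E →L[ℂ] E} {g : α → E} (hF : AEStronglyMeasurable F μ)
    (hg : AEStronglyMeasurable g μ) : AEStronglyMeasurable (fun a => F a (g a)) μ :=
  (ContinuousLinearMap.id ℂ (E →L[ℂ] E)).aestronglyMeasurable_comp₂ hF hg

theorem norm_apply_le_of_norm_le {α : Type*} [MeasurableSpace α] {μ : Measure α}
    {F : α → E →L[ℂ] E} {g : α → E} (hg : ∀ᵐ a ∂μ, ‖g a‖ ≤ M) :
    ∀ᵐ a ∂μ, ‖F a (g a)‖ ≤ M * ‖F a‖ := by
  filter_upwards [hg] with a ha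
  rw [mul_comm]
  exact (F a).le_opNorm_of_le ha

theorem integrable_apply {α : Type*} [MeasurableSpace α] {μ : Measure α}
    {F : α → E →L[ℂ] E} {g : α → E} (hF : Integrable F μ)
    (hg : AEStronglyMeasurable g μ) (hM : ∀ᵐ a ∂μ, ‖g a‖ ≤ M) :
    Integrable (fun a => F a (g a)) μ :=
  (hF.norm.const_mul M).mono' (aestronglyMeasurable_apply hF.1 hg) (norm_apply_le_of_norm_le hM)

theorem norm_integral_apply_le {α : Type*} [MeasurableSpace α] {μ : Measure α}
    {F : α → E →L[ℂ] E} {g : α → E} (hF : Integrable F μ) (hM : ∀ᵐ a ∂μ, ‖g a‖ ≤ M) :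
    ‖∫ a, F a (g a) ∂μ‖ ≤ M * ∫ a, ‖F a‖ ∂μ := by
  rw [← integral_const_mul]
  exact norm_integral_le_of_norm_le (hF.norm.const_mul M) (norm_apply_le_of_norm_le hM)

omit [NormedSpace ℂ E] in
theorem ae_comp_sub_left (hM : ∀ᵐ s, ‖h s‖ ≤ M) (t : ℝ) : ∀ᵐ s, ‖h (t - s)‖ ≤ M :=
  (quasiMeasurePreserving_sub_left volume t).ae hM

omit [NormedSpace ℂ E] in
theorem aestronglyMeasurable_comp_sub_left (hh : AEStronglyMeasurable h) (t : ℝ) :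
    AEStronglyMeasurable fun s => h (t - s) :=
  hh.comp_quasiMeasurePreserving (quasiMeasurePreserving_sub_left volume t)

theorem integrable_kernelConv (hk : Integrable k) (hh : AEStronglyMeasurable h)
    (hM : ∀ᵐ s, ‖h s‖ ≤ M) (t : ℝ) : Integrable fun s => k s (h (t - s)) :=
  integrable_apply hk (aestronglyMeasurable_comp_sub_left hh t) (ae_comp_sub_left hM t)

theorem norm_kernelConv_le (hk : Integrable k) (hM : ∀ᵐ s, ‖h s‖ ≤ M) (t : ℝ) :
    ‖kernelConv k h t‖ ≤ M * ∫ s, ‖k s‖ :=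
  norm_integral_apply_le hk (ae_comp_sub_left hM t)

theorem kernelConv_eq (t : ℝ) : kernelConv k h t = ∫ σ, k (t - σ) (h σ) := by
  rw [kernelConv, ← integral_sub_left_eq_self _ volume t]
  simp

theorem norm_kernelConv_sub_le (hk : Integrable k) (hh : AEStronglyMeasurable h)
    (hM : ∀ᵐ s, ‖h s‖ ≤ M) (t r : ℝ) :
    ‖kernelConv k h (t + r) - kernelConv k h t‖ ≤ M * translationModulus k r := by
  have e : kernelConv k h (t + r) = ∫ s, k (s + r) (h (t - s)) := by
    rw [kernelConv, ← integral_add_right_eq_self _ r]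
    simp
  have hkr : Integrable fun s => k (s + r) := hk.comp_add_right r
  rw [e, kernelConv, ← integral_sub
    (integrable_apply hkr (aestronglyMeasurable_comp_sub_left hh t) (ae_comp_sub_left hM t))
    (integrable_kernelConv hk hh hM t)]
  exact norm_integral_apply_le (F := fun s => k (s + r) - k s) (hkr.sub hk) (ae_comp_sub_left hM t)

theorem continuous_kernelConv (hk : Integrable k) (hh : AEStronglyMeasurable h)
    (hM : ∀ᵐ s, ‖h s‖ ≤ M) : Continuous (kernelConv k h) := by
  refine continuous_iff_continuousAt.2 fun t => ?_
  rw [ContinuousAt, tendsto_iff_norm_sub_tendsto_zero]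
  have h1 : Tendsto (fun τ => M * translationModulus k (τ - t)) (𝓝 t) (𝓝 0) := by
    have h2 : Tendsto (fun τ => τ - t) (𝓝 t) (𝓝 0) := by
      have := (continuous_sub_right t).tendsto t
      rwa [sub_self] at this
    simpa using ((tendsto_translationModulus hk).comp h2).const_mul M
  refine squeeze_zero (fun _ => norm_nonneg _) (fun τ => ?_) h1
  have := norm_kernelConv_sub_le hk hh hM t (τ - t)
  rwa [add_sub_cancel] at this

omit [NormedSpace ℂ E] in
theorem integrable_prod_of_bounded {F : ℝ × ℝ → E} {a b B : ℝ}
    (hF : AEStronglyMeasurable F ((volume.restrict (Ioc a b)).prod volume))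
    (hi : ∀ τ, Integrable fun s => F (τ, s)) (hB : ∀ τ, ∫ s, ‖F (τ, s)‖ ≤ B) :
    Integrable F ((volume.restrict (Ioc a b)).prod volume) := by
  refine (integrable_prod_iff hF).2 ⟨Eventually.of_forall hi, ?_⟩
  refine (integrable_const B).mono' hF.norm.integral_prod_right' (Eventually.of_forall fun τ => ?_)
  rw [Real.norm_of_nonneg (integral_nonneg fun _ => norm_nonneg _)]
  exact hB τ

theorem aestronglyMeasurable_comp_sub_prod {F : Type*} [TopologicalSpace F] {g : ℝ → F}
    (hg : AEStronglyMeasurable g) (a b : ℝ) :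
    AEStronglyMeasurable (fun p : ℝ × ℝ => g (p.1 - p.2))
      ((volume.restrict (Ioc a b)).prod volume) := by
  have h1 : AEStronglyMeasurable (fun p : ℝ × ℝ => g (p.1 - p.2)) (volume.prod volume) :=
    hg.comp_quasiMeasurePreserving (quasiMeasurePreserving_sub volume volume)
  refine h1.mono_ac ?_
  exact Measure.AbsolutelyContinuous.prod Measure.restrict_le_self.absolutelyContinuous
    Measure.AbsolutelyContinuous.rfl

variable [CompleteSpace E]

/-- The primitive of a convolution, with the integral over the interval falling on the function. -/
theorem intervalIntegral_kernelConv (hk : Integrable k) (hh : AEStronglyMeasurable h)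
    (hM : ∀ᵐ s, ‖h s‖ ≤ M) (hloc : LocallyIntegrable h) {a b : ℝ} (hab : a ≤ b) :
    ∫ τ in a..b, kernelConv k h τ = ∫ s, k s (∫ τ in a..b, h (τ - s)) := by
  have hint : Integrable (fun p : ℝ × ℝ => k p.2 (h (p.1 - p.2)))
      ((volume.restrict (Ioc a b)).prod volume) := by
    refine integrable_prod_of_bounded (B := ∫ s, M * ‖k s‖) ?_
      (fun τ => integrable_kernelConv hk hh hM τ) (fun τ => ?_)
    · exact aestronglyMeasurable_apply hk.1.comp_snd (aestronglyMeasurable_comp_sub_prod hh a b)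
    · exact integral_mono_ae (integrable_kernelConv hk hh hM τ).norm (hk.norm.const_mul M)
        (norm_apply_le_of_norm_le (ae_comp_sub_left hM τ))
  simp only [intervalIntegral.integral_of_le hab, kernelConv]
  rw [integral_integral_swap hint]
  refine integral_congr_ae (Eventually.of_forall fun s => ?_)
  have hi : IntervalIntegrable (fun τ => h (τ - s)) volume a b := by
    have := (hloc.integrableOn_isCompact
      (isCompact_uIcc (a := a - s) (b := b - s))).intervalIntegrable.comp_sub_right s
    simpa using this
  exact (k s).integral_comp_comm hi.1

omit [CompleteSpace E] in
/-- The primitive of a convolution, with the integral over the interval falling on the kernel. -/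
theorem intervalIntegral_kernelConv' (hk : Integrable k) (hh : AEStronglyMeasurable h)
    (hM : ∀ᵐ s, ‖h s‖ ≤ M) {a b : ℝ} (hab : a ≤ b) :
    ∫ τ in a..b, kernelConv k h τ = ∫ σ, (∫ τ in a..b, k (τ - σ)) (h σ) := by
  have hi : ∀ τ, Integrable fun σ => k (τ - σ) (h σ) := fun τ =>
    integrable_apply (hk.comp_sub_left τ) hh hM
  have hint : Integrable (fun p : ℝ × ℝ => k (p.1 - p.2) (h p.2))
      ((volume.restrict (Ioc a b)).prod volume) := by
    refine integrable_prod_of_bounded (B := M * ∫ s, ‖k s‖) ?_ hi (fun τ => ?_)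
    · exact aestronglyMeasurable_apply (aestronglyMeasurable_comp_sub_prod hk.1 a b) hh.comp_snd
    · have h1 := integral_mono_ae (hi τ).norm ((hk.comp_sub_left τ).norm.const_mul M)
        (norm_apply_le_of_norm_le hM)
      refine h1.trans (le_of_eq ?_)
      rw [integral_const_mul, integral_sub_left_eq_self (fun s => ‖k s‖) volume τ]
  simp only [intervalIntegral.integral_of_le hab, kernelConv_eq]
  rw [integral_integral_swap hint]
  refine integral_congr_ae (Eventually.of_forall fun σ => ?_)
  exact (ContinuousLinearMap.integral_apply (hk.comp_sub_right σ).integrableOn (h σ)).symm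

/-- A convolution with a function of small averages is small: `k * h` differs little from its
average over `[t, t + T]`, which is the convolution of `k` with the averages of `h`. -/
theorem norm_kernelConv_le_of_average (hk : Integrable k) (hh : LocallyIntegrable h)
    (hM : ∀ᵐ s, ‖h s‖ ≤ M) {T σ ρ : ℝ} (hT : 0 < T)
    (hσ : ∀ t, ‖∫ s in t..(t + T), h s‖ ≤ T * σ)
    (hρ : ∀ r, 0 ≤ r → r ≤ T → translationModulus k r ≤ ρ) (hM0 : 0 ≤ M) (t : ℝ) :
    ‖kernelConv k h t‖ ≤ σ * (∫ s, ‖k s‖) + M * ρ := by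
  have hm := hh.aestronglyMeasurable
  have hc := continuous_kernelConv hk hm hM
  have h1 : ‖∫ τ in t..(t + T), kernelConv k h τ‖ ≤ T * σ * ∫ s, ‖k s‖ := by
    rw [intervalIntegral_kernelConv hk hm hM hh (by linarith)]
    refine norm_integral_apply_le hk (Eventually.of_forall fun s => ?_)
    rw [intervalIntegral.integral_comp_sub_right, add_sub_right_comm]
    exact hσ _
  have h2 : ‖∫ τ in t..(t + T), (kernelConv k h τ - kernelConv k h t)‖ ≤ M * ρ * T := by
    have := intervalIntegral.norm_integral_le_of_norm_le_const (a := t) (b := t + T) (C := M * ρ)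
      (f := fun τ => kernelConv k h τ - kernelConv k h t) fun τ hτ => by
        rw [uIoc_of_le (by linarith)] at hτ
        have h3 := norm_kernelConv_sub_le hk hm hM t (τ - t)
        rw [add_sub_cancel] at h3
        exact h3.trans (mul_le_mul_of_nonneg_left
          (hρ _ (by linarith [hτ.1]) (by linarith [hτ.2])) hM0)
    rwa [add_sub_cancel_left, abs_of_pos hT] at this
  rw [intervalIntegral.integral_sub (hc.intervalIntegrable _ _) intervalIntegrable_const,
    intervalIntegral.integral_const, add_sub_cancel_left] at h2
  have h3 : ‖T • kernelConv k h t‖ ≤ T * σ * (∫ s, ‖k s‖) + M * ρ * T := by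
    rw [norm_sub_rev] at h2
    have := norm_sub_norm_le (T • kernelConv k h t) (∫ τ in t..(t + T), kernelConv k h τ)
    linarith
  rw [norm_smul, Real.norm_of_nonneg hT.le] at h3
  refine le_of_mul_le_mul_left ?_ hT
  linarith

omit [CompleteSpace E] in
theorem norm_kernelConv_add_sub_le (hk : Integrable k) (hh : AEStronglyMeasurable h)
    (hM : ∀ᵐ s, ‖h s‖ ≤ M) {τ e : ℝ} (he : ∀ t, ‖h (t + τ) - h t‖ ≤ e) (t : ℝ) :
    ‖kernelConv k h (t + τ) - kernelConv k h t‖ ≤ e * ∫ s, ‖k s‖ := by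
  rw [kernelConv, kernelConv, ← integral_sub (integrable_kernelConv hk hh hM _)
    (integrable_kernelConv hk hh hM t)]
  simp only [← map_sub]
  refine norm_integral_apply_le hk (Eventually.of_forall fun s => ?_)
  rw [add_sub_right_comm]
  exact he _

omit [CompleteSpace E] in
theorem IsAlmostPeriodic.kernelConv (hk : Integrable k) (hh : IsAlmostPeriodic h)
    (hM : ∀ᵐ s, ‖h s‖ ≤ M) : IsAlmostPeriodic (kernelConv k h) := by
  refine ⟨continuous_kernelConv hk hh.1.aestronglyMeasurable hM, fun e he => ?_⟩
  have hI : 0 ≤ ∫ s, ‖k s‖ := integral_nonneg fun _ => norm_nonneg _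
  obtain ⟨l, hl, hl2⟩ := hh.2 (e / (1 + ∫ s, ‖k s‖)) (by positivity)
  refine ⟨l, hl, fun T => ?_⟩
  obtain ⟨τ, hτ, hτ2⟩ := hl2 T
  refine ⟨τ, hτ, fun t =>
    (norm_kernelConv_add_sub_le hk hh.1.aestronglyMeasurable hM hτ2 t).trans ?_⟩
  rw [div_mul_eq_mul_div, div_le_iff₀ (by positivity)]
  nlinarith

end KernelConvolution

/-! ### Averages and Fourier means -/

section Averages

variable {X : Type*} [NormedAddCommGroup X] [NormedSpace ℂ X] {f : ℝ → X} {f₀ : X}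

omit [NormedSpace ℂ X] in
theorem MeasureTheory.LocallyIntegrable.intervalIntegrable_real (hf : LocallyIntegrable f)
    (a b : ℝ) : IntervalIntegrable f volume a b :=
  (hf.integrableOn_isCompact isCompact_uIcc).intervalIntegrable

/-- If `f` has the average `f₀`, then `f₀ - f` is essentially bounded (by Lebesgue's
differentiation theorem) and its integrals over intervals of length `T` are `o(T)`, uniformly in the
position of the interval. -/
theorem HasTimeAverage.exists_bound [CompleteSpace X] (hf : HasTimeAverage f f₀) :
    LocallyIntegrable (fun t => f₀ - f t) ∧ ∃ (M : ℝ) (σ : ℝ → ℝ), 0 ≤ M ∧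
      Tendsto σ atTop (𝓝 0) ∧ (∀ᵐ t, ‖f₀ - f t‖ ≤ M) ∧
      ∀ t T, 0 < T → ‖∫ s in t..(t + T), (f₀ - f s)‖ ≤ T * σ T := by
  obtain ⟨hloc, M, σ, hM, hσ, hb⟩ := hf
  have hloc' : LocallyIntegrable (fun t => f₀ - f t) := (locallyIntegrable_const f₀).sub hloc
  have hnorm : ∀ t T, 0 < T → ‖∫ s in t..(t + T), (f₀ - f s)‖ ≤ T * min M (σ T) := by
    intro t T hT
    have e : ∫ s in t..(t + T), (f₀ - f s) = -(T • (T⁻¹ • (∫ s in t..(t + T), f s) - f₀)) := by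
      rw [intervalIntegral.integral_sub intervalIntegrable_const
        (hloc.intervalIntegrable_real _ _), intervalIntegral.integral_const, smul_sub,
        smul_inv_smul₀ hT.ne']
      simp
    rw [e, norm_neg, norm_smul, Real.norm_of_nonneg hT.le]
    exact mul_le_mul_of_nonneg_left (hb t T hT) hT.le
  refine ⟨hloc', M, σ, hM.le, hσ, ?_, fun t T hT => (hnorm t T hT).trans
    (mul_le_mul_of_nonneg_left (min_le_right _ _) hT.le)⟩
  -- At a Lebesgue point, `f₀ - f t` is the limit of averages over short intervals.
  filter_upwards [_root_.LocallyIntegrable.ae_hasDerivAt_integral hloc'] with t ht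
  refine le_of_tendsto (ht 0).tendsto_slope_zero_right.norm ?_
  filter_upwards [self_mem_nhdsWithin] with T hT
  have hT0 : (0 : ℝ) < T := hT
  rw [intervalIntegral.integral_interval_sub_left (hloc'.intervalIntegrable_real _ _)
    (hloc'.intervalIntegrable_real _ _), norm_smul, Real.norm_of_nonneg (inv_pos.2 hT0).le,
    inv_mul_le_iff₀ hT0]
  exact (hnorm t T hT0).trans (mul_le_mul_of_nonneg_left (min_le_left _ _) hT0.le)

omit [NormedSpace ℂ X] in
theorem IsAlmostPeriodic.const_sub (hf : IsAlmostPeriodic f) (f₀ : X) :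
    IsAlmostPeriodic fun t => f₀ - f t := by
  refine ⟨continuous_const.sub hf.1, fun e he => ?_⟩
  obtain ⟨l, hl, h⟩ := hf.2 e he
  refine ⟨l, hl, fun T => ?_⟩
  obtain ⟨τ, hτ, hτ2⟩ := h T
  refine ⟨τ, hτ, fun t => ?_⟩
  rw [sub_sub_sub_cancel_left, norm_sub_rev]
  exact hτ2 t

omit [NormedSpace ℂ X] in
/-- An almost periodic function takes all its values, up to `e`, on one interval. -/
theorem IsAlmostPeriodic.totallyBounded_range (hf : IsAlmostPeriodic f) :
    TotallyBounded (range f) := by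
  rw [Metric.totallyBounded_iff]
  intro e he
  obtain ⟨l, hl, h⟩ := hf.2 (e / 2) (half_pos he)
  have hc : IsCompact (f '' Icc 0 l) := isCompact_Icc.image hf.1
  obtain ⟨s, hs, hs2⟩ := Metric.totallyBounded_iff.1 hc.totallyBounded (e / 2) (half_pos he)
  refine ⟨s, hs, ?_⟩
  rintro _ ⟨t, rfl⟩
  obtain ⟨τ, hτ, hτ2⟩ := h (-t)
  obtain ⟨y, hy, hy2⟩ := mem_iUnion₂.1 (hs2 ⟨t + τ, ⟨by linarith [hτ.1], by linarith [hτ.2]⟩, rfl⟩)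
  refine mem_iUnion₂.2 ⟨y, hy, ?_⟩
  rw [Metric.mem_ball, dist_eq_norm] at *
  have h1 := norm_sub_le_norm_sub_add_norm_sub (f t) (f (t + τ)) y
  rw [norm_sub_rev (f t) (f (t + τ))] at h1
  linarith [hτ2 t]

/-- The mean of `f(t) e^{i lam t}` over `[-T, T]`, which tends to a Fourier coefficient of `f` as
`T → ∞`. -/
def fourierMean (f : ℝ → X) (lam T : ℝ) : X :=
  (2 * T)⁻¹ • ∫ t in (-T)..T, Complex.exp (Complex.I * lam * t) • f t

theorem norm_exp_I_mul (lam t : ℝ) : ‖Complex.exp (Complex.I * lam * t)‖ = 1 := by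
  rw [mul_assoc, mul_comm, ← Complex.ofReal_mul]
  exact Complex.norm_exp_ofReal_mul_I _

theorem continuous_exp_I_mul (lam : ℝ) :
    Continuous fun t : ℝ => Complex.exp (Complex.I * lam * t) := by
  fun_prop

theorem hasDerivAt_exp_I_mul (lam t : ℝ) :
    HasDerivAt (fun t : ℝ => Complex.exp (Complex.I * lam * t))
      (Complex.exp (Complex.I * lam * t) * (Complex.I * lam)) t := by
  have h := ((Complex.ofRealCLM.hasDerivAt (x := t)).const_mul (Complex.I * lam)).cexp
  simpa using h

theorem tendsto_inv_two_mul : Tendsto (fun T : ℝ => (2 * T)⁻¹) atTop (𝓝 0) :=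
  tendsto_inv_atTop_zero.comp (tendsto_id.const_mul_atTop two_pos)

/-- The Fourier means of an almost periodic function lie in a compact set. -/
theorem IsAlmostPeriodic.exists_isCompact_fourierMean [CompleteSpace X] (hf : IsAlmostPeriodic f)
    (lam : ℝ) : ∃ Q : Set X, IsCompact Q ∧ ∀ T, 0 < T → fourierMean f lam T ∈ Q := by
  have hK : IsCompact (closure (range f)) :=
    hf.totallyBounded_range.closure.isCompact_of_isClosed isClosed_closure
  have hK2 : IsCompact ((fun p : ℂ × X => p.1 • p.2) ''
      (Metric.closedBall (0 : ℂ) 1 ×ˢ closure (range f))) :=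
    ((isCompact_closedBall 0 1).prod hK).image continuous_smul
  refine ⟨closure (convexHull ℝ _),
    hK2.totallyBounded.convexHull.closure.isCompact_of_isClosed isClosed_closure, fun T hT => ?_⟩
  have e : fourierMean f lam T =
      ⨍ t in Ioc (-T) T, Complex.exp (Complex.I * lam * t) • f t := by
    rw [← uIoc_of_le (by linarith), interval_average_eq, fourierMean]
    congr 2; ring
  have hc : Continuous fun t : ℝ => Complex.exp (Complex.I * lam * t) • f t :=
    (continuous_exp_I_mul lam).smul hf.1
  rw [e]
  refine (convex_convexHull ℝ _).closure.set_average_mem isClosed_closure ?_ ?_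
    (Eventually.of_forall fun t => subset_closure (subset_convexHull ℝ _ ?_))
    ((hc.integrableOn_Icc).mono_set Ioc_subset_Icc_self)
  · simp only [Real.volume_Ioc, sub_neg_eq_add]
    exact (ENNReal.ofReal_pos.2 (by linarith)).ne'
  · simp
  · refine ⟨(Complex.exp (Complex.I * lam * t), f t), ⟨?_, subset_closure ⟨t, rfl⟩⟩, rfl⟩
    simp [norm_exp_I_mul]

/-- A function with values in a compact set converges as soon as its image under an injective
operator does. -/
theorem exists_tendsto_of_injective {Q : Set X} (hQ : IsCompact Q) {P : X →L[ℂ] X}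
    (hP : Function.Injective P) {m : ℝ → X} (hm : ∀ᶠ T in atTop, m T ∈ Q) {p : X}
    (hp : Tendsto (fun T => P (m T)) atTop (𝓝 p)) : ∃ y, P y = p ∧ Tendsto m atTop (𝓝 y) := by
  have hu : ∀ x, MapClusterPt x atTop m → P x = p := by
    intro x hx
    have h1 : MapClusterPt (P x) atTop (P ∘ m) := hx.continuousAt_comp P.continuous.continuousAt
    have : (𝓝 (P x) ⊓ 𝓝 p).NeBot := h1.neBot.mono (inf_le_inf_left _ hp)
    exact eq_of_nhds_neBot this
  obtain ⟨y, -, hy⟩ := hQ.exists_mapClusterPt_of_frequently hm.frequently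
  exact ⟨y, hu y hy, hQ.tendsto_nhds_of_unique_mapClusterPt hm fun x _ hx =>
    hP ((hu x hx).trans (hu y hy).symm)⟩

end Averages

/-! ### The kernel of the semigroup and bounded solutions -/

section SemigroupKernel

variable {H : Type*} [NormedAddCommGroup H] [NormedSpace ℂ H]

/-- The kernel `A S(t) P`, `t > 0`, extended by `0`. -/
def semigroupKernel (N : ℝ → H →L[ℂ] H) (P : H →L[ℂ] H) : ℝ → H →L[ℂ] H :=
  (Ioi 0).indicator fun t => N t * P

theorem translationModulus_comp_mul {k : ℝ → H →L[ℂ] H} {ε : ℝ} (hε : 0 < ε) (r : ℝ) :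
    translationModulus (fun s => k (ε * s)) r = ε⁻¹ * translationModulus k (ε * r) := by
  have := Measure.integral_comp_mul_left (fun s => ‖k (s + ε * r) - k s‖) ε
  rw [abs_of_pos (inv_pos.2 hε), smul_eq_mul] at this
  rw [translationModulus, translationModulus, ← this]
  simp only [mul_add]

theorem integral_norm_comp_mul {k : ℝ → H →L[ℂ] H} {ε : ℝ} (hε : 0 < ε) :
    ∫ s, ‖k (ε * s)‖ = ε⁻¹ * ∫ s, ‖k s‖ := by
  have := Measure.integral_comp_mul_left (fun s => ‖k s‖) ε
  rwa [abs_of_pos (inv_pos.2 hε), smul_eq_mul] at this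

namespace IsStableAnalytic

variable {G P : H →L[ℂ] H} {S N : ℝ → H →L[ℂ] H} {κ C : ℝ} (h : IsStableAnalytic G S N κ C)
include h

theorem integrable_semigroupKernel {δ B : ℝ} (hδ : 0 < δ)
    (hB : ∀ t, 0 < t → ‖N t * P‖ ≤ B * (t ^ (δ - 1) * Real.exp (-(κ * t)))) :
    Integrable (semigroupKernel N P) := by
  suffices hi : IntegrableOn (fun t => N t * P) (Ioi 0) from
    IntegrableOn.integrable_indicator (ε' := H →L[ℂ] H) hi measurableSet_Ioi
  have hc : ContinuousOn (fun t => N t * P) (Ioi 0) := h.continuousOn_deriv.mul continuousOn_const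
  refine ((integrableOn_rpow_mul_exp hδ h.pos).const_mul B).mono'
    (hc.aestronglyMeasurable measurableSet_Ioi) ?_
  exact (ae_restrict_iff' measurableSet_Ioi).2 (Eventually.of_forall fun t ht => hB t ht)

theorem apply_semigroupKernel (t : ℝ) (x : H) :
    G (semigroupKernel N P t x) = (Ioi 0).indicator (fun t => S t (P x)) t := by
  by_cases ht : t ∈ Ioi (0 : ℝ)
  · rw [semigroupKernel, indicator_of_mem ht, indicator_of_mem ht]
    exact h.apply_deriv t ht (P x)
  · rw [semigroupKernel, indicator_of_notMem ht, indicator_of_notMem ht]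
    simp

variable [CompleteSpace H]

/-- `-S(t⁺) P` is a primitive of the kernel `A S(t) P`. -/
theorem integral_semigroupKernel (hk : Integrable (semigroupKernel N P)) {c d : ℝ} (hcd : c ≤ d)
    (x : H) : (∫ t in c..d, semigroupKernel N P t) x = S (max c 0) (P x) - S (max d 0) (P x) := by
  apply h.injective
  have hkx := hk.apply_continuousLinearMap x
  have hki : IntervalIntegrable (semigroupKernel N P) volume c d := hk.intervalIntegrable
  have e1 : (∫ t in c..d, semigroupKernel N P t) x = ∫ t in c..d, semigroupKernel N P t x :=
    ContinuousLinearMap.intervalIntegral_apply hki x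
  rw [e1, ← G.intervalIntegral_comp_comm hkx.intervalIntegrable]
  simp only [h.apply_semigroupKernel]
  have hc0 : 0 ≤ max c 0 := le_max_right c 0
  have hd0 : 0 ≤ max d 0 := le_max_right d 0
  have hcd0 : max c 0 ≤ max d 0 := max_le_max_right 0 hcd
  have e2 := h.apply_sub_apply hc0 hd0 (P x)
  rw [map_sub, h.commute _ hc0, h.commute _ hd0, ← neg_sub, e2, neg_neg,
    intervalIntegral.integral_of_le hcd, setIntegral_indicator measurableSet_Ioi, Ioc_inter_Ioi,
    intervalIntegral.integral_of_le hcd0]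
  rcases le_total d 0 with hd | hd
  · rw [max_eq_right hd, max_eq_right (hcd.trans hd), Ioc_self, Ioc_eq_empty_of_le]
    simpa using hd
  · rw [max_eq_left hd]

/-- Variation of constants: `u = k * g` with `k(t) = A S(εt) P` solves `(A⁻¹ u)' = -εu + P g`. -/
theorem apply_kernelConv_sub (hk : Integrable (semigroupKernel N P)) {g : ℝ → H} {M ε : ℝ}
    (hε : 0 < ε) (hg : LocallyIntegrable g) (hM : ∀ᵐ s, ‖g s‖ ≤ M) (a b : ℝ) :
    G (kernelConv (fun s => semigroupKernel N P (ε * s)) g b) -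
        G (kernelConv (fun s => semigroupKernel N P (ε * s)) g a) =
      ∫ τ in a..b, (-(ε • kernelConv (fun s => semigroupKernel N P (ε * s)) g τ) + P (g τ)) := by
  set k : ℝ → H →L[ℂ] H := fun s => semigroupKernel N P (ε * s) with hkdef
  have hk' : Integrable k := hk.comp_mul_left' hε.ne'
  have hgm := hg.aestronglyMeasurable
  wlog hab : a ≤ b generalizing a b
  · rw [intervalIntegral.integral_symm, ← this b a (le_of_not_ge hab)]
    abel
  have hPg : IntervalIntegrable (fun τ => P (g τ)) volume a b :=
    ⟨P.integrable_comp (hg.intervalIntegrable_real a b).1,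
      P.integrable_comp (hg.intervalIntegrable_real a b).2⟩
  have hu : IntervalIntegrable (fun τ => -(ε • kernelConv k g τ)) volume a b :=
    ((continuous_kernelConv hk' hgm hM).const_smul ε).neg.intervalIntegrable _ _
  have hi : ∀ t, Integrable fun σ => G (k (t - σ) (g σ)) := fun t =>
    G.integrable_comp (integrable_apply (hk'.comp_sub_left t) hgm hM)
  have hind : Integrable ((Ico a b).indicator fun σ => P (g σ)) := by
    rw [integrable_indicator_iff measurableSet_Ico]
    exact (integrableOn_Ico_iff_integrableOn_Ioo).2 (hPg.1.mono_set Ioo_subset_Ioc_self)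
  have hG : ∀ t, G (kernelConv k g t) = ∫ σ, G (k (t - σ) (g σ)) := fun t => by
    rw [kernelConv_eq, G.integral_comp_comm (integrable_apply (hk'.comp_sub_left t) hgm hM)]
  -- `τ ↦ -G k(τ - σ) g(σ)` is a primitive of `ε k(τ - σ) g(σ)` on either side of `τ = σ`, where it
  -- jumps from `0` to `-P g(σ)`; the indicator makes up for the jump.
  have hpt : ∀ σ, ε • (∫ τ in a..b, k (τ - σ)) (g σ) =
      G (k (a - σ) (g σ)) - G (k (b - σ) (g σ)) + (Ico a b).indicator (fun σ => P (g σ)) σ := by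
    intro σ
    have e1 : ε • (∫ τ in a..b, k (τ - σ)) =
        ∫ t in (ε * (a - σ))..(ε * (b - σ)), semigroupKernel N P t := by
      rw [intervalIntegral.integral_comp_sub_right,
        ← intervalIntegral.smul_integral_comp_mul_left]
    have hle : ε * (a - σ) ≤ ε * (b - σ) := by gcongr
    rw [← smul_apply, e1, h.integral_semigroupKernel hk hle]
    simp only [hkdef, h.apply_semigroupKernel]
    have hmem : ∀ t, (ε * (t - σ) ∈ Ioi (0 : ℝ)) ↔ σ < t := fun t => by
      rw [mem_Ioi, mul_pos_iff_of_pos_left hε, sub_pos]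
    have hmax : ∀ t, ¬ σ < t → max (ε * (t - σ)) 0 = 0 := fun t ht =>
      max_eq_right (mul_nonpos_of_nonneg_of_nonpos hε.le (by linarith))
    have hmax' : ∀ t, σ < t → max (ε * (t - σ)) 0 = ε * (t - σ) := fun t ht =>
      max_eq_left (mul_nonneg hε.le (by linarith))
    by_cases h1 : σ < a
    · have h2 : σ < b := h1.trans_le hab
      rw [indicator_of_mem ((hmem a).2 h1), indicator_of_mem ((hmem b).2 h2),
        indicator_of_notMem (fun hc => absurd hc.1 (not_le.2 h1)), hmax' a h1, hmax' b h2, add_zero]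
    · by_cases h2 : σ < b
      · rw [indicator_of_notMem (fun hc => h1 ((hmem a).1 hc)), indicator_of_mem ((hmem b).2 h2),
          indicator_of_mem (mem_Ico.2 ⟨not_lt.1 h1, h2⟩), hmax a h1, hmax' b h2, h.zero]
        simp only [one_apply_eq_self]
        abel
      · rw [indicator_of_notMem (fun hc => h1 ((hmem a).1 hc)),
          indicator_of_notMem (fun hc => h2 ((hmem b).1 hc)),
          indicator_of_notMem (fun hc => h2 hc.2), hmax a h1, hmax b h2]
        simp
  have hmain : ε • ∫ τ in a..b, kernelConv k g τ =
      G (kernelConv k g a) - G (kernelConv k g b) + ∫ τ in a..b, P (g τ) := by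
    rw [intervalIntegral_kernelConv' hk' hgm hM hab, ← integral_smul]
    simp only [hpt]
    have hab' : Integrable fun σ => G (k (a - σ) (g σ)) - G (k (b - σ) (g σ)) :=
      (hi a).sub (hi b)
    rw [integral_add hab' hind, integral_sub (hi a) (hi b), ← hG, ← hG,
      integral_indicator measurableSet_Ico, integral_Ico_eq_integral_Ioc,
      intervalIntegral.integral_of_le hab]
  rw [intervalIntegral.integral_add hu hPg, intervalIntegral.integral_neg,
    intervalIntegral.integral_smul, hmain]
  abel

end IsStableAnalytic

end SemigroupKernel

section Uniqueness

variable {H : Type*} [NormedAddCommGroup H] [InnerProductSpace ℂ H] [CompleteSpace H]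
  {G : H →L[ℂ] H} {c K : ℝ}

/-- The homogeneous equation `(A⁻¹ z)' = -εz` has no bounded solution on `ℝ` but `0`: with
`p = A⁻² z` one has `p' = -ε A p`, so `e^{2εct} ‖p(t)‖²` does not increase, while it tends to `0` as
`t → -∞`. -/
theorem IsSectorialInverse.eq_zero_of_bounded (hG : IsSectorialInverse G c K) {z : ℝ → H} {ε B : ℝ}
    (hε : 0 < ε) (hz : LocallyIntegrable z) (hB : ∀ t, ‖z t‖ ≤ B)
    (heq : ∀ s t, G (z t) - G (z s) = -(ε • ∫ τ in s..t, z τ)) (t : ℝ) : z t = 0 := by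
  have hcont : Continuous fun t => G (z t) := by
    have e : (fun t => G (z t)) = fun t => -(ε • ∫ τ in (0 : ℝ)..t, z τ) + G (z 0) := by
      ext t; rw [← heq 0 t]; abel
    rw [e]
    exact ((intervalIntegral.continuous_primitive (fun a b => hz.intervalIntegrable_real a b)
      0).const_smul ε).neg.add continuous_const
  have hd : ∀ t, HasDerivAt (fun t => G (G (z t))) (-(ε • G (z t))) t := by
    intro t
    have e : (fun t => G (G (z t))) = fun t => -(ε • ∫ τ in (0 : ℝ)..t, G (z τ)) + G (G (z 0)) := by
      ext t
      rw [G.intervalIntegral_comp_comm (hz.intervalIntegrable_real 0 t),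
        ← ContinuousLinearMap.map_smul_of_tower, ← map_neg, ← heq 0 t, map_sub]
      abel
    rw [e]
    exact (((hcont.integral_hasStrictDerivAt 0 t).hasDerivAt.const_smul ε).neg).add_const _
  have hanti := antitone_exp_mul_norm_sq (c := ε * c) (b := fun t => ε • G (z t)) hd (fun t => by
    have h1 := hG.coercive (G (z t))
    rw [← Complex.coe_smul, inner_smul_left, Complex.conj_ofReal, Complex.re_ofReal_mul, mul_assoc]
    exact mul_le_mul_of_nonneg_left h1 hε.le)
  have hlim : Tendsto (fun s => Real.exp (2 * (ε * c) * s) * (‖G‖ * (‖G‖ * B)) ^ 2) atBot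
      (𝓝 0) := by
    have h1 : Tendsto (fun s => 2 * (ε * c) * s) atBot atBot :=
      tendsto_id.const_mul_atBot (by have := hG.pos; positivity)
    simpa using (Real.tendsto_exp_atBot.comp h1).mul_const ((‖G‖ * (‖G‖ * B)) ^ 2)
  have hle : Real.exp (2 * (ε * c) * t) * ‖G (G (z t))‖ ^ 2 ≤ 0 := by
    refine ge_of_tendsto hlim ?_
    filter_upwards [eventually_le_atBot t] with s hs
    refine (hanti hs).trans (mul_le_mul_of_nonneg_left ?_ (Real.exp_pos _).le)
    gcongr
    exact G.le_opNorm_of_le (G.le_opNorm_of_le (hB s))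
  have h0 : ‖G (G (z t))‖ = 0 := by
    have := nonpos_of_mul_nonpos_right hle (Real.exp_pos _)
    nlinarith [norm_nonneg (G (G (z t)))]
  exact hG.eq_zero _ (hG.eq_zero _ (norm_eq_zero.1 h0))

/-- If `(A⁻¹ u)' = -εu + P g` and the bounded function `u` has the Fourier coefficient `c₀`, then
`P g` has the Fourier coefficient `(ε - i lam A⁻¹) c₀`, by integration by parts. -/
theorem tendsto_fourierMean_of_equation {P : H →L[ℂ] H} {u g : ℝ → H} {ε B lam : ℝ} {c₀ : H}
    (hu : Continuous u) (hg : Continuous g) (hB : ∀ t, ‖u t‖ ≤ B)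
    (heq : ∀ s t, G (u t) - G (u s) = ∫ τ in s..t, (-(ε • u τ) + P (g τ)))
    (hc : Tendsto (fourierMean u lam) atTop (𝓝 c₀)) :
    Tendsto (fun T => P (fourierMean g lam T)) atTop
      (𝓝 (ε • c₀ - (Complex.I * lam) • G c₀)) := by
  set e : ℝ → ℂ := fun t => Complex.exp (Complex.I * lam * t) with he
  have hec : Continuous e := continuous_exp_I_mul lam
  have hd : ∀ t, HasDerivAt (fun t => e t • G (u t))
      ((Complex.I * lam) • G (e t • u t) + (-(ε • (e t • u t)) + P (e t • g t))) t := by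
    intro t
    have hint : Continuous fun τ => -(ε • u τ) + P (g τ) :=
      (hu.const_smul ε).neg.add (P.continuous.comp hg)
    have e1 : (fun t => G (u t)) =
        fun t => (∫ τ in (0 : ℝ)..t, (-(ε • u τ) + P (g τ))) + G (u 0) := by
      ext t; rw [← heq 0 t]; abel
    have h1 : HasDerivAt (fun t => G (u t)) (-(ε • u t) + P (g t)) t := by
      rw [e1]
      exact ((hint.integral_hasStrictDerivAt 0 t).hasDerivAt).add_const _
    refine ((hasDerivAt_exp_I_mul lam t).smul h1).congr_deriv ?_
    simp only [map_smul, smul_add, smul_neg, smul_smul, he]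
    rw [smul_comm ε, mul_comm (Complex.I * (lam : ℂ)) (Complex.exp _)]
    abel
  have hmean : ∀ T, P (fourierMean g lam T) = (2 * T)⁻¹ • (e T • G (u T) - e (-T) • G (u (-T))) +
      (ε • fourierMean u lam T - (Complex.I * lam) • G (fourierMean u lam T)) := by
    intro T
    have c1 : Continuous fun t => e t • u t := hec.smul hu
    have c2 : Continuous fun t => e t • g t := hec.smul hg
    have i1 : IntervalIntegrable (fun t => (Complex.I * (lam : ℂ)) • G (e t • u t)) volume (-T) T :=
      ((G.continuous.comp c1).const_smul (Complex.I * (lam : ℂ))).intervalIntegrable _ _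
    have i2 : IntervalIntegrable (fun t => -(ε • (e t • u t))) volume (-T) T :=
      (c1.const_smul ε).neg.intervalIntegrable _ _
    have i3 : IntervalIntegrable (fun t => P (e t • g t)) volume (-T) T :=
      (P.continuous.comp c2).intervalIntegrable _ _
    have h1 := intervalIntegral.integral_eq_sub_of_hasDerivAt (a := -T) (b := T) (fun t _ => hd t)
      (i1.add (i2.add i3))
    have h2 : ∫ t in (-T)..T, ((Complex.I * lam) • G (e t • u t) +
        (-(ε • (e t • u t)) + P (e t • g t))) =
        (Complex.I * lam) • G (∫ t in (-T)..T, e t • u t) +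
        (-(ε • ∫ t in (-T)..T, e t • u t) + P (∫ t in (-T)..T, e t • g t)) := by
      rw [← G.intervalIntegral_comp_comm (c1.intervalIntegrable _ _),
        ← P.intervalIntegral_comp_comm (c2.intervalIntegrable _ _),
        ← intervalIntegral.integral_smul, ← intervalIntegral.integral_smul,
        ← intervalIntegral.integral_neg, ← intervalIntegral.integral_add i2 i3,
        ← intervalIntegral.integral_add i1 (i2.add i3)]
    rw [← h1, h2]
    simp only [fourierMean, ContinuousLinearMap.map_smul_of_tower, smul_add, smul_neg]
    rw [smul_comm ε, smul_comm (Complex.I * (lam : ℂ))]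
    abel
  have hbd : Tendsto (fun T : ℝ => (2 * T)⁻¹ • (e T • G (u T) - e (-T) • G (u (-T)))) atTop
      (𝓝 0) := by
    have h0 : Tendsto (fun T : ℝ => ‖(2 * T)⁻¹‖ * (‖G‖ * B + ‖G‖ * B)) atTop (𝓝 0) := by
      simpa using tendsto_inv_two_mul.norm.mul_const (‖G‖ * B + ‖G‖ * B)
    refine squeeze_zero_norm (fun T => ?_) h0
    rw [norm_smul]
    refine mul_le_mul_of_nonneg_left ((norm_sub_le _ _).trans (add_le_add ?_ ?_)) (norm_nonneg _)
    · rw [norm_smul, norm_exp_I_mul, one_mul]; exact G.le_opNorm_of_le (hB _)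
    · rw [norm_smul, norm_exp_I_mul, one_mul]; exact G.le_opNorm_of_le (hB _)
  have hlim := hbd.add ((hc.const_smul ε).sub
    (((G.continuous.tendsto _).comp hc).const_smul (Complex.I * (lam : ℂ))))
  rw [zero_add] at hlim
  exact hlim.congr fun T => (hmean T).symm

omit [CompleteSpace H] in
/-- `ε - i lam A⁻¹` is injective: pairing with `A⁻¹ x` and taking real parts leaves
`ε Re ⟪A⁻¹ x, x⟫ ≥ ε c ‖A⁻¹ x‖²`. -/
theorem IsSectorialInverse.smul_sub_ne_zero (hG : IsSectorialInverse G c K) {ε lam : ℝ}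
    (hε : 0 < ε) {x : H} (hx : x ≠ 0) : ε • x - (Complex.I * lam) • G x ≠ 0 := by
  intro h0
  have h1 : ε • x = (Complex.I * lam) • G x := sub_eq_zero.1 h0
  have h2 : (ε : ℂ) * inner ℂ (G x) x = Complex.I * lam * inner ℂ (G x) (G x) := by
    rw [← inner_smul_right, ← inner_smul_right, Complex.coe_smul, h1]
  have h3 := congrArg Complex.re h2
  have h4 : inner ℂ (G x) (G x) = ((‖G x‖ ^ 2 : ℝ) : ℂ) := by
    simp [inner_self_eq_norm_sq_to_K]
  rw [h4, Complex.re_ofReal_mul, mul_assoc, ← Complex.ofReal_mul, Complex.re_mul_ofReal,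
    Complex.I_re, zero_mul] at h3
  have h5 : (inner ℂ (G x) x).re = (inner ℂ x (G x)).re := inner_re_symm (𝕜 := ℂ) _ _
  have h6 := hG.coercive x
  rw [← h5, (mul_eq_zero.1 h3).resolve_left hε.ne'] at h6
  have h7 : ‖G x‖ ^ 2 ≤ 0 := nonpos_of_mul_nonpos_right h6 hG.pos
  refine hx (hG.eq_zero x (norm_eq_zero.1 ?_))
  nlinarith [norm_nonneg (G x)]

end Uniqueness

/-! ### Averaging for an operator with sectorial inverse -/

section Evolution

variable {H : Type*} [NormedAddCommGroup H]

/-- If `g` has vanishing averages, `ε (k(ε·) * g)` tends to `0` uniformly as `ε → 0`. The `L¹` norm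
of `ε k(ε·)` does not depend on `ε`, and its modulus of translations at `r` is that of `k` at `εr`,
so that averaging over a length proportional to `1/ε` changes the convolution little. -/
theorem tendstoUniformly_smul_kernelConv [NormedSpace ℂ H] [CompleteSpace H] {k : ℝ → H →L[ℂ] H}
    (hk : Integrable k) {g : ℝ → H} {M : ℝ} {σ : ℝ → ℝ} (hg : LocallyIntegrable g) (hM0 : 0 ≤ M)
    (hM : ∀ᵐ s, ‖g s‖ ≤ M) (hσ : Tendsto σ atTop (𝓝 0))
    (hav : ∀ t T, 0 < T → ‖∫ s in t..(t + T), g s‖ ≤ T * σ T) :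
    TendstoUniformly (fun (ε : ℝ) τ => ε • kernelConv (fun s => k (ε * s)) g τ) (fun _ => 0)
      (𝓝[>] 0) := by
  rw [Metric.tendstoUniformly_iff]
  intro e he
  have he4 : 0 < e / (4 * (M + 1)) := by positivity
  -- The factor `M + 1` keeps the bound meaningful when `M = 0`.
  obtain ⟨η, hη, hη2⟩ := Metric.eventually_nhds_iff.1
    ((tendsto_translationModulus hk).eventually (gt_mem_nhds he4))
  have hI : Tendsto (fun ε : ℝ => σ (η / 2 / ε) * ∫ s, ‖k s‖) (𝓝[>] 0) (𝓝 0) := by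
    have h1 : Tendsto (fun ε : ℝ => η / 2 / ε) (𝓝[>] 0) atTop := by
      simpa [div_eq_mul_inv] using tendsto_inv_nhdsGT_zero.const_mul_atTop (half_pos hη)
    simpa using (hσ.comp h1).mul_const (∫ s, ‖k s‖)
  filter_upwards [hI.eventually (gt_mem_nhds (half_pos he)), self_mem_nhdsWithin] with ε hε1 hε τ
  have hε0 : (0 : ℝ) < ε := hε
  have hT : 0 < η / 2 / ε := by positivity
  have h2 := norm_kernelConv_le_of_average (hk.comp_mul_left' hε0.ne') hg hM hT
    (fun t => hav t _ hT) (ρ := ε⁻¹ * (e / (4 * (M + 1)))) (fun r hr hr2 => by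
      rw [translationModulus_comp_mul hε0]
      refine mul_le_mul_of_nonneg_left (hη2 ?_).le (inv_pos.2 hε0).le
      rw [Real.dist_eq, sub_zero, abs_of_nonneg (by positivity)]
      rw [le_div_iff₀ hε0] at hr2
      linarith) hM0 τ
  rw [integral_norm_comp_mul hε0] at h2
  rw [dist_zero_left, norm_smul, Real.norm_of_nonneg hε0.le]
  have h3 := mul_le_mul_of_nonneg_left h2 hε0.le
  have h4 : ε * (σ (η / 2 / ε) * (ε⁻¹ * ∫ s, ‖k s‖) + M * (ε⁻¹ * (e / (4 * (M + 1))))) =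
      σ (η / 2 / ε) * (∫ s, ‖k s‖) + M / (M + 1) * (e / 4) := by
    field_simp
  have h5 : M / (M + 1) ≤ 1 := div_le_one_of_le₀ (by linarith) (by linarith)
  have h6 : M / (M + 1) * (e / 4) ≤ e / 4 := mul_le_of_le_one_left (by positivity) h5
  linarith

/-- The Fourier means of a constant at a non-zero frequency tend to zero. -/
theorem tendsto_fourierMean_const [NormedSpace ℂ H] [CompleteSpace H] (x : H) {lam : ℝ}
    (hlam : lam ≠ 0) :
    Tendsto (fourierMean (fun _ => x) lam) atTop (𝓝 0) := by
  have hl : Complex.I * lam ≠ 0 := mul_ne_zero Complex.I_ne_zero (Complex.ofReal_ne_zero.2 hlam)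
  have h1 : ∀ T : ℝ, ∫ t in (-T)..T, Complex.exp (Complex.I * lam * t) =
      (Complex.exp (Complex.I * lam * T) - Complex.exp (Complex.I * lam * (-T : ℝ))) *
        (Complex.I * lam)⁻¹ := by
    intro T
    rw [eq_mul_inv_iff_mul_eq₀ hl, ← intervalIntegral.integral_mul_const]
    exact intervalIntegral.integral_eq_sub_of_hasDerivAt (fun t _ => hasDerivAt_exp_I_mul lam t)
      (((continuous_exp_I_mul lam).mul continuous_const).intervalIntegrable _ _)
  have h2 : ∀ T : ℝ, ‖∫ t in (-T)..T, Complex.exp (Complex.I * lam * t) • x‖ ≤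
      2 * ‖(Complex.I * lam : ℂ)⁻¹‖ * ‖x‖ := by
    intro T
    have h3 := norm_sub_le (Complex.exp (Complex.I * lam * T))
      (Complex.exp (Complex.I * lam * (-T : ℝ)))
    rw [norm_exp_I_mul, norm_exp_I_mul, one_add_one_eq_two] at h3
    rw [intervalIntegral.integral_smul_const, h1, norm_smul, norm_mul]
    gcongr
  refine squeeze_zero_norm' (a := fun T : ℝ => (2 * T)⁻¹ * (2 * ‖(Complex.I * lam : ℂ)⁻¹‖ * ‖x‖))
    ?_ (by simpa using tendsto_inv_two_mul.mul_const (2 * ‖(Complex.I * lam : ℂ)⁻¹‖ * ‖x‖))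
  filter_upwards [eventually_gt_atTop 0] with T hT
  rw [fourierMean, norm_smul, Real.norm_of_nonneg (by positivity)]
  exact mul_le_mul_of_nonneg_left (h2 T) (by positivity)

/-- Subtracting `f` from its average creates no Fourier exponent: the constant contributes only at
frequency `0`, where `f₀ - f` has vanishing mean. -/
theorem mem_fourierExponents_of_tendsto_const_sub [NormedSpace ℂ H] [CompleteSpace H]
    {f : ℝ → H} {f₀ y : H}
    {σ : ℝ → ℝ} {lam : ℝ} (hf : Continuous f) (hσ : Tendsto σ atTop (𝓝 0))
    (hav : ∀ t T, 0 < T → ‖∫ s in t..(t + T), (f₀ - f s)‖ ≤ T * σ T) (hy : y ≠ 0)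
    (hlim : Tendsto (fourierMean (fun t => f₀ - f t) lam) atTop (𝓝 y)) :
    lam ∈ fourierExponents f := by
  rcases eq_or_ne lam 0 with rfl | hlam
  · refine absurd (tendsto_nhds_unique hlim ?_) hy
    refine squeeze_zero_norm' (a := fun T : ℝ => σ (2 * T)) ?_
      (hσ.comp (tendsto_id.const_mul_atTop two_pos))
    filter_upwards [eventually_gt_atTop 0] with T hT
    have h1 := hav (-T) (2 * T) (by positivity)
    rw [show -T + 2 * T = T by ring] at h1
    simp only [fourierMean, Complex.ofReal_zero, mul_zero, zero_mul, Complex.exp_zero, one_smul]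
    rw [norm_smul, Real.norm_of_nonneg (by positivity), inv_mul_le_iff₀ (by positivity)]
    exact h1
  · refine ⟨-y, neg_ne_zero.2 hy, ?_⟩
    have h1 := (tendsto_fourierMean_const f₀ hlam).sub hlim
    rw [zero_sub] at h1
    refine h1.congr fun T => ?_
    have hc := continuous_exp_I_mul lam
    have i1 : IntervalIntegrable (fun t : ℝ => Complex.exp (Complex.I * lam * t) • f₀) volume
        (-T) T := (hc.smul continuous_const).intervalIntegrable _ _
    have i2 : IntervalIntegrable (fun t : ℝ => Complex.exp (Complex.I * lam * t) • (f₀ - f t))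
        volume (-T) T := (hc.smul (continuous_const.sub hf)).intervalIntegrable _ _
    rw [fourierMean, fourierMean, ← smul_sub, ← intervalIntegral.integral_sub i1 i2]
    simp only [← smul_sub, sub_sub_cancel]

variable [InnerProductSpace ℂ H] [CompleteSpace H] {A : H →ₗ.[ℂ] H} {G : H →L[ℂ] H}
  {N : ℝ → H →L[ℂ] H} {κ C : ℝ}

omit [CompleteSpace H] in
theorem IsStableAnalytic.negPow_one (h : IsStableAnalytic G (expNeg A) N κ C) (x : H) :
    negPow A 1 x = G x := by
  rw [negPow, if_neg one_ne_zero, Real.Gamma_one, inv_one, one_smul,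
    ← h.gammaIntegral_apply one_pos, h.gammaIntegral_one]

omit [CompleteSpace H] in
theorem IsStableAnalytic.negPow_apply (h : IsStableAnalytic G (expNeg A) N κ C) {s : ℝ}
    (hs : 0 < s) (x : H) :
    negPow A s x = ((Real.Gamma s)⁻¹ • gammaIntegral (expNeg A) s) x := by
  rw [negPow, if_neg hs.ne', ← h.gammaIntegral_apply hs]
  rfl

omit [CompleteSpace H] in
/-- In terms of `u = A^α v`, the equation in `H` is `(A⁻¹ u)' = -εu + A^{-(γ-α+1)} A^γ (f₀ - f)`. -/
theorem isSolution_iff (h : IsStableAnalytic G (expNeg A) N κ C) {α γ ε : ℝ} (hαγ : α - γ < 1)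
    (f₀ : FracDom A γ) (f : ℝ → FracDom A γ) (v : ℝ → FracDom A α) :
    IsSolution A ε f₀ f v ↔ LocallyIntegrable (fun t => (v t).pow) ∧
      ∀ s t, G (v t).pow - G (v s).pow = ∫ τ in s..t, (-(ε • (v τ).pow) +
        ((Real.Gamma (γ - α + 1))⁻¹ • gammaIntegral (expNeg A) (γ - α + 1))
          (f₀.pow - (f τ).pow)) := by
  have e1 : ∀ x : FracDom A α, x.incl (α - 1) = FracDom.pow.symm (G x.pow) := by
    intro x
    rw [FracDom.incl, sub_sub_cancel, h.negPow_one]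
  have e2 : ∀ x : FracDom A γ, x.incl (α - 1) = FracDom.pow.symm
      (((Real.Gamma (γ - α + 1))⁻¹ • gammaIntegral (expNeg A) (γ - α + 1)) x.pow) := by
    intro x
    rw [FracDom.incl, show γ - (α - 1) = γ - α + 1 by ring, h.negPow_apply (by linarith)]
  constructor
  · rintro ⟨h1, h2⟩
    simp only [e1, e2] at h2
    exact ⟨h1, h2⟩
  · rintro ⟨h1, h2⟩
    refine ⟨h1, ?_⟩
    simp only [e1, e2]
    exact h2

/-- The averaging theorem for an arbitrary operator with sectorial inverse. -/
theorem IsSectorialInverse.averaging {c K : ℝ} (hG : IsSectorialInverse G c K)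
    (hA : ∀ x y, (x, y) ∈ A.graph ↔ x = G y) {α γ : ℝ} (hαγ : α - γ < 1)
    (f : ℝ → FracDom A γ) (f₀ : FracDom A γ) (hf : HasTimeAverage f f₀) :
    ∃ v : ℝ → ℝ → FracDom A α,
      (∀ ε : ℝ, 0 < ε →
        Continuous (v ε) ∧ (∃ C : ℝ, ∀ τ, ‖v ε τ‖ ≤ C) ∧
        IsSolution A ε f₀ f (v ε) ∧
        ∀ w : ℝ → FracDom A α, (∃ C : ℝ, ∀ τ, ‖w τ‖ ≤ C) →
          IsSolution A ε f₀ f w → w = v ε) ∧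
      TendstoUniformly (fun ε τ => ε • v ε τ) (fun _ => 0) (𝓝[>] (0 : ℝ)) ∧
      (IsAlmostPeriodic f → ∀ ε : ℝ, 0 < ε →
        IsAlmostPeriodic (v ε) ∧ fourierExponents (v ε) ⊆ fourierExponents f) := by
  obtain ⟨N, κ, C, h⟩ := hG.exists_isStableAnalytic_expNeg hA
  have hθ : 0 < γ - α + 1 := by linarith
  set P : H →L[ℂ] H := (Real.Gamma (γ - α + 1))⁻¹ • gammaIntegral (expNeg A) (γ - α + 1) with hP
  have hΓ : (Real.Gamma (γ - α + 1))⁻¹ ≠ 0 := (inv_pos.2 (Real.Gamma_pos_of_pos hθ)).ne'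
  have hPinj : Function.Injective P := by
    refine (injective_iff_map_eq_zero P).2 fun x hx => h.eq_zero_of_gammaIntegral hθ ?_
    have hx' : (Real.Gamma (γ - α + 1))⁻¹ • gammaIntegral (expNeg A) (γ - α + 1) x = 0 := hx
    exact (smul_eq_zero.1 hx').resolve_left hΓ
  have hk : Integrable (semigroupKernel N P) := by
    obtain ⟨δ, B, hδ, hB⟩ := h.norm_deriv_mul_gammaIntegral_le hθ
    refine h.integrable_semigroupKernel (B := |(Real.Gamma (γ - α + 1))⁻¹| * B) hδ fun t ht => ?_
    rw [hP, mul_smul_comm, norm_smul, mul_assoc]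
    exact mul_le_mul_of_nonneg_left (hB t ht) (norm_nonneg _)
  set g : ℝ → H := fun t => f₀.pow - (f t).pow with hgdef
  obtain ⟨hg, M, σ, hM0, hσ, hM, hav⟩ := HasTimeAverage.exists_bound
    (show HasTimeAverage (fun t => (f t).pow) f₀.pow from hf)
  have hgm := hg.aestronglyMeasurable
  set u : ℝ → ℝ → H := fun ε => kernelConv (fun s => semigroupKernel N P (ε * s)) g with hu
  have hkε : ∀ {ε : ℝ}, 0 < ε → Integrable fun s => semigroupKernel N P (ε * s) :=
    fun hε => hk.comp_mul_left' hε.ne'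
  have hcont : ∀ {ε : ℝ}, 0 < ε → Continuous (u ε) := fun hε =>
    continuous_kernelConv (hkε hε) hgm hM
  have hbdd : ∀ {ε : ℝ}, 0 < ε → ∃ B, ∀ t, ‖u ε t‖ ≤ B := fun hε =>
    ⟨_, norm_kernelConv_le (hkε hε) hM⟩
  have heq : ∀ {ε : ℝ}, 0 < ε → ∀ s t, G (u ε t) - G (u ε s) =
      ∫ τ in s..t, (-(ε • u ε τ) + P (g τ)) := fun hε s t =>
    h.apply_kernelConv_sub hk hε hg hM s t
  refine ⟨fun ε τ => FracDom.pow.symm (u ε τ), fun ε hε => ⟨hcont hε, hbdd hε, ?_, ?_⟩, ?_, ?_⟩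
  · exact (isSolution_iff h hαγ f₀ f _).2 ⟨(hcont hε).locallyIntegrable, heq hε⟩
  · rintro w ⟨B, hB⟩ hw
    obtain ⟨hw1, hw2⟩ := (isSolution_iff h hαγ f₀ f w).1 hw
    obtain ⟨B', hB'⟩ := hbdd hε
    ext t
    refine sub_eq_zero.1 (hG.eq_zero_of_bounded (z := fun t => (w t).pow - u ε t) hε
      (hw1.sub (hcont hε).locallyIntegrable) (B := B + B')
      (fun t => (norm_sub_le _ _).trans (add_le_add (hB t) (hB' t))) (fun s t => ?_) t)
    have hPg : IntervalIntegrable (fun τ => P (g τ)) volume s t :=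
      ⟨P.integrable_comp (hg.intervalIntegrable_real s t).1,
        P.integrable_comp (hg.intervalIntegrable_real s t).2⟩
    have hwi := hw1.intervalIntegrable_real s t
    have hui := (hcont hε).intervalIntegrable (μ := volume) s t
    have e1 := hw2 s t
    have e2 := heq hε s t
    have i1 : IntervalIntegrable (fun τ => -(ε • (w τ).pow)) volume s t := (hwi.smul ε).neg
    have i2 : IntervalIntegrable (fun τ => -(ε • u ε τ)) volume s t := (hui.smul ε).neg
    rw [intervalIntegral.integral_add i1 hPg, intervalIntegral.integral_neg,
      intervalIntegral.integral_smul] at e1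
    rw [intervalIntegral.integral_add i2 hPg, intervalIntegral.integral_neg,
      intervalIntegral.integral_smul] at e2
    rw [intervalIntegral.integral_sub hwi hui, smul_sub, map_sub, map_sub,
      sub_sub_sub_comm, e1, e2]
    abel
  · exact tendstoUniformly_smul_kernelConv hk hg hM0 hM hσ hav
  · intro hfap ε hε
    have hgap : IsAlmostPeriodic g :=
      (show IsAlmostPeriodic fun t => (f t).pow from hfap).const_sub f₀.pow
    refine ⟨hgap.kernelConv (hkε hε) hM, ?_⟩
    rintro lam ⟨c₀, hc₀, hc⟩
    obtain ⟨B, hB⟩ := hbdd hε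
    obtain ⟨Q, hQ, hmQ⟩ := hgap.exists_isCompact_fourierMean lam
    obtain ⟨y, hy, hlim⟩ := exists_tendsto_of_injective hQ hPinj
      ((eventually_gt_atTop 0).mono hmQ)
      (tendsto_fourierMean_of_equation (hcont hε) hgap.1 hB (heq hε) hc)
    have hy0 : y ≠ 0 := by
      rintro rfl
      rw [map_zero] at hy
      exact hG.smul_sub_ne_zero hε hc₀ hy.symm
    have hfc : Continuous fun t => (f t).pow := hfap.1
    exact mem_fourierExponents_of_tendsto_const_sub hfc hσ hav hy0 hlim

end Evolution

/-! ### Forms on an embedded Hilbert space -/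

section Form

variable {V H : Type*} [NormedAddCommGroup V] [InnerProductSpace ℂ V] [CompleteSpace V]
  [NormedAddCommGroup H] [InnerProductSpace ℂ H] [CompleteSpace H]

/-- The coercivity constant of the form, by `(ν + κr)² ≥ 4νκr`. -/
theorem pos_of_mul_sq_lt {ν r β κ : ℝ} (hν : 0 < ν) (hr : 0 < r) (hκ : 0 ≤ κ)
    (hcond : β ^ 2 * κ ^ 2 < 4 * ν * r) : 0 < ν + κ * (r - β * √κ) := by
  rcases hκ.eq_or_lt with rfl | hκ'
  · simpa using hν
  have h1 : (β * κ * √κ) ^ 2 < (ν + κ * r) ^ 2 := by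
    rw [mul_pow, Real.sq_sqrt hκ]
    have := mul_lt_mul_of_pos_right hcond hκ'
    nlinarith [sq_nonneg (ν - κ * r)]
  have h2 := lt_of_pow_lt_pow_left₀ 2 (by positivity) h1
  linarith

/-- If `E` embeds the form domain `V` in `H`, then `-E E†` is the inverse of a Laplacian, and the
operator `x = ν w + r u - β Q u`, `u = E E† w`, is the inverse of a bounded sectorial `G`. This is
the Lax–Milgram theorem for the form `ν ⟪g, h⟫ + ⟪(r - β Q) E g, E h⟫` on `V`. -/
theorem exists_isSectorialInverse_of_form (E : V →L[ℂ] H) (Q : H →L[ℂ] H) {ν r β κ : ℝ}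
    (hν : 0 < ν) (hr : 0 < r) (hβ : 0 ≤ β) (hκ : 0 ≤ κ) (hcond : β ^ 2 * κ ^ 2 < 4 * ν * r)
    (hE : ∀ g, ‖E g‖ ^ 2 ≤ κ * ‖g‖ ^ 2) (hQ : ∀ u, ‖Q u‖ ^ 2 ≤ κ * ‖u‖ ^ 2)
    (hE' : ∀ x, ContinuousLinearMap.adjoint E x = 0 → x = 0) :
    ∃ (G : H →L[ℂ] H) (c K : ℝ), IsSectorialInverse G c K ∧ ∀ u x,
      (∃ w, u = E (ContinuousLinearMap.adjoint E w) ∧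
        x = (ν : ℂ) • w + (r : ℂ) • u - (β : ℂ) • Q u) ↔ u = G x := by
  set E' := ContinuousLinearMap.adjoint E with hE'def
  set M : V →L[ℂ] V := (ν : ℂ) • 1 + E' ∘L ((r : ℂ) • 1 - (β : ℂ) • Q) ∘L E with hM
  have hMapp : ∀ g, M g = (ν : ℂ) • g + E' ((r : ℂ) • E g - (β : ℂ) • Q (E g)) := fun g => rfl
  have hQ' : ∀ u, ‖Q u‖ ≤ √κ * ‖u‖ := by
    intro u
    have := Real.sqrt_le_sqrt (hQ u)
    rwa [Real.sqrt_sq (norm_nonneg _), Real.sqrt_mul hκ, Real.sqrt_sq (norm_nonneg _)] at this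
  set c₀ : ℝ := min ν (ν + κ * (r - β * √κ)) with hc₀
  have hc₀pos : 0 < c₀ := lt_min hν (pos_of_mul_sq_lt hν hr hκ hcond)
  have hcoer : ∀ g, c₀ * ‖g‖ ^ 2 ≤ (inner ℂ (M g) g).re := by
    intro g
    have h1 : (inner ℂ (M g) g).re =
        ν * ‖g‖ ^ 2 + (r * ‖E g‖ ^ 2 - β * (inner ℂ (Q (E g)) (E g)).re) := by
      rw [hMapp, inner_add_left, hE'def, ContinuousLinearMap.adjoint_inner_left, inner_sub_left,
        inner_smul_left, inner_smul_left, inner_smul_left, inner_self_eq_norm_sq_to_K,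
        inner_self_eq_norm_sq_to_K]
      simp only [Complex.conj_ofReal, Complex.add_re, Complex.sub_re, Complex.re_ofReal_mul,
        Complex.coe_algebraMap, ← Complex.ofReal_pow, Complex.ofReal_re]
    have h2 : (inner ℂ (Q (E g)) (E g)).re ≤ √κ * ‖E g‖ ^ 2 := by
      refine ((Complex.re_le_norm _).trans (norm_inner_le_norm _ _)).trans ?_
      rw [pow_two, ← mul_assoc]
      exact mul_le_mul_of_nonneg_right (hQ' _) (norm_nonneg _)
    have h3 := mul_le_mul_of_nonneg_left h2 hβ
    rw [h1]
    rcases le_total 0 (r - β * √κ) with h | h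
    · have h4 : c₀ * ‖g‖ ^ 2 ≤ ν * ‖g‖ ^ 2 :=
        mul_le_mul_of_nonneg_right (min_le_left _ _) (sq_nonneg _)
      have h5 := mul_nonneg h (sq_nonneg ‖E g‖)
      linarith
    · have h4 : c₀ * ‖g‖ ^ 2 ≤ (ν + κ * (r - β * √κ)) * ‖g‖ ^ 2 :=
        mul_le_mul_of_nonneg_right (min_le_right _ _) (sq_nonneg _)
      have h5 := mul_le_mul_of_nonpos_left (hE g) h
      linarith
  have hMunit : IsUnit M := by
    refine ContinuousLinearMap.isUnit_of_forall_le_norm_inner_map M (c := ⟨c₀, hc₀pos.le⟩) hc₀pos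
      fun g => ?_
    rw [mul_comm]
    exact (hcoer g).trans (Complex.re_le_norm _)
  obtain ⟨M', hM'⟩ := hMunit
  set R : V →L[ℂ] V := ((M'⁻¹ : (V →L[ℂ] V)ˣ) : V →L[ℂ] V) with hR
  have hMR : ∀ g, M (R g) = g := by
    intro g
    have : M * R = 1 := by rw [← hM', hR, Units.mul_inv]
    exact DFunLike.congr_fun this g
  have hRM : ∀ g, R (M g) = g := by
    intro g
    have : R * M = 1 := by rw [← hM', hR, Units.inv_mul]
    exact DFunLike.congr_fun this g
  have hνC : (ν : ℂ) ≠ 0 := Complex.ofReal_ne_zero.2 hν.ne'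
  -- Injectivity of `E` on the range of `M⁻¹ E†` alone: there `E w = 0` leaves `E† x = ν w`, and
  -- `E† x` is orthogonal to the kernel of `E`.
  have hEE : ∀ w, E w = 0 → ∀ x, w = R (E' x) → w = 0 := by
    intro w hw x hx
    have h1 : E' x = (ν : ℂ) • w := by
      rw [← hMR (E' x), ← hx, hMapp, hw]
      simp
    have h2 : (inner ℂ (E' x) w : ℂ) = 0 := by
      rw [hE'def, ContinuousLinearMap.adjoint_inner_left, hw, inner_zero_right]
    rw [h1, inner_smul_left] at h2
    exact inner_self_eq_zero.1 ((mul_eq_zero.1 h2).resolve_left (by simpa using hν.ne'))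
  have hinner : ∀ x, (inner ℂ x (E (R (E' x))) : ℂ) = inner ℂ (M (R (E' x))) (R (E' x)) := by
    intro x
    rw [hMR, hE'def, ContinuousLinearMap.adjoint_inner_left]
  refine ⟨E ∘L R ∘L E', c₀ / (κ + 1), ‖M‖ / c₀, ⟨by positivity, by positivity, ?_, ?_, ?_⟩, ?_⟩
  · intro x hx
    have h1 : R (E' x) = 0 := hEE _ hx x rfl
    refine hE' x ?_
    rw [← hMR (E' x), h1, map_zero]
  · intro x
    change _ * ‖E (R (E' x))‖ ^ 2 ≤ (inner ℂ x (E (R (E' x)))).re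
    rw [hinner]
    refine le_trans ?_ (hcoer _)
    rw [div_mul_eq_mul_div, div_le_iff₀ (by positivity), mul_assoc]
    refine mul_le_mul_of_nonneg_left ?_ hc₀pos.le
    have := hE (R (E' x))
    nlinarith [sq_nonneg ‖R (E' x)‖]
  · intro x
    change |(inner ℂ x (E (R (E' x)))).im| ≤ _ * (inner ℂ x (E (R (E' x)))).re
    rw [hinner, div_mul_eq_mul_div, le_div_iff₀ hc₀pos]
    set g := R (E' x)
    have h1 : |(inner ℂ (M g) g).im| ≤ ‖M‖ * ‖g‖ ^ 2 := by
      refine (Complex.abs_im_le_norm _).trans ((norm_inner_le_norm _ _).trans ?_)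
      rw [pow_two, ← mul_assoc]
      exact mul_le_mul_of_nonneg_right (M.le_opNorm g) (norm_nonneg _)
    calc |(inner ℂ (M g) g).im| * c₀ ≤ ‖M‖ * ‖g‖ ^ 2 * c₀ :=
          mul_le_mul_of_nonneg_right h1 hc₀pos.le
      _ = ‖M‖ * (c₀ * ‖g‖ ^ 2) := by ring
      _ ≤ _ := mul_le_mul_of_nonneg_left (hcoer g) (norm_nonneg _)
  · intro u x
    change _ ↔ u = E (R (E' x))
    constructor
    · rintro ⟨w, hu, hx⟩
      have h1 : E' x = M (E' w) := by
        rw [hMapp, ← hu, hx, add_sub_assoc, map_add, map_smul]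
      rw [h1, hRM, ← hu]
    · intro hu
      have h1 := hMR (E' x)
      rw [hMapp, ← hu] at h1
      refine ⟨(ν : ℂ)⁻¹ • (x - ((r : ℂ) • u - (β : ℂ) • Q u)), ?_, ?_⟩
      · rw [map_smul, map_sub, ← h1, add_sub_cancel_right, smul_smul, inv_mul_cancel₀ hνC,
          one_smul, ← hu]
      · rw [smul_smul, mul_inv_cancel₀ hνC, one_smul]
        abel

end Form

/-! ### The Poincaré inequality in the plane -/

section Poincare

/-- The factor `2` comes from integrating the derivative over both half-lines. -/
theorem HasCompactSupport.two_mul_enorm_le_lintegral_deriv {F : Type*} [NormedAddCommGroup F]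
    [NormedSpace ℝ F] {f : ℝ → F} (hf : ContDiff ℝ 1 f) (hfc : HasCompactSupport f) (x : ℝ) :
    2 * ‖f x‖ₑ ≤ ∫⁻ y, ‖deriv f y‖ₑ := by
  have h1 := hfc.enorm_le_lintegral_Ici_deriv hf x
  have h2 : ‖f x‖ₑ ≤ ∫⁻ y in Ici x, ‖deriv f y‖ₑ := by
    have h3 := (hfc.comp_homeomorph (Homeomorph.neg ℝ)).enorm_le_lintegral_Ici_deriv
      (f := fun y => f (-y)) (hf.comp contDiff_neg) (-x)
    simp only [neg_neg, deriv_comp_neg, enorm_neg] at h3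
    refine h3.trans_eq ?_
    have h4 := (Measure.measurePreserving_neg (volume : Measure ℝ)).setLIntegral_comp_preimage_emb
      (Homeomorph.neg ℝ).measurableEmbedding (fun y => ‖deriv f y‖ₑ) (Ici x)
    rw [← h4]
    congr 2
    ext y
    simp
  rw [two_mul, ← lintegral_add_compl _ (measurableSet_Iic (a := x)), compl_Iic,
    setLIntegral_congr Ioi_ae_eq_Ici]
  exact add_le_add h1 h2

/-- The length of the gradient. -/
def gradNorm (φ : EuclideanSpace ℝ (Fin 2) → ℂ) (z : EuclideanSpace ℝ (Fin 2)) : ℝ :=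
  √(∑ i, ‖partialD i φ z‖ ^ 2)

theorem norm_partialD_le_gradNorm (φ : EuclideanSpace ℝ (Fin 2) → ℂ)
    (z : EuclideanSpace ℝ (Fin 2)) (i : Fin 2) : ‖partialD i φ z‖ ≤ gradNorm φ z :=
  Real.le_sqrt_of_sq_le (Finset.single_le_sum (f := fun i => ‖partialD i φ z‖ ^ 2)
    (fun _ _ => sq_nonneg _) (Finset.mem_univ i))

theorem continuous_partialD {φ : EuclideanSpace ℝ (Fin 2) → ℂ} (hφ : ContDiff ℝ 1 φ) (i : Fin 2) :
    Continuous (partialD i φ) :=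
  (hφ.continuous_fderiv one_ne_zero).clm_apply continuous_const

theorem continuous_gradNorm {φ : EuclideanSpace ℝ (Fin 2) → ℂ} (hφ : ContDiff ℝ 1 φ) :
    Continuous (gradNorm φ) :=
  (continuous_finsetSum _ fun i _ => (continuous_partialD hφ i).norm.pow 2).sqrt

/-- The Gagliardo–Nirenberg–Sobolev inequality in the plane, with the constant `1 / 4`. -/
theorem four_mul_lintegral_sq_le {φ : EuclideanSpace ℝ (Fin 2) → ℂ} (hφ : ContDiff ℝ 1 φ)
    (hφc : HasCompactSupport φ) :
    4 * ∫⁻ z, ‖φ z‖ₑ ^ 2 ≤ (∫⁻ z, ‖gradNorm φ z‖ₑ) ^ 2 := by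
  have hmp := PiLp.volume_preserving_toLp (Fin 2)
  have hme : MeasurableEmbedding (WithLp.toLp 2 : (Fin 2 → ℝ) → EuclideanSpace ℝ (Fin 2)) :=
    (MeasurableEquiv.toLp 2 (Fin 2 → ℝ)).measurableEmbedding
  rw [← hmp.lintegral_comp_emb hme, ← hmp.lintegral_comp_emb hme,
    ← lintegral_const_mul' _ _ (by simp)]
  have hp : Real.HolderConjugate (Fintype.card (Fin 2)) 2 := by
    rw [Fintype.card_fin]
    exact Real.HolderConjugate.two_two
  have h1 := lintegral_prod_lintegral_pow_le (fun _ : Fin 2 => (volume : Measure ℝ)) hp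
    (f := fun x => ‖gradNorm φ (WithLp.toLp 2 x)‖ₑ)
    ((continuous_gradNorm hφ).measurable.comp hme.measurable).enorm
  rw [← volume_pi, ENNReal.rpow_two] at h1
  refine le_trans (lintegral_mono fun x => ?_) h1
  have h2 : ∀ i : Fin 2, 2 * ‖φ (WithLp.toLp 2 x)‖ₑ ≤
      ∫⁻ t, ‖gradNorm φ (WithLp.toLp 2 (Function.update x i t))‖ₑ := by
    intro i
    have hder : ∀ t : ℝ, HasDerivAt (fun t : ℝ => (WithLp.toLp 2 (Function.update x i t) :
        EuclideanSpace ℝ (Fin 2))) (EuclideanSpace.single i 1) t := fun t =>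
      (PiLp.continuousLinearEquiv 2 ℝ (fun _ : Fin 2 => ℝ)).symm.toContinuousLinearMap.hasFDerivAt
        |>.comp_hasDerivAt t (hasDerivAt_update x i t)
    have hcd : ContDiff ℝ 1 fun t : ℝ => (WithLp.toLp 2 (Function.update x i t) :
        EuclideanSpace ℝ (Fin 2)) :=
      (PiLp.continuousLinearEquiv 2 ℝ (fun _ : Fin 2 => ℝ)).symm.contDiff.comp
        (contDiff_update 1 x i)
    have hemb : IsClosedEmbedding fun t : ℝ => (WithLp.toLp 2 (Function.update x i t) :
        EuclideanSpace ℝ (Fin 2)) :=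
      (PiLp.continuousLinearEquiv 2 ℝ (fun _ : Fin 2 => ℝ)).symm.toHomeomorph.isClosedEmbedding.comp
        (isClosedEmbedding_update x i)
    have h3 := (hφc.comp_isClosedEmbedding hemb).two_mul_enorm_le_lintegral_deriv
      (hφ.comp hcd) (x i)
    simp only [Function.comp_def, Function.update_eq_self] at h3
    refine h3.trans (lintegral_mono fun t => ?_)
    rw [enorm_le_iff_norm_le]
    have h4 : HasDerivAt (fun t => φ (WithLp.toLp 2 (Function.update x i t)))
        (partialD i φ (WithLp.toLp 2 (Function.update x i t))) t :=
      (hφ.differentiable one_ne_zero _).hasFDerivAt.comp_hasDerivAt t (hder t)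
    rw [h4.deriv]
    exact (norm_partialD_le_gradNorm _ _ _).trans (le_abs_self _)
  have h5 : ((1 : ℝ) / ((Fintype.card (Fin 2) : ℝ) - 1)) = 1 := by
    rw [Fintype.card_fin]; norm_num
  simp only [h5, ENNReal.rpow_one, Fin.prod_univ_two]
  calc 4 * ‖φ (WithLp.toLp 2 x)‖ₑ ^ 2
      = 2 * ‖φ (WithLp.toLp 2 x)‖ₑ * (2 * ‖φ (WithLp.toLp 2 x)‖ₑ) := by ring
    _ ≤ _ := mul_le_mul' (h2 0) (h2 1)

/-- The Poincaré inequality, with a constant slightly better than `|D| / π`. -/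
theorem four_mul_lintegral_sq_le_volume {D : Set (EuclideanSpace ℝ (Fin 2))}
    {φ : EuclideanSpace ℝ (Fin 2) → ℂ} (hφ : ContDiff ℝ 1 φ) (hφc : HasCompactSupport φ)
    (hD : tsupport φ ⊆ D) :
    4 * ∫⁻ z in D, ‖φ z‖ₑ ^ 2 ≤ volume D * ∫⁻ z in D, ∑ i, ‖partialD i φ z‖ₑ ^ 2 := by
  have h0 : ∀ z ∉ D, gradNorm φ z = 0 := by
    intro z hz
    have : fderiv ℝ φ z = 0 := by
      by_contra h
      exact hz (hD (support_fderiv_subset ℝ h))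
    simp [gradNorm, partialD, this]
  have h1 : ∫⁻ z, ‖gradNorm φ z‖ₑ = ∫⁻ z in D, ‖gradNorm φ z‖ₑ := by
    refine (setLIntegral_eq_of_support_subset fun z hz => ?_).symm
    by_contra h
    exact hz (by simp [h0 z h])
  have h2 : (∫⁻ z in D, ‖gradNorm φ z‖ₑ) ^ 2 ≤ volume D * ∫⁻ z in D, ‖gradNorm φ z‖ₑ ^ 2 := by
    have h3 := ENNReal.lintegral_mul_le_Lp_mul_Lq (volume.restrict D) Real.HolderConjugate.two_two
      (f := fun _ => 1) (g := fun z => ‖gradNorm φ z‖ₑ) aemeasurable_const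
      (continuous_gradNorm hφ).enorm.measurable.aemeasurable
    simp only [Pi.mul_apply, one_mul, ENNReal.rpow_two, one_pow, lintegral_one,
      Measure.restrict_apply_univ] at h3
    calc _ ≤ _ := pow_le_pow_left' h3 2
      _ = _ := by
        rw [mul_pow, ← ENNReal.rpow_mul_natCast, ← ENNReal.rpow_mul_natCast]
        norm_num
  have h4 : ∀ z, ‖gradNorm φ z‖ₑ ^ 2 = ∑ i, ‖partialD i φ z‖ₑ ^ 2 := by
    intro z
    have hs : 0 ≤ ∑ i, ‖partialD i φ z‖ ^ 2 := Finset.sum_nonneg fun _ _ => sq_nonneg _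
    rw [gradNorm, ← ofReal_norm, Real.norm_of_nonneg (Real.sqrt_nonneg _), ← ENNReal.ofReal_pow
      (Real.sqrt_nonneg _), Real.sq_sqrt hs, ENNReal.ofReal_sum_of_nonneg fun _ _ => sq_nonneg _]
    simp only [← ofReal_norm, ENNReal.ofReal_pow (norm_nonneg _)]
  simp only [← h4]
  calc _ ≤ 4 * ∫⁻ z, ‖φ z‖ₑ ^ 2 := by gcongr; exact Measure.restrict_le_self
    _ ≤ _ := four_mul_lintegral_sq_le hφ hφc
    _ ≤ _ := by rw [h1]; exact h2

end Poincare

/-! ### The Dirichlet Laplacian and the quasi-geostrophic operator -/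

section Dirichlet

variable {D : Set (EuclideanSpace ℝ (Fin 2))}

theorem enorm_sq_eq_lintegral (u : L2 D) : ‖u‖ₑ ^ 2 = ∫⁻ z in D, ‖u z‖ₑ ^ 2 := by
  rw [Lp.enorm_def]
  simpa using eLpNorm_nnreal_pow_eq_lintegral (f := u) (μ := volume.restrict D) (p := 2) two_ne_zero

theorem norm_sq_le_of_mem_testGraph (hD : volume D ≠ ⊤) {p : L2 D × (Fin 2 → L2 D)}
    (hp : p ∈ testGraph D) : ‖p.1‖ ^ 2 ≤ volume.real D / 4 * ∑ i, ‖p.2 i‖ ^ 2 := by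
  obtain ⟨φ, h1, h2, h3, h4, h5⟩ := hp
  have h6 := four_mul_lintegral_sq_le_volume (h1.of_le (by simp)) h2 h3
  have h7 : ∫⁻ z in D, ‖φ z‖ₑ ^ 2 = ‖p.1‖ₑ ^ 2 := by
    rw [enorm_sq_eq_lintegral]
    exact lintegral_congr_ae (h4.mono fun z hz => by simp only [hz])
  have h8 : ∫⁻ z in D, ∑ i, ‖partialD i φ z‖ₑ ^ 2 = ∑ i, ‖p.2 i‖ₑ ^ 2 := by
    rw [lintegral_finsetSum _ fun i _ =>
      ((continuous_partialD (h1.of_le (by simp)) i).enorm.measurable.pow_const 2)]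
    refine Finset.sum_congr rfl fun i _ => ?_
    rw [enorm_sq_eq_lintegral]
    exact lintegral_congr_ae ((h5 i).mono fun z hz => by simp only [hz])
  rw [h7, h8] at h6
  have h9 := ENNReal.toReal_mono (ENNReal.mul_ne_top hD
    (ENNReal.sum_ne_top.2 fun i _ => ENNReal.pow_ne_top enorm_ne_top)) h6
  rw [ENNReal.toReal_mul, ENNReal.toReal_mul, ENNReal.toReal_sum
    fun i _ => ENNReal.pow_ne_top enorm_ne_top] at h9
  simp only [ENNReal.toReal_pow, toReal_enorm, ENNReal.toReal_ofNat] at h9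
  rw [div_mul_eq_mul_div, le_div_iff₀ four_pos, mul_comm]
  exact h9

/-- The Poincaré inequality on `H^1_0(D)`. -/
theorem norm_sq_le_of_mem_sobolevH10 (hD : volume D ≠ ⊤) {p : L2 D × (Fin 2 → L2 D)}
    (hp : p ∈ sobolevH10 D) : ‖p.1‖ ^ 2 ≤ volume.real D / 4 * ∑ i, ‖p.2 i‖ ^ 2 := by
  have hcl : IsClosed {p : L2 D × (Fin 2 → L2 D) |
      ‖p.1‖ ^ 2 ≤ volume.real D / 4 * ∑ i, ‖p.2 i‖ ^ 2} :=
    isClosed_le (by fun_prop) (by fun_prop)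
  exact closure_minimal (fun p hp => norm_sq_le_of_mem_testGraph hD hp) hcl hp

theorem exists_mem_testGraph {φ : EuclideanSpace ℝ (Fin 2) → ℂ} (hφ : ContDiff ℝ ∞ φ)
    (hφc : HasCompactSupport φ) (hD : tsupport φ ⊆ D) :
    ∃ p ∈ testGraph D, p.1 =ᵐ[volume.restrict D] φ := by
  have h1 : MemLp φ 2 (volume.restrict D) := hφ.continuous.memLp_of_hasCompactSupport hφc
  have h2 : ∀ i, MemLp (partialD i φ) 2 (volume.restrict D) := fun i =>
    (continuous_partialD (hφ.of_le (by simp)) i).memLp_of_hasCompactSupport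
      (hφc.fderiv_apply ℝ _)
  exact ⟨(h1.toLp φ, fun i => (h2 i).toLp _), ⟨φ, hφ, hφc, hD, h1.coeFn_toLp,
    fun i => (h2 i).coeFn_toLp⟩, h1.coeFn_toLp⟩

/-- The test functions are dense in `L²(D)`. -/
theorem eq_zero_of_forall_testGraph_inner (hDo : IsOpen D) (hD : volume D ≠ ⊤) {h : L2 D}
    (hh : ∀ p ∈ testGraph D, inner ℂ p.1 h = 0) : h = 0 := by
  have : IsFiniteMeasure (volume.restrict D) := ⟨by simpa using hD.lt_top⟩
  have hint : IntegrableOn h D volume := (Lp.memLp h).integrable one_le_two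
  have h1 := hDo.ae_eq_zero_of_integral_contDiff_smul_eq_zero (μ := volume) (f := h)
    hint.locallyIntegrableOn fun g hg hgc hgD => by
      have hs : tsupport (fun z => (g z : ℂ)) ⊆ D :=
        (tsupport_comp_subset Complex.ofReal_zero g).trans hgD
      obtain ⟨p, hp, hpg⟩ := exists_mem_testGraph (φ := fun z => (g z : ℂ))
        (Complex.ofRealCLM.contDiff.comp hg) (hgc.comp_left Complex.ofReal_zero) hs
      have h2 := hh p hp
      rw [L2.inner_def] at h2
      rw [← setIntegral_eq_integral_of_forall_compl_eq_zero (s := D) fun z hz => by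
        rw [image_eq_zero_of_notMem_tsupport fun h => hz (hgD h), zero_smul], ← h2]
      refine integral_congr_ae (hpg.mono fun z hz => ?_)
      simp only [hz, RCLike.inner_apply, Complex.conj_ofReal, Complex.real_smul]
      ring
  refine Lp.eq_zero_iff_ae_eq_zero.2 ?_
  exact (ae_restrict_iff' hDo.measurableSet).2 h1

/-- Integration by parts against a test function. -/
theorem inner_gradient_eq {p q : L2 D × (Fin 2 → L2 D)} (hq : q ∈ testGraph D)
    (hp : p ∈ sobolevH10 D) (i : Fin 2) :
    (inner ℂ q.1 (p.2 i) : ℂ) = -inner ℂ (q.2 i) p.1 := by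
  have hcl : IsClosed {p : L2 D × (Fin 2 → L2 D) |
      (inner ℂ q.1 (p.2 i) : ℂ) = -inner ℂ (q.2 i) p.1} :=
    isClosed_eq (by fun_prop) (by fun_prop)
  refine closure_minimal (fun p hp => ?_) hcl hp
  obtain ⟨φ, h1, h2, h3, h4, h5⟩ := hq
  obtain ⟨χ, k1, k2, k3, k4, k5⟩ := hp
  have hφd : ∀ z, HasFDerivAt (fun z => (starRingEnd ℂ) (φ z))
      ((Complex.conjCLE : ℂ →L[ℝ] ℂ) ∘L fderiv ℝ φ z) z := fun z =>
    (Complex.conjCLE : ℂ →L[ℝ] ℂ).hasFDerivAt.comp z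
      ((h1.differentiable (by simp)) z).hasFDerivAt
  have hφe : ∀ z, fderiv ℝ (fun z => (starRingEnd ℂ) (φ z)) z (EuclideanSpace.single i 1) =
      (starRingEnd ℂ) (partialD i φ z) := fun z => by
    rw [(hφd z).fderiv]; rfl
  have c1 : Continuous fun z => (starRingEnd ℂ) (φ z) := Complex.continuous_conj.comp h1.continuous
  have c2 : Continuous fun z => (starRingEnd ℂ) (partialD i φ z) :=
    Complex.continuous_conj.comp (continuous_partialD (h1.of_le (by simp)) i)
  have c3 : Continuous fun z => fderiv ℝ χ z (EuclideanSpace.single i 1) :=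
    continuous_partialD (k1.of_le (by simp)) i
  have h6 := integral_mul_fderiv_eq_neg_fderiv_mul_of_integrable (μ := volume)
    (f := fun z => (starRingEnd ℂ) (φ z)) (g := χ) (v := EuclideanSpace.single i 1)
    (by simp only [hφe]
        exact (c2.mul k1.continuous).integrable_of_hasCompactSupport k2.mul_left)
    ((c1.mul c3).integrable_of_hasCompactSupport (k2.fderiv_apply ℝ _).mul_left)
    ((c1.mul k1.continuous).integrable_of_hasCompactSupport k2.mul_left)
    (fun z _ => (hφd z).differentiableAt) (fun z _ => k1.differentiable (by simp) z)
  simp only [hφe] at h6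
  have e1 : (inner ℂ q.1 (p.2 i) : ℂ) =
      ∫ z, (starRingEnd ℂ) (φ z) * fderiv ℝ χ z (EuclideanSpace.single i 1) := by
    rw [L2.inner_def, ← setIntegral_eq_integral_of_forall_compl_eq_zero (μ := volume) (s := D)
      (f := fun z => (starRingEnd ℂ) (φ z) * fderiv ℝ χ z (EuclideanSpace.single i 1))
      fun z hz => by
        rw [image_eq_zero_of_notMem_tsupport (f := φ) fun h => hz (h3 h), map_zero, zero_mul]]
    refine integral_congr_ae ?_
    filter_upwards [h4, k5 i] with z hz hz2
    simp only [hz, hz2, RCLike.inner_apply, partialD]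
    ring
  have e2 : (inner ℂ (q.2 i) p.1 : ℂ) = ∫ z, (starRingEnd ℂ) (partialD i φ z) * χ z := by
    rw [L2.inner_def, ← setIntegral_eq_integral_of_forall_compl_eq_zero (μ := volume) (s := D)
      (f := fun z => (starRingEnd ℂ) (partialD i φ z) * χ z) fun z hz => by
        rw [image_eq_zero_of_notMem_tsupport (f := χ) fun h => hz (k3 h), mul_zero]]
    refine integral_congr_ae ?_
    filter_upwards [h5 i, k4] with z hz hz2
    simp only [hz, hz2, RCLike.inner_apply]
    ring
  change (inner ℂ q.1 (p.2 i) : ℂ) = -inner ℂ (q.2 i) p.1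
  rw [e1, e2, h6]

/-- A weak gradient is unique. -/
theorem eq_zero_of_zero_mem_sobolevH10 (hDo : IsOpen D) (hD : volume D ≠ ⊤) {g : Fin 2 → L2 D}
    (hg : ((0 : L2 D), g) ∈ sobolevH10 D) : g = 0 := by
  ext1 i
  refine eq_zero_of_forall_testGraph_inner hDo hD fun q hq => ?_
  rw [inner_gradient_eq (p := (0, g)) hq hg i, inner_zero_right, neg_zero]

instance : CompleteSpace (sobolevH10 D) :=
  inferInstanceAs (CompleteSpace (testGraph D).topologicalClosure)

/-- The gradient `H^1_0(D) → L²(D)²`, the target with its Hilbert space structure. -/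
def weakGradient (D : Set (EuclideanSpace ℝ (Fin 2))) :
    sobolevH10 D →L[ℂ] PiLp 2 fun _ : Fin 2 => L2 D :=
  (PiLp.continuousLinearEquiv 2 ℂ fun _ : Fin 2 => L2 D).symm.toContinuousLinearMap ∘L
    ContinuousLinearMap.snd ℂ _ _ ∘L (sobolevH10 D).subtypeL

theorem weakGradient_apply (p : sobolevH10 D) (i : Fin 2) : weakGradient D p i = p.1.2 i := rfl

theorem norm_sq_weakGradient (p : sobolevH10 D) : ‖weakGradient D p‖ ^ 2 = ∑ i, ‖p.1.2 i‖ ^ 2 :=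
  PiLp.norm_sq_eq_of_L2 _ _

/-- The Poincaré inequality: the gradient is bounded below. -/
theorem antilipschitz_weakGradient (hD : volume D ≠ ⊤) :
    ∃ K, AntilipschitzWith K (weakGradient D) := by
  refine ⟨⟨√(volume.real D / 4) + 1, by positivity⟩,
    (weakGradient D).antilipschitz_of_bound fun p => ?_⟩
  have h1 : ‖p.1.1‖ ≤ √(volume.real D / 4) * ‖weakGradient D p‖ := by
    have h2 := Real.sqrt_le_sqrt (norm_sq_le_of_mem_sobolevH10 hD p.2)
    rw [← norm_sq_weakGradient p] at h2
    rwa [Real.sqrt_sq (norm_nonneg _), Real.sqrt_mul (by positivity),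
      Real.sqrt_sq (norm_nonneg _)] at h2
  have h3 : ‖p.1.2‖ ≤ ‖weakGradient D p‖ := by
    refine (pi_norm_le_iff_of_nonneg (norm_nonneg _)).2 fun i => ?_
    refine le_of_sq_le_sq ?_ (norm_nonneg _)
    rw [norm_sq_weakGradient]
    exact Finset.single_le_sum (f := fun i => ‖p.1.2 i‖ ^ 2) (fun _ _ => sq_nonneg _)
      (Finset.mem_univ i)
  change ‖p.1‖ ≤ (√(volume.real D / 4) + 1) * ‖weakGradient D p‖
  have h4 := norm_nonneg (weakGradient D p)
  rw [add_mul, one_mul]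
  exact max_le (by linarith) (by nlinarith [Real.sqrt_nonneg (volume.real D / 4)])

theorem inner_weakGradient (q p : sobolevH10 D) :
    (inner ℂ (weakGradient D q) (weakGradient D p) : ℂ) = ∑ i, inner ℂ (q.1.2 i) (p.1.2 i) := rfl

/-- A bounded-below operator `T` identifies its domain with a complete subspace `V`, on which any
other operator `J` becomes a bounded operator `E`. -/
theorem exists_continuousLinearMap_range {S X H : Type*} [NormedAddCommGroup S] [NormedSpace ℂ S]
    [CompleteSpace S] [NormedAddCommGroup X] [NormedSpace ℂ X] [CompleteSpace X]
    [NormedAddCommGroup H] [NormedSpace ℂ H] (T : S →L[ℂ] X) {K : NNReal}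
    (hK : AntilipschitzWith K T) (J : S →L[ℂ] H) :
    ∃ (V : Submodule ℂ X) (_ : CompleteSpace V) (E : V →L[ℂ] H) (L : S → V),
      Function.Surjective L ∧ ∀ p, (L p : X) = T p ∧ ‖L p‖ = ‖T p‖ ∧ E (L p) = J p := by
  have hclo := hK.isClosed_range T.uniformContinuous
  refine ⟨T.range, hclo.completeSpace_coe,
    J ∘L (T.equivRange hK.injective hclo).symm.toContinuousLinearMap,
    T.equivRange hK.injective hclo, (T.equivRange hK.injective hclo).surjective,
    fun p => ⟨rfl, rfl, ?_⟩⟩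
  change J ((T.equivRange hK.injective hclo).symm (T.equivRange hK.injective hclo p)) = J p
  rw [ContinuousLinearEquiv.symm_apply_apply]

set_option maxHeartbeats 800000 in
/-- By the Poincaré inequality the gradients of the functions of `H^1_0(D)` form a Hilbert space
`V`, and `E : V → L²(D)`, `∇u ↦ u`, is bounded. In these terms the Dirichlet Laplacian is
`Δ⁻¹ = -E E†`, and `∇Δ⁻¹ = -E†`. -/
theorem exists_gradient_space (hDo : IsOpen D) (hD : volume D ≠ ⊤) :
    ∃ (V : Submodule ℂ (PiLp 2 fun _ : Fin 2 => L2 D)) (_ : CompleteSpace V) (E : V →L[ℂ] L2 D),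
      (∀ g, ‖E g‖ ^ 2 ≤ volume.real D / 4 * ‖g‖ ^ 2) ∧
      (∀ u, ContinuousLinearMap.adjoint E u = 0 → u = 0) ∧
      (∀ u ℓ, (u, ℓ) ∈ dirichletLaplacian D ↔ u = -E (ContinuousLinearMap.adjoint E ℓ)) ∧
      ∀ ℓ g, (-E (ContinuousLinearMap.adjoint E ℓ), g) ∈ sobolevH10 D ↔
        g = fun i => -(ContinuousLinearMap.adjoint E ℓ : PiLp 2 fun _ : Fin 2 => L2 D) i := by
  obtain ⟨K, hK⟩ := antilipschitz_weakGradient hD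
  obtain ⟨V, _, E, T, hsurj, hT⟩ := exists_continuousLinearMap_range (weakGradient D) hK
    (ContinuousLinearMap.fst ℂ (L2 D) (Fin 2 → L2 D) ∘L (sobolevH10 D).subtypeL)
  have hTE : ∀ p, E (T p) = p.1.1 := fun p => (hT p).2.2
  have hinner : ∀ (p q : sobolevH10 D),
      (inner ℂ (T q) (T p) : ℂ) = ∑ i, inner ℂ (q.1.2 i) (p.1.2 i) := fun p q => by
    rw [Submodule.coe_inner, (hT q).1, (hT p).1, inner_weakGradient]
  set E' := ContinuousLinearMap.adjoint E with hE'
  have hdual : ∀ (p : sobolevH10 D) (ℓ : L2 D),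
      (∀ q ∈ testGraph D, ∑ i, inner ℂ (q.2 i) (p.1.2 i) = -inner ℂ q.1 ℓ) ↔ T p = -E' ℓ := by
    intro p ℓ
    constructor
    · intro h
      have hcl : IsClosed {q : L2 D × (Fin 2 → L2 D) |
          ∑ i, (inner ℂ (q.2 i) (p.1.2 i) : ℂ) = -inner ℂ q.1 ℓ} :=
        isClosed_eq (by fun_prop) (by fun_prop)
      refine ext_inner_left ℂ fun k => ?_
      obtain ⟨q, rfl⟩ := hsurj k
      rw [hinner, inner_neg_right, hE', ContinuousLinearMap.adjoint_inner_right, hTE]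
      exact closure_minimal (fun q hq => h q hq) hcl q.2
    · intro h q hq
      have hq' : q ∈ sobolevH10 D := subset_closure hq
      have h1 := hinner p ⟨q, hq'⟩
      rw [h, inner_neg_right, hE', ContinuousLinearMap.adjoint_inner_right, hTE] at h1
      exact h1.symm
  refine ⟨V, inferInstance, E, ?_, ?_, ?_, ?_⟩
  · intro g
    obtain ⟨p, rfl⟩ := hsurj g
    rw [hTE, (hT p).2.1, norm_sq_weakGradient]
    exact norm_sq_le_of_mem_sobolevH10 hD p.2
  · intro u hu
    refine eq_zero_of_forall_testGraph_inner hDo hD fun q hq => ?_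
    have h1 := hTE ⟨q, subset_closure hq⟩
    rw [← h1, ← ContinuousLinearMap.adjoint_inner_right, hu, inner_zero_right]
  · intro u ℓ
    constructor
    · rintro ⟨g, hg, hg2⟩
      have h1 := (hdual ⟨(u, g), hg⟩ ℓ).1 hg2
      rw [← map_neg, ← h1, hTE]
    · intro hu
      obtain ⟨p, hp⟩ := hsurj (-E' ℓ)
      rw [← map_neg, ← hp, hTE] at hu
      exact ⟨p.1.2, hu ▸ p.2, (hdual p ℓ).2 hp⟩
  · intro ℓ g
    obtain ⟨p, hp⟩ := hsurj (-E' ℓ)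
    have h1 : p.1.2 = fun i => -(E' ℓ : PiLp 2 fun _ : Fin 2 => L2 D) i := by
      ext1 i
      rw [← weakGradient_apply, ← (hT p).1, hp, Submodule.coe_neg, PiLp.neg_apply]
    have h2 : -E (E' ℓ) = p.1.1 := by rw [← map_neg, ← hp, hTE]
    have h5 : (-E (E' ℓ), g) ∈ sobolevH10 D ↔ (p.1.1, g) ∈ sobolevH10 D := by rw [h2]
    refine h5.trans (Iff.trans ?_ (by rw [h1] : g = p.1.2 ↔ _))
    constructor
    · intro hg
      have h3 := (sobolevH10 D).sub_mem hg p.2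
      have h4 : ((p.1.1, g) - p.1 : L2 D × (Fin 2 → L2 D)) = (0, g - p.1.2) :=
        Prod.ext (sub_self _) rfl
      rw [h4] at h3
      exact sub_eq_zero.1 (eq_zero_of_zero_mem_sobolevH10 hDo hD h3)
    · rintro rfl
      exact p.2

/-- The quasi-geostrophic operator is the inverse of a bounded injective sectorial operator: it is
given by a coercive form, with `Q u = -∂_x Δ⁻¹ u`. -/
theorem exists_isSectorialInverse_qgOperator (hDo : IsOpen D) (hDb : Bornology.IsBounded D)
    {ν r β : ℝ} (hν : 0 < ν) (hr : 0 < r) (hβ : 0 < β)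
    (hcond : β ^ 2 * volume.real D ^ 2 / Real.pi ^ 2 < 4 * ν * r) :
    ∃ (G : L2 D →L[ℂ] L2 D) (c K : ℝ), IsSectorialInverse G c K ∧
      ∀ x y, (x, y) ∈ (qgOperator D ν r β).graph ↔ x = G y := by
  have hD : volume D ≠ ⊤ := hDb.measure_lt_top.ne
  obtain ⟨V, _, E, hE, hE0, hL, hgrad⟩ := exists_gradient_space hDo hD
  set E' := ContinuousLinearMap.adjoint E with hE'
  have hκ : 0 ≤ volume.real D / 4 := by positivity
  have hE'n : ∀ u, ‖E' u‖ ^ 2 ≤ volume.real D / 4 * ‖u‖ ^ 2 := by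
    intro u
    have h1 : ‖E‖ ≤ √(volume.real D / 4) :=
      E.opNorm_le_bound (Real.sqrt_nonneg _) fun g => by
        have h2 := Real.sqrt_le_sqrt (hE g)
        rwa [Real.sqrt_sq (norm_nonneg _), Real.sqrt_mul hκ, Real.sqrt_sq (norm_nonneg _)] at h2
    have h3 : ‖E' u‖ ≤ √(volume.real D / 4) * ‖u‖ := by
      refine (E'.le_opNorm u).trans (mul_le_mul_of_nonneg_right ?_ (norm_nonneg _))
      rwa [hE', LinearIsometryEquiv.norm_map]
    calc _ ≤ (√(volume.real D / 4) * ‖u‖) ^ 2 := pow_le_pow_left₀ (norm_nonneg _) h3 2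
      _ = _ := by rw [mul_pow, Real.sq_sqrt hκ]
  set Q : L2 D →L[ℂ] L2 D := (PiLp.proj 2 (fun _ : Fin 2 => L2 D) 0 : _ →L[ℂ] L2 D) ∘L
    V.subtypeL ∘L E' with hQdef
  have hQapp : ∀ u, Q u = (E' u : PiLp 2 fun _ : Fin 2 => L2 D) 0 := fun u => rfl
  have hQ : ∀ u, ‖Q u‖ ^ 2 ≤ volume.real D / 4 * ‖u‖ ^ 2 := by
    intro u
    refine le_trans ?_ (hE'n u)
    rw [hQapp]
    exact pow_le_pow_left₀ (norm_nonneg _) (PiLp.norm_apply_le _ _) 2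
  -- The Poincaré constant `|D| / 4` is below the `|D| / π` of the hypothesis.
  have hcond' : β ^ 2 * (volume.real D / 4) ^ 2 < 4 * ν * r := by
    refine lt_of_le_of_lt ?_ hcond
    rw [mul_div_assoc, ← div_pow]
    gcongr
    exact Real.pi_le_four
  obtain ⟨G, c, K, hG, hGx⟩ := exists_isSectorialInverse_of_form E Q hν hr hβ.le hκ hcond' hE hQ hE0
  have hgraph : ∀ x y, (x, y) ∈ qgGraph D ν r β ↔ x = G y := by
    intro x y
    rw [← hGx x y]
    constructor
    · rintro ⟨ℓ, ψ, q, h1, h2, h3, h4⟩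
      have h5 := (hL _ _).1 h2
      dsimp only at h1 h2 h3 h4 h5
      rw [h5] at h3
      have h6 := (hgrad _ _).1 h3
      refine ⟨-ℓ, ?_, ?_⟩
      · rw [(hL _ _).1 h1, map_neg, map_neg]
      · rw [h4, h6, hQapp, smul_neg, smul_neg, sub_eq_add_neg]
    · rintro ⟨w, hx, hy⟩
      refine ⟨-w, -E (E' x), fun i => -(E' x : PiLp 2 fun _ : Fin 2 => L2 D) i, (hL _ _).2 ?_,
        (hL _ _).2 rfl, (hgrad _ _).2 rfl, ?_⟩
      · rw [map_neg, map_neg, neg_neg]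
        exact hx
      · simp only [hy, hQapp, smul_neg, neg_neg, sub_eq_add_neg]
  refine ⟨G, c, K, hG, fun x y => ?_⟩
  rw [qgOperator, Submodule.toLinearPMap_graph_eq, hgraph]
  rintro ⟨x, y⟩ hxy hx
  dsimp only at hx ⊢
  rw [hgraph, hx] at hxy
  exact hG.eq_zero y hxy.symm

end Dirichlet

end

theorem lemma3p1 (D : Set (EuclideanSpace ℝ (Fin 2))) (hDopen : IsOpen D)
    (hDbdd : Bornology.IsBounded D) (ν r β : ℝ) (hν : 0 < ν) (hr : 0 < r) (hβ : 0 < β)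
    (hcond : β ^ 2 * volume.real D ^ 2 / Real.pi ^ 2 < 4 * ν * r)
    (α γ : ℝ) (hαγ : α - γ < 1)
    (f : ℝ → FracDom (qgOperator D ν r β) γ) (f₀ : FracDom (qgOperator D ν r β) γ)
    (hf : HasTimeAverage f f₀) :
    ∃ v : ℝ → ℝ → FracDom (qgOperator D ν r β) α,
      (∀ ε : ℝ, 0 < ε →
        Continuous (v ε) ∧ (∃ C : ℝ, ∀ τ, ‖v ε τ‖ ≤ C) ∧
        IsSolution (qgOperator D ν r β) ε f₀ f (v ε) ∧
        ∀ w : ℝ → FracDom (qgOperator D ν r β) α, (∃ C : ℝ, ∀ τ, ‖w τ‖ ≤ C) →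
          IsSolution (qgOperator D ν r β) ε f₀ f w → w = v ε) ∧
      TendstoUniformly (fun ε τ => ε • v ε τ) (fun _ => 0) (𝓝[>] (0 : ℝ)) ∧
      (IsAlmostPeriodic f → ∀ ε : ℝ, 0 < ε →
        IsAlmostPeriodic (v ε) ∧
        (∀ Ω : Set ℝ, IsFrequencyBasis Ω f → ∃ Ω' ⊆ Ω, IsFrequencyBasis Ω' (v ε)) ∧
        frequencyModule (v ε) ≤ frequencyModule f) := by
  obtain ⟨G, c, K, hG, hA⟩ := exists_isSectorialInverse_qgOperator hDopen hDbdd hν hr hβ hcond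
  obtain ⟨v, h1, h2, h3⟩ := hG.averaging hA hαγ f f₀ hf
  refine ⟨v, h1, h2, fun hfap ε hε => ?_⟩
  obtain ⟨h4, h5⟩ := h3 hfap ε hε
  exact ⟨h4, fun Ω hΩ => ⟨Ω, subset_rfl, hΩ.1, fun lam hlam => hΩ.2 lam (h5 hlam)⟩,
    Submodule.span_mono h5⟩
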